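/- Let $\rho>0$ and let $\alpha,\beta\in\mathbb C\cup\{\infty\}$ be such that $\alpha,\ \beta,\ -1/\bar\alpha,\ -1/\bar\beta$ are distinct. For $z,w\in\mathbb C\cup\{\infty\}$ put $$k_{zw}=\frac{|1+\bar z w|}{\sqrt{(1+|z|^2)(1+|w|^2)}},\qquad k'_{zw}=\frac{|z-w|}{\sqrt{(1+|z|^2)(1+|w|^2)}},\qquad \delta_{zw}=2\arccos k_{zw}\in[0,\pi]$$ (extended by continuity to $\infty$; $\delta$ is the Fubini–Study distance), and $k=k_{\alpha\beta}$, $k'=k'_{\alpha\beta}$, so $0<k,k'<1$ and $k^2+k'^2=1$. Let $F(\sin\varphi,k)=\int_0^\varphi d\theta/\sqrt{1-k^2\sin^2\theta}$ ($|\varphi|\le\pi/2$), $K(k)=F(1,k)$, and let $\mathrm{sn},\mathrm{cn},\mathrm{dn}$ be the Jacobi elliptic functions of modulus $k$, i.e. the meromorphic functions on $\mathbb C$ with $\mathrm{sn}\,F(x,k)=x$, $\mathrm{cn}\,F(x,k)=\sqrt{1-x^2}$, $\mathrm{dn}\,F(x,k)=\sqrt{1-k^2x^2}$ for $-1<x<1$.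 Let $\omega=K(k)/\sqrt\rho$, $\omega'=iK(k')/\sqrt\rho$, $\omega_2=-\omega-\omega'$, $\Lambda=2\omega\mathbb Z+2\omega'\mathbb Z$, let $\wp$ be the Weierstrass function of $\Lambda$, and $e_1=\frac{\rho}{3}(2-k^2)$, $e_3=-\frac{\rho}{3}(1+k^2)$. For $\zeta\in\mathbb C\cup\{\infty\}$ let $X_\zeta\in\mathbb C\cup\{\infty\}$ be defined by $$\frac{X_\zeta-e_3}{e_1-e_3}=\Big[\zeta,-\tfrac1{\bar\alpha},\alpha,\beta\Big],\qquad [z_1,z_2,z_3,z_4]=\frac{(z_1-z_3)(z_2-z_4)}{(z_1-z_4)(z_2-z_3)}.$$ A complex number $u$ is called an Abel–Jacobi image of $\zeta$, written $u_\zeta$, if $\wp(u)=X_\zeta$ (with $\wp=\infty$ on $\Lambda$). Fix any $\zeta\in\mathbb C\cup\{\infty\}$. (i) For every Abel–Jacobi image $u_\zeta$, $$\mathrm{cn}[\sqrt\rho(u_\zeta\pm\bar u_\zeta)]=\frac{k'_{\alpha\beta}}{k_{\alpha\beta}}\,\frac{k_{\alpha\zeta}k'_{\alpha\zeta}\mp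 k_{\beta\zeta}k'_{\beta\zeta}}{k'^2_{\alpha\zeta}-k'^2_{\beta\zeta}}=\frac{\tan\frac{\delta_{\alpha\beta}}2}{\tan\frac{\delta_{\alpha\zeta}\pm\delta_{\beta\zeta}}2},$$ $$\mathrm{dn}[\sqrt\rho(u_\zeta\pm\bar u_\zeta)]=k'_{\alpha\beta}\,\frac{k_{\beta\zeta}k'_{\alpha\zeta}\mp k_{\alpha\zeta}k'_{\beta\zeta}}{k_{\beta\zeta}^2-k_{\alpha\zeta}^2}=\frac{\sin\frac{\delta_{\alpha\beta}}2}{\sin\frac{\delta_{\alpha\zeta}\pm\delta_{\beta\zeta}}2}$$ whenever $\delta_{\alpha\zeta}\ne\delta_{\beta\zeta}$. If $\delta_{\alpha\zeta}=\delta_{\beta\zeta}$, the outer equalities still hold for the upper sign, and for the lower sign $\mathrm{cn}$ and $\mathrm{dn}$ have poles. (The quotient of tangents is $0$ if $\delta_{\alpha\zeta}+\delta_{\beta\zeta}=\pi$.) (ii) If $u_\zeta$ is an Abel–Jacobi image of $\zeta$, then $\omega_2-\bar u_\zeta$ is an Abel–Jacobi image of $-1/\bar\zeta$. (iii) Let $u_\zeta$,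 $u_{-1/\bar\zeta}$ be Abel–Jacobi images of $\zeta$, $-1/\bar\zeta$ with $\bar u_\zeta+u_{-1/\bar\zeta}=\omega_2+2m\omega+2m'\omega'$, $m,m'\in\mathbb Z$, and put $u^\pm_\zeta=u_\zeta\pm u_{-1/\bar\zeta}$. Then $$\mathrm{sn}(\sqrt\rho\,u^\pm_\zeta)=\mp(-1)^m\sec\frac{\delta_{\alpha\zeta}\mp\delta_{\beta\zeta}}2,\qquad \mathrm{sn}[\sqrt\rho(u^\pm_\zeta-\omega')]=\mp(-1)^m\,\frac{\cos\frac{\delta_{\alpha\zeta}\mp\delta_{\beta\zeta}}2}{\cos\frac{\delta_{\alpha\beta}}2},$$ where an infinite secant (lower sign, $\delta_{\alpha\zeta}+\delta_{\beta\zeta}=\pi$) means a pole. In particular each of the two classes $u_\zeta^\pm$ modulo $\Lambda$ has a representative in $\mathbb C$ for which both formulas hold with the sign $\mp(-1)^m$ replaced by $+$. (iv) There is a real $D_\zeta$ with $\sin\frac{\pi-\delta_{\alpha\zeta}-\delta_{\beta\zeta}}2=k\sin D_\zeta$. There are Abel–Jacobi images $u_\zeta,u_{-1/\bar\zeta}$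 with $\bar u_\zeta+u_{-1/\bar\zeta}=\omega_2$ and $-\omega\le\mathrm{Re}\,u_\zeta\le0$, and for all of them and every such $D_\zeta$, $$u^-_\zeta=\frac1{\sqrt\rho}F(\sin D_\zeta,k)+\omega',$$ where the first term is real and $\omega'$ is purely imaginary. -/

import Mathlib

open scoped ComplexConjugate

noncomputable section

/-! ### The round sphere `ℂ ∪ {∞}` -/

/-- Homogeneous coordinates of a point of the sphere: `[z : 1]` for `z ∈ ℂ` and `[1 : 0]` for `∞`. -/
def sphereCoord (z : OnePoint ℂ) : ℂ × ℂ :=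
  z.elim (1, 0) fun w => (w, 1)

/-- The antipodal map `ζ ↦ -1 / conj ζ`, exchanging `0` and `∞`. -/
def antipode (z : OnePoint ℂ) : OnePoint ℂ :=
  open Classical in
  z.elim ((0 : ℂ) : OnePoint ℂ) fun w =>
    if w = 0 then OnePoint.infty else ((-1 / conj w : ℂ) : OnePoint ℂ)

/-- Homogeneous form of the Hermitian product `1 + conj z * w`. -/
def sphereInner (z w : OnePoint ℂ) : ℂ :=
  conj (sphereCoord z).1 * (sphereCoord w).1 + conj (sphereCoord z).2 * (sphereCoord w).2

/-- Homogeneous form of the difference `z - w`. -/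
def sphereDet (z w : OnePoint ℂ) : ℂ :=
  (sphereCoord z).1 * (sphereCoord w).2 - (sphereCoord w).1 * (sphereCoord z).2

/-- Homogeneous form of `√(1 + |z|²)`. -/
def sphereNorm (z : OnePoint ℂ) : ℝ :=
  √(‖(sphereCoord z).1‖ ^ 2 + ‖(sphereCoord z).2‖ ^ 2)

/-- `k_{zw} = |1 + conj z * w| / √((1 + |z|²) (1 + |w|²))`. -/
def chordK (z w : OnePoint ℂ) : ℝ := ‖sphereInner z w‖ / (sphereNorm z * sphereNorm w)

/-- `k'_{zw} = |z - w| / √((1 + |z|²) (1 + |w|²))`. -/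
def chordK' (z w : OnePoint ℂ) : ℝ := ‖sphereDet z w‖ / (sphereNorm z * sphereNorm w)

/-- The Fubini–Study distance `δ_{zw} = 2 arccos k_{zw}`. -/
def fsDist (z w : OnePoint ℂ) : ℝ := 2 * Real.arccos (chordK z w)

/-- The cross-ratio `(z₁ - z₃) (z₂ - z₄) / ((z₁ - z₄) (z₂ - z₃))`, in homogeneous coordinates; it is
meant for `z₁ ≠ z₄`, `z₂ ≠ z₃`. -/
def crossRatio (z₁ z₂ z₃ z₄ : OnePoint ℂ) : ℂ :=
  (sphereDet z₁ z₃ * sphereDet z₂ z₄) / (sphereDet z₁ z₄ * sphereDet z₂ z₃)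

@[simp] theorem sphereCoord_coe (z : ℂ) : sphereCoord (z : OnePoint ℂ) = (z, 1) := rfl

@[simp] theorem sphereCoord_infty : sphereCoord OnePoint.infty = (1, 0) := rfl

@[simp] theorem antipode_infty : antipode OnePoint.infty = ((0 : ℂ) : OnePoint ℂ) := rfl

theorem antipode_coe_zero : antipode ((0 : ℂ) : OnePoint ℂ) = OnePoint.infty := if_pos rfl

theorem antipode_coe {z : ℂ} (hz : z ≠ 0) :
    antipode (z : OnePoint ℂ) = ((-1 / conj z : ℂ) : OnePoint ℂ) := if_neg hz

theorem chordK_coe (z w : ℂ) :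
    chordK (z : OnePoint ℂ) w = ‖1 + conj z * w‖ / √((1 + ‖z‖ ^ 2) * (1 + ‖w‖ ^ 2)) := by
  rw [Real.sqrt_mul (by positivity)]
  simp [chordK, sphereInner, sphereNorm, add_comm]

theorem chordK'_coe (z w : ℂ) :
    chordK' (z : OnePoint ℂ) w = ‖z - w‖ / √((1 + ‖z‖ ^ 2) * (1 + ‖w‖ ^ 2)) := by
  rw [Real.sqrt_mul (by positivity)]
  simp [chordK', sphereDet, sphereNorm, add_comm]

theorem crossRatio_coe (z₁ z₂ z₃ z₄ : ℂ) :
    crossRatio (z₁ : OnePoint ℂ) z₂ z₃ z₄ = ((z₁ - z₃) * (z₂ - z₄)) / ((z₁ - z₄) * (z₂ - z₃)) := by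
  simp [crossRatio, sphereDet]

theorem sphereNorm_pos (z : OnePoint ℂ) : 0 < sphereNorm z := by
  induction z using OnePoint.rec with
  | infty => simp [sphereNorm]
  | coe z =>
    simp only [sphereNorm, sphereCoord_coe, norm_one]
    positivity

theorem chordK_sq_add_sq (z w : OnePoint ℂ) : chordK z w ^ 2 + chordK' z w ^ 2 = 1 := by
  have hz := sphereNorm_pos z
  have hw := sphereNorm_pos w
  have key : ‖sphereInner z w‖ ^ 2 + ‖sphereDet z w‖ ^ 2
      = (sphereNorm z * sphereNorm w) ^ 2 := by
    rw [mul_pow, sphereNorm, sphereNorm, Real.sq_sqrt (by positivity),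
      Real.sq_sqrt (by positivity)]
    simp only [sphereInner, sphereDet, ← Complex.normSq_eq_norm_sq, Complex.normSq_apply,
      Complex.add_re, Complex.add_im, Complex.sub_re, Complex.sub_im, Complex.mul_re,
      Complex.mul_im, Complex.conj_re, Complex.conj_im]
    ring
  rw [chordK, chordK', div_pow, div_pow, ← add_div, key, div_self (by positivity)]

theorem eq_of_sphereDet_eq_zero {z w : OnePoint ℂ} (h : sphereDet z w = 0) : z = w := by
  induction z using OnePoint.rec with
  | infty =>
    induction w using OnePoint.rec with
    | infty => rfl
    | coe w => simp [sphereDet] at h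
  | coe z =>
    induction w using OnePoint.rec with
    | infty => simp [sphereDet] at h
    | coe w => simpa [sphereDet, sub_eq_zero] using h

theorem eq_antipode_of_sphereInner_eq_zero {z w : OnePoint ℂ} (h : sphereInner z w = 0) :
    w = antipode z := by
  induction z using OnePoint.rec with
  | infty =>
    induction w using OnePoint.rec with
    | infty => simp [sphereInner] at h
    | coe w => simpa [sphereInner] using h
  | coe z =>
    induction w using OnePoint.rec with
    | infty =>
      have hz : z = 0 := by simpa [sphereInner] using h
      rw [hz, antipode_coe_zero]
    | coe w =>
      have h' : conj z * w + 1 = 0 := by simpa [sphereInner] using h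
      have hz : z ≠ 0 := by
        rintro rfl
        simp at h'
      have hz' : conj z ≠ 0 := by simpa using hz
      rw [antipode_coe hz, OnePoint.coe_eq_coe, eq_div_iff hz']
      linear_combination h'

/-! ### Elliptic integrals and Jacobi elliptic functions -/

/-- Legendre's incomplete elliptic integral of the first kind
`F(x, k) = ∫₀^φ dθ / √(1 - k² sin² θ)` with `x = sin φ`, `|φ| ≤ π/2`. -/
def ellipticF (x k : ℝ) : ℝ :=
  ∫ θ in (0 : ℝ)..Real.arcsin x, 1 / √(1 - k ^ 2 * Real.sin θ ^ 2)

/-- The complete elliptic integral of the first kind, `K(k) = F(1, k)`. -/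
def ellipticK (k : ℝ) : ℝ := ellipticF 1 k

/-- `f` is the meromorphic function on `ℂ` with `f (F(x, k)) = g x` for `-1 < x < 1`. Being in normal
form, `f` takes the value `0` at its poles; by the identity theorem there is at most one such `f`
when `0 < k < 1`. -/
def InvertsEllipticF (k : ℝ) (g : ℝ → ℝ) (f : ℂ → ℂ) : Prop :=
  MeromorphicNFOn f Set.univ ∧ ∀ x ∈ Set.Ioo (-1 : ℝ) 1, f (ellipticF x k : ℂ) = (g x : ℂ)

/-- The function characterized by `InvertsEllipticF k g`. -/
def jacobiExtension (k : ℝ) (g : ℝ → ℝ) : ℂ → ℂ :=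
  open Classical in if h : ∃ f, InvertsEllipticF k g f then h.choose else 0

/-- `sn(·, k)`: the meromorphic function with `sn F(x, k) = x`. -/
def jacobiSn (k : ℝ) : ℂ → ℂ := jacobiExtension k fun x => x

/-- `cn(·, k)`: the meromorphic function with `cn F(x, k) = √(1 - x²)`. -/
def jacobiCn (k : ℝ) : ℂ → ℂ := jacobiExtension k fun x => √(1 - x ^ 2)

/-- `dn(·, k)`: the meromorphic function with `dn F(x, k) = √(1 - k² x²)`. -/
def jacobiDn (k : ℝ) : ℂ → ℂ := jacobiExtension k fun x => √(1 - k ^ 2 * x ^ 2)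

/-- `f` is holomorphic at `v`, with the (real) value `r` there. -/
def HasValueAt (f : ℂ → ℂ) (v : ℂ) (r : ℝ) : Prop := AnalyticAt ℂ f v ∧ f v = (r : ℂ)

/-- `f` has a pole at `v`. -/
def HasPoleAt (f : ℂ → ℂ) (v : ℂ) : Prop := MeromorphicAt f v ∧ meromorphicOrderAt f v < 0

theorem ellipticK_pos {k : ℝ} (h0 : 0 < k) (h1 : k < 1) : 0 < ellipticK k := by
  have hpos : ∀ θ : ℝ, 0 < 1 - k ^ 2 * Real.sin θ ^ 2 := by
    intro θ
    have h2 : k ^ 2 < 1 := by nlinarith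
    nlinarith [Real.sin_sq_le_one θ, sq_nonneg (Real.sin θ), sq_nonneg k]
  have hc : Continuous fun θ : ℝ => 1 / √(1 - k ^ 2 * Real.sin θ ^ 2) := by
    refine continuous_const.div (by fun_prop) fun θ => ?_
    exact (Real.sqrt_pos.2 (hpos θ)).ne'
  rw [ellipticK, ellipticF, Real.arcsin_one]
  refine intervalIntegral.intervalIntegral_pos_of_pos (hc.intervalIntegrable _ _) (fun θ => ?_)
    (by positivity)
  exact div_pos one_pos (Real.sqrt_pos.2 (hpos θ))

/-! ### The curve of an `O(4)` multiplet -/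

/-- The `O(4)` multiplet with scale `ρ > 0` and roots `α`, `β`, `-1 / conj α`, `-1 / conj β`, the four
roots being distinct. -/
structure O4Multiplet where
  ρ : ℝ
  α : OnePoint ℂ
  β : OnePoint ℂ
  ρ_pos : 0 < ρ
  ne : α ≠ β
  ne_antipode : β ≠ antipode α

namespace O4Multiplet

variable (C : O4Multiplet)

/-- The elliptic modulus `k = k_{αβ}`. -/
def k : ℝ := chordK C.α C.β

/-- The complementary modulus `k' = k'_{αβ}`. -/
def k' : ℝ := chordK' C.α C.β

theorem k_pos : 0 < C.k := by
  refine div_pos (norm_pos_iff.2 fun h => ?_) (mul_pos (sphereNorm_pos _) (sphereNorm_pos _))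
  exact C.ne_antipode (eq_antipode_of_sphereInner_eq_zero h)

theorem k'_pos : 0 < C.k' := by
  refine div_pos (norm_pos_iff.2 fun h => ?_) (mul_pos (sphereNorm_pos _) (sphereNorm_pos _))
  exact C.ne (eq_of_sphereDet_eq_zero h)

theorem k_sq_add_sq : C.k ^ 2 + C.k' ^ 2 = 1 := chordK_sq_add_sq _ _

theorem k_lt_one : C.k < 1 := by nlinarith [C.k_sq_add_sq, C.k_pos, C.k'_pos]

theorem k'_lt_one : C.k' < 1 := by nlinarith [C.k_sq_add_sq, C.k_pos, C.k'_pos]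

/-- The Weierstrass root `e₁`. -/
def e₁ : ℝ := -(C.ρ / 3) * (C.k ^ 2 - 2)

/-- The Weierstrass root `e₃`. -/
def e₃ : ℝ := -(C.ρ / 3) * (C.k ^ 2 + 1)

/-- The real half-period `ω = K(k) / √ρ`. -/
def ω : ℝ := ellipticK C.k / √C.ρ

/-- The imaginary half-period `ω' = i K(k') / √ρ`. -/
def ω' : ℂ := Complex.I * ((ellipticK C.k' / √C.ρ : ℝ) : ℂ)

/-- The third half-period `ω₂`, with the convention `ω + ω₂ + ω' = 0`. -/
def ω₂ : ℂ := -((C.ω : ℂ) + C.ω')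

/-- The periods `2ω`, `2ω'`. -/
def periods : PeriodPair where
  ω₁ := 2 * (C.ω : ℂ)
  ω₂ := 2 * C.ω'
  indep := by
    have hω : C.ω ≠ 0 :=
      (div_pos (ellipticK_pos C.k_pos C.k_lt_one) (Real.sqrt_pos.2 C.ρ_pos)).ne'
    have hω' : ellipticK C.k' / √C.ρ ≠ 0 :=
      (div_pos (ellipticK_pos C.k'_pos C.k'_lt_one) (Real.sqrt_pos.2 C.ρ_pos)).ne'
    rw [LinearIndependent.pair_iff]
    intro s t h
    rw [ω'] at h
    have hre := congrArg Complex.re h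
    have him := congrArg Complex.im h
    constructor
    · simpa [-Complex.ofReal_div, hω] using hre
    · simpa [-Complex.ofReal_div, -div_eq_zero_iff, hω'] using him

/-- The lattice `Λ = ℤ 2ω + ℤ 2ω'`. -/
def Λ : Submodule ℤ ℂ := C.periods.lattice

/-- The `X`-coordinate `X_ζ` on the Weierstrass cubic of a point of the curve over `ζ`, given by
`[ζ, -1 / conj α, α, β] = (X_ζ - e₃) / (e₁ - e₃)`; it is `∞` for `ζ = β`. -/
def X (ζ : OnePoint ℂ) : OnePoint ℂ :=
  open Classical in
  if ζ = C.β then OnePoint.infty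
  else (((C.e₃ : ℂ) + ((C.e₁ : ℂ) - C.e₃) * crossRatio ζ (antipode C.α) C.α C.β : ℂ) : OnePoint ℂ)

/-- The Weierstrass function of the lattice `Λ`, as a map to `ℂ ∪ {∞}`. -/
def wp (u : ℂ) : OnePoint ℂ :=
  open Classical in
  if u ∈ C.Λ then OnePoint.infty else ((C.periods.weierstrassP u : ℂ) : OnePoint ℂ)

/-- `u` represents an Abel–Jacobi image `u_ζ` of a point of the curve over `ζ`. The two points over
`ζ` correspond to `± u` modulo `Λ`. -/
def IsAbelJacobi (ζ : OnePoint ℂ) (u : ℂ) : Prop := C.wp u = C.X ζ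

end O4Multiplet

end

open Complex (I)

open scoped Topology

noncomputable section

/-! Put `v = √ρ u = x + iy` and write `ns = 1/sn`, `cs = cn/sn`, `ds = dn/sn`, `cd = cn/dn`. By
Liouville's theorem `℘(u) = e₃ + ρ ns² v` (`weierstrassP_eq`), so an Abel–Jacobi image of `ζ` is a
solution of `ns² v = [ζ, -1/conj α, α, β]`. This cross-ratio, the cross-ratio minus `1` and the
cross-ratio minus `k²` all factor into Hermitian products and determinants. Hence the moduli of `ns²
v`, `cs² v = ns² v - 1` and `ds² v = ns² v - k²` are quotients of chords from `ζ` to `α` and `β`. On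
the elliptic side the same moduli are quotients of four real polynomials in the Jacobi functions of
`x` (modulus `k`) and `y` (modulus `k'`). These four numbers are therefore, up to a common factor
and constants in `k` and `k'`, the sines and cosines of `δα/2` and `δβ/2` (`exists_scale`).

The addition theorem for `v ± conj v` expresses `cn` and `dn` of `2x` and `2y` through the four
numbers (`rcn_two_mul_re` and its companions). After substitution the bilinear combinations collapse
to sines and cosines of `(δα ± δβ)/2` (`duplication_re`, `duplication_im`). As `√ρ(u ± conj u)` is
`2x` or `2iy`, this gives the formulas for `cn` and `dn`.

Up to conjugation, the antipodal map sends the cross-ratio `c` to `k²(c - 1)/(c - k²)`, which is the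
effect on `ns²` of a translation by `K + iK'`; this is the real structure `isAbelJacobi_antipode`.
It turns `u^±` into `u ∓ conj u` shifted by half-periods, and the formulas for `sn` follow from
quarter-period shifts. The elliptic integral at the end is the inverse of `sn` on `[-K, K]`.

The Jacobi functions are built explicitly: on the real line from the amplitude, on `ℂ` by separated
formulas checked with the Cauchy–Riemann equations, with poles controlled by `sn(z + iK') = 1/(k sn
z)`. The identity theorem identifies them with the functions of the statement. -/

/-! ### Real Jacobi elliptic functions -/

/-- Legendre's integral as a function of the amplitude. -/
def legendreInt (k θ : ℝ) : ℝ := ∫ t in (0 : ℝ)..θ, 1 / √(1 - k ^ 2 * Real.sin t ^ 2)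

/-- The Jacobi amplitude, inverse to `legendreInt k`. -/
def jacobiAm (k : ℝ) : ℝ → ℝ := Function.invFun (legendreInt k)

/-- The Jacobi function `sn` on the real line. -/
def rsn (k x : ℝ) : ℝ := Real.sin (jacobiAm k x)

/-- The Jacobi function `cn` on the real line. -/
def rcn (k x : ℝ) : ℝ := Real.cos (jacobiAm k x)

/-- The Jacobi function `dn` on the real line. -/
def rdn (k x : ℝ) : ℝ := √(1 - k ^ 2 * Real.sin (jacobiAm k x) ^ 2)

theorem one_sub_sq_mul_sin_sq_pos {k : ℝ} (hk : k ^ 2 < 1) (θ : ℝ) :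
    0 < 1 - k ^ 2 * Real.sin θ ^ 2 := by
  nlinarith [Real.sin_sq_le_one θ, sq_nonneg (Real.sin θ), sq_nonneg k]

theorem continuous_legendreIntegrand {k : ℝ} (hk : k ^ 2 < 1) :
    Continuous fun θ : ℝ => 1 / √(1 - k ^ 2 * Real.sin θ ^ 2) :=
  continuous_const.div (by fun_prop) fun θ => (Real.sqrt_pos.2 (one_sub_sq_mul_sin_sq_pos hk θ)).ne'

theorem hasDerivAt_legendreInt {k : ℝ} (hk : k ^ 2 < 1) (θ : ℝ) :
    HasDerivAt (legendreInt k) (1 / √(1 - k ^ 2 * Real.sin θ ^ 2)) θ :=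
  intervalIntegral.integral_hasDerivAt_right
    ((continuous_legendreIntegrand hk).intervalIntegrable _ _)
    (continuous_legendreIntegrand hk).aestronglyMeasurable.stronglyMeasurableAtFilter
    (continuous_legendreIntegrand hk).continuousAt

@[simp] theorem legendreInt_zero (k : ℝ) : legendreInt k 0 = 0 := by simp [legendreInt]

theorem strictMono_legendreInt {k : ℝ} (hk : k ^ 2 < 1) : StrictMono (legendreInt k) :=
  strictMono_of_hasDerivAt_pos (hasDerivAt_legendreInt hk) fun θ =>
    one_div_pos.2 (Real.sqrt_pos.2 (one_sub_sq_mul_sin_sq_pos hk θ))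

theorem continuous_legendreInt {k : ℝ} (hk : k ^ 2 < 1) : Continuous (legendreInt k) :=
  continuous_iff_continuousAt.2 fun θ => (hasDerivAt_legendreInt hk θ).continuousAt

/-- The integrand is at least `1`. This makes the integral tend to `±∞`, hence surjective, so that
the amplitude is defined on the whole line. -/
theorem monotone_legendreInt_sub_id {k : ℝ} (hk : k ^ 2 < 1) :
    Monotone fun θ => legendreInt k θ - θ := by
  refine monotone_of_hasDerivAt_nonneg
    (fun θ => (hasDerivAt_legendreInt hk θ).sub (hasDerivAt_id θ)) fun θ => ?_
  rw [Pi.zero_apply, sub_nonneg, le_div_iff₀ (Real.sqrt_pos.2 (one_sub_sq_mul_sin_sq_pos hk θ)),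
    one_mul, Real.sqrt_le_one]
  nlinarith [sq_nonneg (k * Real.sin θ)]

theorem surjective_legendreInt {k : ℝ} (hk : k ^ 2 < 1) :
    Function.Surjective (legendreInt k) := by
  refine (continuous_legendreInt hk).surjective ?_ ?_
  · refine Filter.tendsto_atTop_mono' _ ?_ Filter.tendsto_id
    filter_upwards [Filter.eventually_ge_atTop 0] with θ hθ
    simpa using monotone_legendreInt_sub_id hk hθ
  · refine Filter.tendsto_atBot_mono' _ ?_ Filter.tendsto_id
    filter_upwards [Filter.eventually_le_atBot 0] with θ hθ
    simpa using monotone_legendreInt_sub_id hk hθ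

theorem legendreInt_jacobiAm {k : ℝ} (hk : k ^ 2 < 1) (x : ℝ) :
    legendreInt k (jacobiAm k x) = x :=
  Function.rightInverse_invFun (surjective_legendreInt hk) x

theorem jacobiAm_legendreInt {k : ℝ} (hk : k ^ 2 < 1) (θ : ℝ) :
    jacobiAm k (legendreInt k θ) = θ :=
  Function.leftInverse_invFun (strictMono_legendreInt hk).injective θ

theorem continuous_jacobiAm {k : ℝ} (hk : k ^ 2 < 1) : Continuous (jacobiAm k) := by
  let e := (strictMono_legendreInt hk).orderIsoOfSurjective _ (surjective_legendreInt hk)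
  have : jacobiAm k = e.symm := by
    funext x
    apply (strictMono_legendreInt hk).injective
    rw [legendreInt_jacobiAm hk]
    exact (e.apply_symm_apply x).symm
  rw [this]
  exact e.symm.continuous

theorem rdn_pos {k : ℝ} (hk : k ^ 2 < 1) (x : ℝ) : 0 < rdn k x :=
  Real.sqrt_pos.2 (one_sub_sq_mul_sin_sq_pos hk _)

theorem hasDerivAt_jacobiAm {k : ℝ} (hk : k ^ 2 < 1) (x : ℝ) :
    HasDerivAt (jacobiAm k) (rdn k x) x := by
  have h := HasDerivAt.of_local_left_inverse (continuous_jacobiAm hk).continuousAt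
    (hasDerivAt_legendreInt hk (jacobiAm k x)) (one_div_ne_zero (rdn_pos hk x).ne')
    (.of_forall (legendreInt_jacobiAm hk))
  simpa [rdn] using h

theorem rcn_sq (k x : ℝ) : rcn k x ^ 2 = 1 - rsn k x ^ 2 := Real.cos_sq' _

theorem rdn_sq {k : ℝ} (hk : k ^ 2 < 1) (x : ℝ) : rdn k x ^ 2 = 1 - k ^ 2 * rsn k x ^ 2 :=
  Real.sq_sqrt (one_sub_sq_mul_sin_sq_pos hk _).le

theorem rsn_sq_le_one (k x : ℝ) : rsn k x ^ 2 ≤ 1 := Real.sin_sq_le_one _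

theorem hasDerivAt_rsn {k : ℝ} (hk : k ^ 2 < 1) (x : ℝ) :
    HasDerivAt (rsn k) (rcn k x * rdn k x) x :=
  (Real.hasDerivAt_sin _).comp x (hasDerivAt_jacobiAm hk x)

theorem hasDerivAt_rcn {k : ℝ} (hk : k ^ 2 < 1) (x : ℝ) :
    HasDerivAt (rcn k) (-rsn k x * rdn k x) x :=
  (Real.hasDerivAt_cos _).comp x (hasDerivAt_jacobiAm hk x)

theorem hasDerivAt_rdn {k : ℝ} (hk : k ^ 2 < 1) (x : ℝ) :
    HasDerivAt (rdn k) (-k ^ 2 * rsn k x * rcn k x) x := by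
  have h := ((((hasDerivAt_rsn hk x).pow 2).const_mul (k ^ 2)).const_sub 1).sqrt
    (one_sub_sq_mul_sin_sq_pos hk _).ne'
  refine h.congr_deriv ?_
  have h1 : √(1 - k ^ 2 * rsn k x ^ 2) = rdn k x := rfl
  have := (rdn_pos hk x).ne'
  simp only [Pi.pow_apply, h1]
  field_simp
  norm_num
  ring

@[simp] theorem jacobiAm_zero {k : ℝ} (hk : k ^ 2 < 1) : jacobiAm k 0 = 0 := by
  simpa using jacobiAm_legendreInt hk 0

theorem rsn_zero {k : ℝ} (hk : k ^ 2 < 1) : rsn k 0 = 0 := by simp [rsn, hk]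
theorem rcn_zero {k : ℝ} (hk : k ^ 2 < 1) : rcn k 0 = 1 := by simp [rcn, hk]
theorem rdn_zero {k : ℝ} (hk : k ^ 2 < 1) : rdn k 0 = 1 := by simp [rdn, hk]

theorem ellipticF_eq (x k : ℝ) : ellipticF x k = legendreInt k (Real.arcsin x) := rfl

theorem ellipticK_eq (k : ℝ) : ellipticK k = legendreInt k (Real.pi / 2) := by
  rw [ellipticK, ellipticF_eq, Real.arcsin_one]

theorem legendreInt_neg (k θ : ℝ) : legendreInt k (-θ) = -legendreInt k θ := by
  have := intervalIntegral.integral_comp_neg (a := 0) (b := θ)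
    (fun t => 1 / √(1 - k ^ 2 * Real.sin t ^ 2))
  simp only [Real.sin_neg, neg_sq, neg_zero] at this
  rw [legendreInt, legendreInt, this, intervalIntegral.integral_symm]

theorem jacobiAm_neg {k : ℝ} (hk : k ^ 2 < 1) (x : ℝ) : jacobiAm k (-x) = -jacobiAm k x := by
  apply (strictMono_legendreInt hk).injective
  rw [legendreInt_neg, legendreInt_jacobiAm hk, legendreInt_jacobiAm hk]

theorem rsn_neg {k : ℝ} (hk : k ^ 2 < 1) (x : ℝ) : rsn k (-x) = -rsn k x := by
  simp [rsn, jacobiAm_neg hk]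
theorem rcn_neg {k : ℝ} (hk : k ^ 2 < 1) (x : ℝ) : rcn k (-x) = rcn k x := by
  simp [rcn, jacobiAm_neg hk]
theorem rdn_neg {k : ℝ} (hk : k ^ 2 < 1) (x : ℝ) : rdn k (-x) = rdn k x := by
  simp [rdn, jacobiAm_neg hk]

theorem jacobiAm_ellipticK {k : ℝ} (hk : k ^ 2 < 1) : jacobiAm k (ellipticK k) = Real.pi / 2 := by
  rw [ellipticK_eq, jacobiAm_legendreInt hk]

theorem rsn_ellipticK {k : ℝ} (hk : k ^ 2 < 1) : rsn k (ellipticK k) = 1 := by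
  simp [rsn, jacobiAm_ellipticK hk]
theorem rcn_ellipticK {k : ℝ} (hk : k ^ 2 < 1) : rcn k (ellipticK k) = 0 := by
  simp [rcn, jacobiAm_ellipticK hk]

theorem one_sub_sq_mul_rsn_pos {k : ℝ} (hk : k ^ 2 < 1) (x y : ℝ) :
    0 < 1 - k ^ 2 * rsn k x ^ 2 * rsn k y ^ 2 := by
  have h : k ^ 2 * rsn k x ^ 2 * rsn k y ^ 2 ≤ k ^ 2 * 1 * 1 := by
    gcongr
    · exact rsn_sq_le_one _ _
    · exact rsn_sq_le_one _ _
  linarith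

/-- The mechanism behind the addition theorems: an expression constant along the lines `x + y = a`
equals its value at `(a, 0)`. -/
theorem eq_of_hasDerivAt_zero {F : ℝ → ℝ → ℝ} (hF : ∀ a t, HasDerivAt (fun t => F (a - t) t) 0 t)
    (x y : ℝ) : F x y = F (x + y) 0 := by
  have h := is_const_of_deriv_eq_zero (fun t => (hF (x + y) t).differentiableAt)
    (fun t => (hF (x + y) t).deriv) y 0
  simpa using h

theorem HasDerivAt.comp_const_sub' {f : ℝ → ℝ} {f' : ℝ} (a t : ℝ) (hf : HasDerivAt f f' (a - t)) :
    HasDerivAt (fun t => f (a - t)) (-f') t := by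
  simpa using hf.comp_const_sub a t

theorem rsn_add {k : ℝ} (hk : k ^ 2 < 1) (x y : ℝ) :
    rsn k (x + y) = (rsn k x * rcn k y * rdn k y + rsn k y * rcn k x * rdn k x) /
      (1 - k ^ 2 * rsn k x ^ 2 * rsn k y ^ 2) := by
  symm
  have := eq_of_hasDerivAt_zero (F := fun x y =>
    (rsn k x * rcn k y * rdn k y + rsn k y * rcn k x * rdn k x) /
      (1 - k ^ 2 * rsn k x ^ 2 * rsn k y ^ 2)) (fun a t => ?_) x y
  · simpa [rsn_zero hk, rcn_zero hk, rdn_zero hk] using this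
  have hs := (hasDerivAt_rsn hk (a - t)).comp_const_sub' a t
  have hc := (hasDerivAt_rcn hk (a - t)).comp_const_sub' a t
  have hd := (hasDerivAt_rdn hk (a - t)).comp_const_sub' a t
  have hs' := hasDerivAt_rsn hk t
  have hc' := hasDerivAt_rcn hk t
  have hd' := hasDerivAt_rdn hk t
  have hne := (one_sub_sq_mul_rsn_pos hk (a - t) t).ne'
  refine ((((hs.mul hc').mul hd').add ((hs'.mul hc).mul hd)).div
    ((((hs.pow 2).const_mul (k ^ 2)).mul (hs'.pow 2)).const_sub 1) hne).congr_deriv ?_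
  rw [div_eq_zero_iff]
  left
  -- Vanishing of the numerator of the derivative is a polynomial identity modulo the quadratic
  -- relations `e1`–`e4`.
  have e1 := rcn_sq k (a - t)
  have e2 := rcn_sq k t
  have e3 := rdn_sq hk (a - t)
  have e4 := rdn_sq hk t
  simp only [Pi.mul_apply, Pi.pow_apply, Pi.add_apply]
  generalize rsn k (a - t) = s at *
  generalize rcn k (a - t) = c at *
  generalize rdn k (a - t) = d at *
  generalize rsn k t = s' at *
  generalize rcn k t = c' at *
  generalize rdn k t = d' at *
  clear hs hc hd hs' hc' hd'
  grind

theorem rcn_add {k : ℝ} (hk : k ^ 2 < 1) (x y : ℝ) :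
    rcn k (x + y) = (rcn k x * rcn k y - rsn k x * rdn k x * (rsn k y * rdn k y)) /
      (1 - k ^ 2 * rsn k x ^ 2 * rsn k y ^ 2) := by
  symm
  have := eq_of_hasDerivAt_zero (F := fun x y =>
    (rcn k x * rcn k y - rsn k x * rdn k x * (rsn k y * rdn k y)) /
      (1 - k ^ 2 * rsn k x ^ 2 * rsn k y ^ 2)) (fun a t => ?_) x y
  · simpa [rsn_zero hk, rcn_zero hk, rdn_zero hk] using this
  have hs := (hasDerivAt_rsn hk (a - t)).comp_const_sub' a t
  have hc := (hasDerivAt_rcn hk (a - t)).comp_const_sub' a t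
  have hd := (hasDerivAt_rdn hk (a - t)).comp_const_sub' a t
  have hs' := hasDerivAt_rsn hk t
  have hc' := hasDerivAt_rcn hk t
  have hd' := hasDerivAt_rdn hk t
  have hne := (one_sub_sq_mul_rsn_pos hk (a - t) t).ne'
  refine (((hc.mul hc').sub ((hs.mul hd).mul (hs'.mul hd'))).div
    ((((hs.pow 2).const_mul (k ^ 2)).mul (hs'.pow 2)).const_sub 1) hne).congr_deriv ?_
  rw [div_eq_zero_iff]
  left
  have e1 := rcn_sq k (a - t)
  have e2 := rcn_sq k t
  have e3 := rdn_sq hk (a - t)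
  have e4 := rdn_sq hk t
  simp only [Pi.mul_apply, Pi.pow_apply, Pi.sub_apply]
  generalize rsn k (a - t) = s at *
  generalize rcn k (a - t) = c at *
  generalize rdn k (a - t) = d at *
  generalize rsn k t = s' at *
  generalize rcn k t = c' at *
  generalize rdn k t = d' at *
  clear hs hc hd hs' hc' hd'
  grind

theorem rdn_add {k : ℝ} (hk : k ^ 2 < 1) (x y : ℝ) :
    rdn k (x + y) = (rdn k x * rdn k y - k ^ 2 * (rsn k x * rcn k x) * (rsn k y * rcn k y)) /
      (1 - k ^ 2 * rsn k x ^ 2 * rsn k y ^ 2) := by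
  symm
  have := eq_of_hasDerivAt_zero (F := fun x y =>
    (rdn k x * rdn k y - k ^ 2 * (rsn k x * rcn k x) * (rsn k y * rcn k y)) /
      (1 - k ^ 2 * rsn k x ^ 2 * rsn k y ^ 2)) (fun a t => ?_) x y
  · simpa [rsn_zero hk, rcn_zero hk, rdn_zero hk] using this
  have hs := (hasDerivAt_rsn hk (a - t)).comp_const_sub' a t
  have hc := (hasDerivAt_rcn hk (a - t)).comp_const_sub' a t
  have hd := (hasDerivAt_rdn hk (a - t)).comp_const_sub' a t
  have hs' := hasDerivAt_rsn hk t
  have hc' := hasDerivAt_rcn hk t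
  have hd' := hasDerivAt_rdn hk t
  have hne := (one_sub_sq_mul_rsn_pos hk (a - t) t).ne'
  refine (((hd.mul hd').sub (((hs.mul hc).const_mul (k ^ 2)).mul (hs'.mul hc'))).div
    ((((hs.pow 2).const_mul (k ^ 2)).mul (hs'.pow 2)).const_sub 1) hne).congr_deriv ?_
  rw [div_eq_zero_iff]
  left
  have e1 := rcn_sq k (a - t)
  have e2 := rcn_sq k t
  have e3 := rdn_sq hk (a - t)
  have e4 := rdn_sq hk t
  simp only [Pi.mul_apply, Pi.pow_apply, Pi.sub_apply]
  generalize rsn k (a - t) = s at *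
  generalize rcn k (a - t) = c at *
  generalize rdn k (a - t) = d at *
  generalize rsn k t = s' at *
  generalize rcn k t = c' at *
  generalize rdn k t = d' at *
  clear hs hc hd hs' hc' hd'
  grind

theorem rsn_add_ellipticK {k : ℝ} (hk : k ^ 2 < 1) (x : ℝ) :
    rsn k (x + ellipticK k) = rcn k x / rdn k x := by
  rw [rsn_add hk, rsn_ellipticK hk, rcn_ellipticK hk, one_pow, mul_one, ← rdn_sq hk]
  have := (rdn_pos hk x).ne'
  field_simp
  ring

theorem rdn_ellipticK {k k' : ℝ} (h0' : 0 < k') (h : k ^ 2 + k' ^ 2 = 1) :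
    rdn k (ellipticK k) = k' := by
  have hk : k ^ 2 < 1 := by nlinarith
  have h1 := rdn_sq hk (ellipticK k)
  rw [rsn_ellipticK hk] at h1
  refine (pow_left_inj₀ (rdn_pos hk _).le h0'.le two_ne_zero).1 ?_
  linarith

theorem rcn_add_ellipticK {k k' : ℝ} (h0' : 0 < k') (h : k ^ 2 + k' ^ 2 = 1) (x : ℝ) :
    rcn k (x + ellipticK k) = -k' * rsn k x / rdn k x := by
  have hk : k ^ 2 < 1 := by nlinarith
  rw [rcn_add hk, rsn_ellipticK hk, rcn_ellipticK hk, rdn_ellipticK h0' h, one_pow, mul_one,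
    ← rdn_sq hk]
  have := (rdn_pos hk x).ne'
  field_simp
  ring

theorem rdn_add_ellipticK {k k' : ℝ} (h0' : 0 < k') (h : k ^ 2 + k' ^ 2 = 1) (x : ℝ) :
    rdn k (x + ellipticK k) = k' / rdn k x := by
  have hk : k ^ 2 < 1 := by nlinarith
  rw [rdn_add hk, rsn_ellipticK hk, rcn_ellipticK hk, rdn_ellipticK h0' h, one_pow, mul_one,
    ← rdn_sq hk]
  have := (rdn_pos hk x).ne'
  field_simp
  ring

theorem rsn_add_two_ellipticK {k : ℝ} (hk : k ^ 2 < 1) (x : ℝ) :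
    rsn k (x + 2 * ellipticK k) = -rsn k x := by
  have h0' : 0 < √(1 - k ^ 2) := Real.sqrt_pos.2 (by linarith)
  have h : k ^ 2 + √(1 - k ^ 2) ^ 2 = 1 := by rw [Real.sq_sqrt (by linarith)]; ring
  have := (rdn_pos hk x).ne'
  rw [two_mul, ← add_assoc, rsn_add_ellipticK hk, rcn_add_ellipticK h0' h,
    rdn_add_ellipticK h0' h]
  field_simp

theorem rcn_add_two_ellipticK {k : ℝ} (hk : k ^ 2 < 1) (x : ℝ) :
    rcn k (x + 2 * ellipticK k) = -rcn k x := by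
  have h0' : 0 < √(1 - k ^ 2) := Real.sqrt_pos.2 (by linarith)
  have h : k ^ 2 + √(1 - k ^ 2) ^ 2 = 1 := by rw [Real.sq_sqrt (by linarith)]; ring
  have := (rdn_pos hk x).ne'
  rw [two_mul, ← add_assoc, rcn_add_ellipticK h0' h, rsn_add_ellipticK hk,
    rdn_add_ellipticK h0' h]
  field_simp

theorem rdn_add_two_ellipticK {k : ℝ} (hk : k ^ 2 < 1) (x : ℝ) :
    rdn k (x + 2 * ellipticK k) = rdn k x := by
  have h0' : 0 < √(1 - k ^ 2) := Real.sqrt_pos.2 (by linarith)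
  have h : k ^ 2 + √(1 - k ^ 2) ^ 2 = 1 := by rw [Real.sq_sqrt (by linarith)]; ring
  have := (rdn_pos hk x).ne'
  rw [two_mul, ← add_assoc, rdn_add_ellipticK h0' h, rdn_add_ellipticK h0' h]
  field_simp

theorem rsn_add_int_mul {k : ℝ} (hk : k ^ 2 < 1) (x : ℝ) (m : ℤ) :
    rsn k (x + m * (2 * ellipticK k)) = (-1) ^ m * rsn k x := by
  have h : Function.Antiperiodic (rsn k) (2 * ellipticK k) := rsn_add_two_ellipticK hk
  rw [h.add_int_mul_eq, Int.cast_negOnePow]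

theorem rcn_add_int_mul {k : ℝ} (hk : k ^ 2 < 1) (x : ℝ) (m : ℤ) :
    rcn k (x + m * (2 * ellipticK k)) = (-1) ^ m * rcn k x := by
  have h : Function.Antiperiodic (rcn k) (2 * ellipticK k) := rcn_add_two_ellipticK hk
  rw [h.add_int_mul_eq, Int.cast_negOnePow]

theorem rdn_add_int_mul {k : ℝ} (hk : k ^ 2 < 1) (x : ℝ) (m : ℤ) :
    rdn k (x + m * (2 * ellipticK k)) = rdn k x := by
  have h : Function.Periodic (rdn k) (2 * ellipticK k) := rdn_add_two_ellipticK hk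
  exact h.int_mul m x

theorem monotone_jacobiAm {k : ℝ} (hk : k ^ 2 < 1) : Monotone (jacobiAm k) := fun x y h => by
  rw [← (strictMono_legendreInt hk).le_iff_le, legendreInt_jacobiAm hk, legendreInt_jacobiAm hk]
  exact h

theorem ellipticF_rsn {k : ℝ} (hk : k ^ 2 < 1) {x : ℝ} (h1 : -ellipticK k ≤ x)
    (h2 : x ≤ ellipticK k) : ellipticF (rsn k x) k = x := by
  have h1' := monotone_jacobiAm hk h1
  have h2' := monotone_jacobiAm hk h2
  rw [jacobiAm_neg hk, jacobiAm_ellipticK hk] at h1'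
  rw [jacobiAm_ellipticK hk] at h2'
  rw [ellipticF_eq, rsn, Real.arcsin_sin h1' h2', legendreInt_jacobiAm hk]

/-- A shift by a multiple of `2K` moves the zero into `[-K, K)`, where `ellipticF` inverts `rsn`,
leaving only `0`. -/
theorem exists_eq_of_rsn_eq_zero {k : ℝ} (hk : k ^ 2 < 1) (hK : 0 < ellipticK k) {x : ℝ}
    (hx : rsn k x = 0) : ∃ m : ℤ, x = m * (2 * ellipticK k) := by
  obtain ⟨m, hm, -⟩ := existsUnique_sub_zsmul_mem_Ico (a := 2 * ellipticK k) (by linarith) x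
    (-ellipticK k)
  refine ⟨m, ?_⟩
  have h2 := rsn_add_int_mul hk (x - m * (2 * ellipticK k)) m
  rw [sub_add_cancel, hx, eq_comm, mul_eq_zero] at h2
  have h3 : rsn k (x - m * (2 * ellipticK k)) = 0 :=
    h2.resolve_left (zpow_ne_zero _ (by norm_num))
  rw [zsmul_eq_mul, Set.mem_Ico] at hm
  have h4 := ellipticF_rsn hk hm.1 (by linarith [hm.2])
  rw [h3, ellipticF_eq, Real.arcsin_zero, legendreInt_zero] at h4
  linarith

theorem rsn_ellipticF {k : ℝ} (hk : k ^ 2 < 1) {x : ℝ} (h1 : -1 ≤ x) (h2 : x ≤ 1) :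
    rsn k (ellipticF x k) = x := by
  rw [ellipticF_eq, rsn, jacobiAm_legendreInt hk, Real.sin_arcsin h1 h2]

theorem rcn_ellipticF {k : ℝ} (hk : k ^ 2 < 1) (x : ℝ) :
    rcn k (ellipticF x k) = √(1 - x ^ 2) := by
  rw [ellipticF_eq, rcn, jacobiAm_legendreInt hk, Real.cos_arcsin]

theorem rdn_ellipticF {k : ℝ} (hk : k ^ 2 < 1) {x : ℝ} (h1 : -1 ≤ x) (h2 : x ≤ 1) :
    rdn k (ellipticF x k) = √(1 - k ^ 2 * x ^ 2) := by
  rw [ellipticF_eq, rdn, jacobiAm_legendreInt hk, Real.sin_arcsin h1 h2]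

/-! ### Complex Jacobi elliptic functions -/

/-- The Cauchy–Riemann criterion, in a form where the complex derivative is prescribed in advance.
-/
theorem hasDerivAt_of_partials {f : ℂ → ℂ} {z f' : ℂ} (hd : DifferentiableAt ℝ f z)
    (hx : HasDerivAt (fun t : ℝ => f (z + t)) f' 0)
    (hy : HasDerivAt (fun t : ℝ => f (z + t * I)) (I * f') 0) : HasDerivAt f f' z := by
  have h1 : fderiv ℝ f z 1 = f' := by
    have h := hd.hasFDerivAt.hasLineDerivAt 1
    rw [HasLineDerivAt] at h
    simp only [Complex.real_smul, mul_one] at h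
    exact h.unique hx
  have h2 : fderiv ℝ f z I = I * f' := by
    have h := hd.hasFDerivAt.hasLineDerivAt I
    rw [HasLineDerivAt] at h
    simp only [Complex.real_smul] at h
    exact h.unique hy
  have h3 := (differentiableAt_complex_iff_differentiableAt_real.2
    ⟨hd, by rw [h1, h2, smul_eq_mul]⟩).hasDerivAt
  have h4 : HasDerivAt (fun t : ℝ => f (z + t)) (deriv f z) 0 := by
    have h5 : HasDerivAt f (deriv f z) (z + ((0 : ℝ) : ℂ)) := by simpa using h3
    have h6 : HasDerivAt (fun t : ℝ => z + (t : ℂ)) 1 0 :=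
      (Complex.ofRealCLM.hasDerivAt (x := (0:ℝ))).const_add z
    simpa [Function.comp_def] using! h5.comp (0:ℝ) h6
  rwa [h4.unique hx] at h3

/-- The common denominator of `csn`, `ccn`, `cdn`. -/
def jacobiDen (k k' : ℝ) (z : ℂ) : ℝ :=
  rcn k' z.im ^ 2 + k ^ 2 * rsn k z.re ^ 2 * rsn k' z.im ^ 2

/-- The Jacobi function `sn` of modulus `k` and complementary modulus `k'`, by separation of real
and imaginary parts; its value at the poles is `0`. -/
def csn (k k' : ℝ) (z : ℂ) : ℂ :=
  (rsn k z.re * rdn k' z.im + I * (rcn k z.re * rdn k z.re * rsn k' z.im * rcn k' z.im)) /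
    jacobiDen k k' z

/-- The Jacobi function `cn`, see `csn`. -/
def ccn (k k' : ℝ) (z : ℂ) : ℂ :=
  (rcn k z.re * rcn k' z.im - I * (rsn k z.re * rdn k z.re * rsn k' z.im * rdn k' z.im)) /
    jacobiDen k k' z

/-- The Jacobi function `dn`, see `csn`. -/
def cdn (k k' : ℝ) (z : ℂ) : ℂ :=
  (rdn k z.re * rcn k' z.im * rdn k' z.im - I * (k ^ 2 * rsn k z.re * rcn k z.re * rsn k' z.im)) /
    jacobiDen k k' z

theorem differentiable_rsn {k : ℝ} (hk : k ^ 2 < 1) : Differentiable ℝ (rsn k) :=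
  fun x => (hasDerivAt_rsn hk x).differentiableAt
theorem differentiable_rcn {k : ℝ} (hk : k ^ 2 < 1) : Differentiable ℝ (rcn k) :=
  fun x => (hasDerivAt_rcn hk x).differentiableAt
theorem differentiable_rdn {k : ℝ} (hk : k ^ 2 < 1) : Differentiable ℝ (rdn k) :=
  fun x => (hasDerivAt_rdn hk x).differentiableAt

theorem differentiable_re : Differentiable ℝ Complex.re := Complex.reCLM.differentiable
theorem differentiable_im : Differentiable ℝ Complex.im := Complex.imCLM.differentiable
theorem differentiable_ofReal : Differentiable ℝ Complex.ofReal := Complex.ofRealCLM.differentiable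

theorem continuous_jacobiDen {k k' : ℝ} (hk : k ^ 2 < 1) (hk' : k' ^ 2 < 1) :
    Continuous (jacobiDen k k') := by
  have h1 := (differentiable_rsn hk).continuous
  have h3 := (differentiable_rsn hk').continuous
  have h4 := (differentiable_rcn hk').continuous
  unfold jacobiDen
  fun_prop

theorem differentiable_jacobiDen {k k' : ℝ} (hk : k ^ 2 < 1) (hk' : k' ^ 2 < 1) :
    Differentiable ℝ (fun z => (jacobiDen k k' z : ℂ)) := by
  have h1 := (differentiable_rsn hk).comp differentiable_re
  have h3 := (differentiable_rsn hk').comp differentiable_im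
  have h4 := (differentiable_rcn hk').comp differentiable_im
  exact differentiable_ofReal.comp ((h4.pow 2).add (((h1.pow 2).const_mul _).mul (h3.pow 2)))

section

variable {k k' : ℝ}

theorem hasDerivAt_comp_re {f : ℝ → ℝ} {f' : ℝ} {z : ℂ} (hf : HasDerivAt f f' z.re) :
    HasDerivAt (fun t : ℝ => (f (z + t).re : ℂ)) f' 0 := by
  have h : HasDerivAt f f' (z.re + 0) := by simpa using hf
  have h2 := (h.comp_const_add z.re 0).ofReal_comp
  simpa using h2

theorem hasDerivAt_comp_im {f : ℝ → ℝ} {f' : ℝ} {z : ℂ} (hf : HasDerivAt f f' z.im) :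
    HasDerivAt (fun t : ℝ => (f (z + t * I).im : ℂ)) f' 0 := by
  have h : HasDerivAt f f' (z.im + 0) := by simpa using hf
  have h2 := (h.comp_const_add z.im 0).ofReal_comp
  simpa using h2

theorem hasDerivAt_comp_im_const {f : ℝ → ℝ} {z : ℂ} :
    HasDerivAt (fun t : ℝ => (f (z + t).im : ℂ)) 0 0 := by
  simpa using hasDerivAt_const (0 : ℝ) (f z.im : ℂ)

theorem hasDerivAt_comp_re_const {f : ℝ → ℝ} {z : ℂ} :
    HasDerivAt (fun t : ℝ => (f (z + t * I).re : ℂ)) 0 0 := by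
  simpa using hasDerivAt_const (0 : ℝ) (f z.re : ℂ)

end

theorem rsn_rcn_rdn_relations {k k' : ℝ} (hk : k ^ 2 < 1) (hk' : k' ^ 2 < 1) (h : k ^ 2 + k' ^ 2 = 1)
    (x y : ℝ) : (k' : ℂ) ^ 2 = 1 - k ^ 2 ∧ (rcn k x : ℂ) ^ 2 = 1 - rsn k x ^ 2 ∧
      (rdn k x : ℂ) ^ 2 = 1 - k ^ 2 * rsn k x ^ 2 ∧ (rcn k' y : ℂ) ^ 2 = 1 - rsn k' y ^ 2 ∧
      (rdn k' y : ℂ) ^ 2 = 1 - (1 - k ^ 2) * rsn k' y ^ 2 := by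
  have h' : k' ^ 2 = 1 - k ^ 2 := by linarith
  refine ⟨mod_cast h', mod_cast rcn_sq k x, mod_cast rdn_sq hk x, mod_cast rcn_sq k' y, ?_⟩
  have := rdn_sq hk' y
  rw [h'] at this
  exact_mod_cast this

set_option maxHeartbeats 1000000 in
-- The separated formulas are the addition theorem at `x + iy` combined with Jacobi's imaginary
-- transformation. They need not be derived: both partial derivatives are computed and compared with
-- the expected `cn dn` modulo the quadratic relations.
theorem hasDerivAt_csn {k k' : ℝ} (hk : k ^ 2 < 1) (hk' : k' ^ 2 < 1) (h : k ^ 2 + k' ^ 2 = 1)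
    {z : ℂ} (hz : jacobiDen k k' z ≠ 0) :
    HasDerivAt (csn k k') (ccn k k' z * cdn k k' z) z := by
  have hz' : (jacobiDen k k' z : ℂ) ≠ 0 := by exact_mod_cast hz
  apply hasDerivAt_of_partials
  · have s := differentiable_ofReal.comp ((differentiable_rsn hk).comp differentiable_re) z
    have c := differentiable_ofReal.comp ((differentiable_rcn hk).comp differentiable_re) z
    have d := differentiable_ofReal.comp ((differentiable_rdn hk).comp differentiable_re) z
    have s' := differentiable_ofReal.comp ((differentiable_rsn hk').comp differentiable_im) z
    have c' := differentiable_ofReal.comp ((differentiable_rcn hk').comp differentiable_im) z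
    have d' := differentiable_ofReal.comp ((differentiable_rdn hk').comp differentiable_im) z
    have hΔ := differentiable_jacobiDen hk hk' z
    refine (((s.mul d').add ((((c.mul d).mul s').mul c').const_mul I)).mul
      (hΔ.inv hz')).congr_of_eventuallyEq (.of_forall fun w => ?_)
    simp [csn, div_eq_mul_inv]
  · have s := hasDerivAt_comp_re (hasDerivAt_rsn hk z.re)
    have c := hasDerivAt_comp_re (hasDerivAt_rcn hk z.re)
    have d := hasDerivAt_comp_re (hasDerivAt_rdn hk z.re)
    have s' := hasDerivAt_comp_im_const (f := rsn k') (z := z)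
    have c' := hasDerivAt_comp_im_const (f := rcn k') (z := z)
    have d' := hasDerivAt_comp_im_const (f := rdn k') (z := z)
    have hΔ := (c'.pow 2).add (((s.pow 2).const_mul ((k : ℂ) ^ 2)).mul (s'.pow 2))
    have hN := (s.mul d').add ((((c.mul d).mul s').mul c').const_mul I)
    have hQ := hN.div hΔ (by simpa [jacobiDen] using hz')
    refine (hQ.congr_of_eventuallyEq (.of_forall fun t => ?_)).congr_deriv ?_
    · simp [csn, jacobiDen]
    clear hQ hN hΔ s c d s' c' d'
    obtain ⟨e0, e1, e2, e3, e4⟩ := rsn_rcn_rdn_relations hk hk' h z.re z.im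
    have eI := Complex.I_sq
    simp only [ccn, cdn, jacobiDen, Complex.ofReal_zero, add_zero, Pi.mul_apply, Pi.add_apply,
      Pi.pow_apply, Complex.ofReal_mul, Complex.ofReal_add, Complex.ofReal_pow,
      Complex.ofReal_neg]
    rw [div_mul_div_comm, ← sq]
    congr 1
    generalize (rsn k z.re : ℂ) = s at *
    generalize (rcn k z.re : ℂ) = c at *
    generalize (rdn k z.re : ℂ) = d at *
    generalize (rsn k' z.im : ℂ) = s' at *
    generalize (rcn k' z.im : ℂ) = c' at *
    generalize (rdn k' z.im : ℂ) = d' at *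
    generalize (k' : ℂ) = κ' at *
    generalize (k : ℂ) = κ at *
    generalize I = i at *
    clear hz' hz hk hk' h
    grind
  · have s := hasDerivAt_comp_re_const (f := rsn k) (z := z)
    have c := hasDerivAt_comp_re_const (f := rcn k) (z := z)
    have d := hasDerivAt_comp_re_const (f := rdn k) (z := z)
    have s' := hasDerivAt_comp_im (hasDerivAt_rsn hk' z.im)
    have c' := hasDerivAt_comp_im (hasDerivAt_rcn hk' z.im)
    have d' := hasDerivAt_comp_im (hasDerivAt_rdn hk' z.im)
    have hΔ := (c'.pow 2).add (((s.pow 2).const_mul ((k : ℂ) ^ 2)).mul (s'.pow 2))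
    have hN := (s.mul d').add ((((c.mul d).mul s').mul c').const_mul I)
    have hQ := hN.div hΔ (by simpa [jacobiDen] using hz')
    refine (hQ.congr_of_eventuallyEq (.of_forall fun t => ?_)).congr_deriv ?_
    · simp [csn, jacobiDen]
    clear hQ hN hΔ s c d s' c' d'
    obtain ⟨e0, e1, e2, e3, e4⟩ := rsn_rcn_rdn_relations hk hk' h z.re z.im
    have eI := Complex.I_sq
    simp only [ccn, cdn, jacobiDen, Complex.ofReal_zero, add_zero, Pi.mul_apply, Pi.add_apply,
      Pi.pow_apply, zero_mul, Complex.ofReal_mul, Complex.ofReal_add, Complex.ofReal_pow,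
      Complex.ofReal_neg]
    rw [div_mul_div_comm, ← sq, mul_div_assoc']
    congr 1
    generalize (rsn k z.re : ℂ) = s at *
    generalize (rcn k z.re : ℂ) = c at *
    generalize (rdn k z.re : ℂ) = d at *
    generalize (rsn k' z.im : ℂ) = s' at *
    generalize (rcn k' z.im : ℂ) = c' at *
    generalize (rdn k' z.im : ℂ) = d' at *
    generalize (k' : ℂ) = κ' at *
    generalize (k : ℂ) = κ at *
    generalize I = i at *
    clear hz' hz hk hk' h
    grind

set_option maxHeartbeats 1000000 in
theorem hasDerivAt_ccn {k k' : ℝ} (hk : k ^ 2 < 1) (hk' : k' ^ 2 < 1) (h : k ^ 2 + k' ^ 2 = 1)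
    {z : ℂ} (hz : jacobiDen k k' z ≠ 0) :
    HasDerivAt (ccn k k') (-csn k k' z * cdn k k' z) z := by
  have hz' : (jacobiDen k k' z : ℂ) ≠ 0 := by exact_mod_cast hz
  apply hasDerivAt_of_partials
  · have s := differentiable_ofReal.comp ((differentiable_rsn hk).comp differentiable_re) z
    have c := differentiable_ofReal.comp ((differentiable_rcn hk).comp differentiable_re) z
    have d := differentiable_ofReal.comp ((differentiable_rdn hk).comp differentiable_re) z
    have s' := differentiable_ofReal.comp ((differentiable_rsn hk').comp differentiable_im) z
    have c' := differentiable_ofReal.comp ((differentiable_rcn hk').comp differentiable_im) z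
    have d' := differentiable_ofReal.comp ((differentiable_rdn hk').comp differentiable_im) z
    have hΔ := differentiable_jacobiDen hk hk' z
    refine (((c.mul c').sub ((((s.mul d).mul s').mul d').const_mul I)).mul
      (hΔ.inv hz')).congr_of_eventuallyEq (.of_forall fun w => ?_)
    simp [ccn, div_eq_mul_inv]
  · have s := hasDerivAt_comp_re (hasDerivAt_rsn hk z.re)
    have c := hasDerivAt_comp_re (hasDerivAt_rcn hk z.re)
    have d := hasDerivAt_comp_re (hasDerivAt_rdn hk z.re)
    have s' := hasDerivAt_comp_im_const (f := rsn k') (z := z)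
    have c' := hasDerivAt_comp_im_const (f := rcn k') (z := z)
    have d' := hasDerivAt_comp_im_const (f := rdn k') (z := z)
    have hΔ := (c'.pow 2).add (((s.pow 2).const_mul ((k : ℂ) ^ 2)).mul (s'.pow 2))
    have hN := (c.mul c').sub ((((s.mul d).mul s').mul d').const_mul I)
    have hQ := hN.div hΔ (by simpa [jacobiDen] using hz')
    refine (hQ.congr_of_eventuallyEq (.of_forall fun t => ?_)).congr_deriv ?_
    · simp [ccn, jacobiDen]
    clear hQ hN hΔ s c d s' c' d'
    obtain ⟨e0, e1, e2, e3, e4⟩ := rsn_rcn_rdn_relations hk hk' h z.re z.im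
    have eI := Complex.I_sq
    simp only [csn, cdn, ← neg_div, jacobiDen, Complex.ofReal_zero, add_zero, Pi.mul_apply, Pi.add_apply,
      Pi.pow_apply, Pi.sub_apply, Complex.ofReal_mul, Complex.ofReal_add, Complex.ofReal_pow,
      Complex.ofReal_neg]
    rw [div_mul_div_comm, ← sq]
    congr 1
    generalize (rsn k z.re : ℂ) = s at *
    generalize (rcn k z.re : ℂ) = c at *
    generalize (rdn k z.re : ℂ) = d at *
    generalize (rsn k' z.im : ℂ) = s' at *
    generalize (rcn k' z.im : ℂ) = c' at *
    generalize (rdn k' z.im : ℂ) = d' at *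
    generalize (k' : ℂ) = κ' at *
    generalize (k : ℂ) = κ at *
    generalize I = i at *
    clear hz' hz hk hk' h
    grind
  · have s := hasDerivAt_comp_re_const (f := rsn k) (z := z)
    have c := hasDerivAt_comp_re_const (f := rcn k) (z := z)
    have d := hasDerivAt_comp_re_const (f := rdn k) (z := z)
    have s' := hasDerivAt_comp_im (hasDerivAt_rsn hk' z.im)
    have c' := hasDerivAt_comp_im (hasDerivAt_rcn hk' z.im)
    have d' := hasDerivAt_comp_im (hasDerivAt_rdn hk' z.im)
    have hΔ := (c'.pow 2).add (((s.pow 2).const_mul ((k : ℂ) ^ 2)).mul (s'.pow 2))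
    have hN := (c.mul c').sub ((((s.mul d).mul s').mul d').const_mul I)
    have hQ := hN.div hΔ (by simpa [jacobiDen] using hz')
    refine (hQ.congr_of_eventuallyEq (.of_forall fun t => ?_)).congr_deriv ?_
    · simp [ccn, jacobiDen]
    clear hQ hN hΔ s c d s' c' d'
    obtain ⟨e0, e1, e2, e3, e4⟩ := rsn_rcn_rdn_relations hk hk' h z.re z.im
    have eI := Complex.I_sq
    simp only [csn, cdn, ← neg_div, jacobiDen, Complex.ofReal_zero, add_zero, Pi.mul_apply, Pi.add_apply,
      Pi.pow_apply, Pi.sub_apply, zero_mul, Complex.ofReal_mul, Complex.ofReal_add, Complex.ofReal_pow,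
      Complex.ofReal_neg]
    rw [div_mul_div_comm, ← sq, mul_div_assoc']
    congr 1
    generalize (rsn k z.re : ℂ) = s at *
    generalize (rcn k z.re : ℂ) = c at *
    generalize (rdn k z.re : ℂ) = d at *
    generalize (rsn k' z.im : ℂ) = s' at *
    generalize (rcn k' z.im : ℂ) = c' at *
    generalize (rdn k' z.im : ℂ) = d' at *
    generalize (k' : ℂ) = κ' at *
    generalize (k : ℂ) = κ at *
    generalize I = i at *
    clear hz' hz hk hk' h
    grind

set_option maxHeartbeats 1000000 in
theorem hasDerivAt_cdn {k k' : ℝ} (hk : k ^ 2 < 1) (hk' : k' ^ 2 < 1) (h : k ^ 2 + k' ^ 2 = 1)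
    {z : ℂ} (hz : jacobiDen k k' z ≠ 0) :
    HasDerivAt (cdn k k') (-(k : ℂ) ^ 2 * (csn k k' z * ccn k k' z)) z := by
  have hz' : (jacobiDen k k' z : ℂ) ≠ 0 := by exact_mod_cast hz
  apply hasDerivAt_of_partials
  · have s := differentiable_ofReal.comp ((differentiable_rsn hk).comp differentiable_re) z
    have c := differentiable_ofReal.comp ((differentiable_rcn hk).comp differentiable_re) z
    have d := differentiable_ofReal.comp ((differentiable_rdn hk).comp differentiable_re) z
    have s' := differentiable_ofReal.comp ((differentiable_rsn hk').comp differentiable_im) z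
    have c' := differentiable_ofReal.comp ((differentiable_rcn hk').comp differentiable_im) z
    have d' := differentiable_ofReal.comp ((differentiable_rdn hk').comp differentiable_im) z
    have hΔ := differentiable_jacobiDen hk hk' z
    refine ((((d.mul c').mul d').sub ((((s.const_mul ((k : ℂ) ^ 2)).mul c).mul s').const_mul I)).mul
      (hΔ.inv hz')).congr_of_eventuallyEq (.of_forall fun w => ?_)
    simp [cdn, div_eq_mul_inv]
  · have s := hasDerivAt_comp_re (hasDerivAt_rsn hk z.re)
    have c := hasDerivAt_comp_re (hasDerivAt_rcn hk z.re)
    have d := hasDerivAt_comp_re (hasDerivAt_rdn hk z.re)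
    have s' := hasDerivAt_comp_im_const (f := rsn k') (z := z)
    have c' := hasDerivAt_comp_im_const (f := rcn k') (z := z)
    have d' := hasDerivAt_comp_im_const (f := rdn k') (z := z)
    have hΔ := (c'.pow 2).add (((s.pow 2).const_mul ((k : ℂ) ^ 2)).mul (s'.pow 2))
    have hN := ((d.mul c').mul d').sub ((((s.const_mul ((k : ℂ) ^ 2)).mul c).mul s').const_mul I)
    have hQ := hN.div hΔ (by simpa [jacobiDen] using hz')
    refine (hQ.congr_of_eventuallyEq (.of_forall fun t => ?_)).congr_deriv ?_
    · simp [cdn, jacobiDen]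
    clear hQ hN hΔ s c d s' c' d'
    obtain ⟨e0, e1, e2, e3, e4⟩ := rsn_rcn_rdn_relations hk hk' h z.re z.im
    have eI := Complex.I_sq
    simp only [csn, ccn, jacobiDen, Complex.ofReal_zero, add_zero, Pi.mul_apply, Pi.add_apply,
      Pi.pow_apply, Pi.sub_apply, Complex.ofReal_mul, Complex.ofReal_add, Complex.ofReal_pow,
      Complex.ofReal_neg]
    rw [div_mul_div_comm, ← sq]
    generalize (rsn k z.re : ℂ) = s at *
    generalize (rcn k z.re : ℂ) = c at *
    generalize (rdn k z.re : ℂ) = d at *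
    generalize (rsn k' z.im : ℂ) = s' at *
    generalize (rcn k' z.im : ℂ) = c' at *
    generalize (rdn k' z.im : ℂ) = d' at *
    generalize (k' : ℂ) = κ' at *
    generalize (k : ℂ) = κ at *
    generalize I = i at *
    clear hz' hz hk hk' h
    grind
  · have s := hasDerivAt_comp_re_const (f := rsn k) (z := z)
    have c := hasDerivAt_comp_re_const (f := rcn k) (z := z)
    have d := hasDerivAt_comp_re_const (f := rdn k) (z := z)
    have s' := hasDerivAt_comp_im (hasDerivAt_rsn hk' z.im)
    have c' := hasDerivAt_comp_im (hasDerivAt_rcn hk' z.im)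
    have d' := hasDerivAt_comp_im (hasDerivAt_rdn hk' z.im)
    have hΔ := (c'.pow 2).add (((s.pow 2).const_mul ((k : ℂ) ^ 2)).mul (s'.pow 2))
    have hN := ((d.mul c').mul d').sub ((((s.const_mul ((k : ℂ) ^ 2)).mul c).mul s').const_mul I)
    have hQ := hN.div hΔ (by simpa [jacobiDen] using hz')
    refine (hQ.congr_of_eventuallyEq (.of_forall fun t => ?_)).congr_deriv ?_
    · simp [cdn, jacobiDen]
    clear hQ hN hΔ s c d s' c' d'
    obtain ⟨e0, e1, e2, e3, e4⟩ := rsn_rcn_rdn_relations hk hk' h z.re z.im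
    have eI := Complex.I_sq
    simp only [csn, ccn, jacobiDen, Complex.ofReal_zero, add_zero, Pi.mul_apply, Pi.add_apply,
      Pi.pow_apply, Pi.sub_apply, zero_mul, Complex.ofReal_mul, Complex.ofReal_add, Complex.ofReal_pow,
      Complex.ofReal_neg]
    rw [div_mul_div_comm, ← sq, mul_div_assoc']
    generalize (rsn k z.re : ℂ) = s at *
    generalize (rcn k z.re : ℂ) = c at *
    generalize (rdn k z.re : ℂ) = d at *
    generalize (rsn k' z.im : ℂ) = s' at *
    generalize (rcn k' z.im : ℂ) = c' at *
    generalize (rdn k' z.im : ℂ) = d' at *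
    generalize (k' : ℂ) = κ' at *
    generalize (k : ℂ) = κ at *
    generalize I = i at *
    clear hz' hz hk hk' h
    grind

/-! ### Holomorphy, translation by `iK'` and poles -/

theorem analyticAt_of_hasDerivAt_jacobiDen {k k' : ℝ} (hk : k ^ 2 < 1) (hk' : k' ^ 2 < 1)
    {f g : ℂ → ℂ} (hf : ∀ z, jacobiDen k k' z ≠ 0 → HasDerivAt f (g z) z) {z : ℂ}
    (hz : jacobiDen k k' z ≠ 0) : AnalyticAt ℂ f z := by
  have ho : IsOpen {z | jacobiDen k k' z ≠ 0} :=
    isOpen_ne_fun (continuous_jacobiDen hk hk') continuous_const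
  have hd : DifferentiableOn ℂ f {z | jacobiDen k k' z ≠ 0} :=
    fun w hw => (hf w hw).differentiableAt.differentiableWithinAt
  exact hd.analyticAt (ho.mem_nhds hz)

/-- `jacobiNumS k k' z / jacobiDen k k' z` is `|sn z|²`. -/
def jacobiNumS (k k' : ℝ) (z : ℂ) : ℝ :=
  rsn k z.re ^ 2 * rcn k' z.im ^ 2 + rsn k' z.im ^ 2

/-- For real values and `i = I` the left side is the squared modulus of the numerator of `csn`. The
second factor is also, up to `k * jacobiNumS`, the numerator of `sn(z + iK')`, which makes the
product of the two functions `1/k`. -/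
theorem csn_num_mul_conj {s c d s' c' d' κ i : ℂ} (e1 : c ^ 2 = 1 - s ^ 2)
    (e2 : d ^ 2 = 1 - κ ^ 2 * s ^ 2) (e3 : c' ^ 2 = 1 - s' ^ 2)
    (e4 : d' ^ 2 = 1 - (1 - κ ^ 2) * s' ^ 2) (eI : i ^ 2 = -1) :
    (s * d' + i * (c * d * s' * c')) * (s * d' - i * (c * d * s' * c')) =
      (s ^ 2 * c' ^ 2 + s' ^ 2) * (c' ^ 2 + κ ^ 2 * s ^ 2 * s' ^ 2) := by
  grind

/-- The numerator identity behind `cn(z + iK') = -i dn z / (k sn z)`; the next one plays this role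
for `dn`. -/
theorem cdn_mul_csn_num_conj {s c d s' c' d' κ i : ℂ} (e1 : c ^ 2 = 1 - s ^ 2)
    (e2 : d ^ 2 = 1 - κ ^ 2 * s ^ 2) (e3 : c' ^ 2 = 1 - s' ^ 2)
    (e4 : d' ^ 2 = 1 - (1 - κ ^ 2) * s' ^ 2) (eI : i ^ 2 = -1) :
    -i * (d * c' * d' - i * (κ ^ 2 * s * c * s')) * (s * d' - i * (c * d * s' * c')) =
      (-c * s' * d' - i * (s * d * c')) * (c' ^ 2 + κ ^ 2 * s ^ 2 * s' ^ 2) := by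
  grind

theorem ccn_mul_csn_num_conj {s c d s' c' d' κ i : ℂ} (e1 : c ^ 2 = 1 - s ^ 2)
    (e2 : d ^ 2 = 1 - κ ^ 2 * s ^ 2) (e3 : c' ^ 2 = 1 - s' ^ 2)
    (e4 : d' ^ 2 = 1 - (1 - κ ^ 2) * s' ^ 2) (eI : i ^ 2 = -1) :
    -i * (c * c' - i * (s * d * s' * d')) * (s * d' - i * (c * d * s' * c')) =
      (-d * s' - i * (s * c * c' * d')) * (c' ^ 2 + κ ^ 2 * s ^ 2 * s' ^ 2) := by
  grind

section

variable {k k' : ℝ} (h0 : 0 < k) (h0' : 0 < k') (h : k ^ 2 + k' ^ 2 = 1)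

include h0' h in
theorem modulus_sq_lt_one : k ^ 2 < 1 := by nlinarith

include h0 h in
theorem comodulus_sq_lt_one : k' ^ 2 < 1 := by nlinarith

include h0 h0' h

theorem analyticAt_csn {z : ℂ} (hz : jacobiDen k k' z ≠ 0) : AnalyticAt ℂ (csn k k') z :=
  analyticAt_of_hasDerivAt_jacobiDen (modulus_sq_lt_one h0' h) (comodulus_sq_lt_one h0 h)
    (fun _ hz => hasDerivAt_csn (modulus_sq_lt_one h0' h) (comodulus_sq_lt_one h0 h) h hz) hz

theorem analyticAt_ccn {z : ℂ} (hz : jacobiDen k k' z ≠ 0) : AnalyticAt ℂ (ccn k k') z :=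
  analyticAt_of_hasDerivAt_jacobiDen (modulus_sq_lt_one h0' h) (comodulus_sq_lt_one h0 h)
    (fun _ hz => hasDerivAt_ccn (modulus_sq_lt_one h0' h) (comodulus_sq_lt_one h0 h) h hz) hz

theorem analyticAt_cdn {z : ℂ} (hz : jacobiDen k k' z ≠ 0) : AnalyticAt ℂ (cdn k k') z :=
  analyticAt_of_hasDerivAt_jacobiDen (modulus_sq_lt_one h0' h) (comodulus_sq_lt_one h0 h)
    (fun _ hz => hasDerivAt_cdn (modulus_sq_lt_one h0' h) (comodulus_sq_lt_one h0 h) h hz) hz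

omit h0' h in
theorem jacobiDen_eq_zero {z : ℂ} (hz : jacobiDen k k' z = 0) :
    rsn k z.re = 0 ∧ rcn k' z.im = 0 := by
  rw [jacobiDen] at hz
  have h1 : rcn k' z.im = 0 := by
    nlinarith [sq_nonneg (rcn k' z.im), sq_nonneg (k * rsn k z.re * rsn k' z.im)]
  have h2 := rcn_sq k' z.im
  rw [h1] at hz h2
  have h3 : rsn k' z.im ^ 2 = 1 := by linarith
  rw [h3] at hz
  refine ⟨?_, h1⟩
  simpa [h0.ne'] using hz

omit h0 h0' h in
theorem jacobiNumS_eq_zero {z : ℂ} (hz : jacobiNumS k k' z = 0) :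
    rsn k z.re = 0 ∧ rsn k' z.im = 0 := by
  rw [jacobiNumS] at hz
  have h1 : rsn k' z.im = 0 := by
    nlinarith [sq_nonneg (rsn k' z.im), sq_nonneg (rsn k z.re * rcn k' z.im)]
  have h2 := rcn_sq k' z.im
  rw [h1] at h2
  rw [h1, h2] at hz
  exact ⟨by simpa using hz, h1⟩

omit h0' in
theorem jacobiDen_add (z : ℂ) :
    jacobiDen k k' (z + ellipticK k' * I) =
      k ^ 2 * jacobiNumS k k' z / rdn k' z.im ^ 2 := by
  have hk' := comodulus_sq_lt_one h0 h
  have hd := (rdn_pos hk' z.im).ne'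
  simp only [jacobiDen, jacobiNumS, Complex.add_re, Complex.add_im, Complex.mul_I_re,
    Complex.mul_I_im, Complex.ofReal_im, Complex.ofReal_re, neg_zero, add_zero,
    rsn_add_ellipticK hk', rcn_add_ellipticK h0 ((add_comm _ _).trans h)]
  field_simp
  ring

omit h0' in
theorem csn_add (z : ℂ) :
    csn k k' (z + ellipticK k' * I) =
      (rsn k z.re * rdn k' z.im - I * (rcn k z.re * rdn k z.re * rsn k' z.im * rcn k' z.im)) /
        (k * jacobiNumS k k' z) := by
  have hk' := comodulus_sq_lt_one h0 h
  have hd : (rdn k' z.im : ℂ) ≠ 0 := by exact_mod_cast (rdn_pos hk' _).ne'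
  have hk0 : (k : ℂ) ≠ 0 := by exact_mod_cast h0.ne'
  have h' := (add_comm _ _).trans h
  rw [csn, jacobiDen_add h0 h]
  simp only [Complex.add_re, Complex.add_im, Complex.mul_I_re, Complex.mul_I_im,
    Complex.ofReal_im, Complex.ofReal_re, neg_zero, add_zero, rsn_add_ellipticK hk',
    rcn_add_ellipticK h0 h', rdn_add_ellipticK h0 h', Complex.ofReal_mul,
    Complex.ofReal_pow, Complex.ofReal_neg, Complex.ofReal_div]
  by_cases hN : (jacobiNumS k k' z : ℂ) = 0
  · simp [hN]
  field_simp
  ring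

theorem csn_add_eq_inv (z : ℂ) :
    csn k k' (z + ellipticK k' * I) = (k * csn k k' z)⁻¹ := by
  rw [csn_add h0 h, csn]
  -- At the poles and at the zeros of `sn` both sides are `0`, by the convention for division by
  -- zero.
  by_cases hD : jacobiDen k k' z = 0
  · obtain ⟨h1, h2⟩ := jacobiDen_eq_zero h0 hD
    simp [h1, h2]
  by_cases hN : jacobiNumS k k' z = 0
  · obtain ⟨h1, h2⟩ := jacobiNumS_eq_zero hN
    simp [h1, h2]
  have hk := modulus_sq_lt_one h0' h
  have hk' := comodulus_sq_lt_one h0 h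
  obtain ⟨e0, e1, e2, e3, e4⟩ := rsn_rcn_rdn_relations hk hk' h z.re z.im
  have hσ := csn_num_mul_conj e1 e2 e3 e4 Complex.I_sq
  have hk0 : (k : ℂ) ≠ 0 := by exact_mod_cast h0.ne'
  have hD' : (jacobiDen k k' z : ℂ) ≠ 0 := by exact_mod_cast hD
  have hN' : (jacobiNumS k k' z : ℂ) ≠ 0 := by exact_mod_cast hN
  have hE : (jacobiNumS k k' z : ℂ) * jacobiDen k k' z = (rsn k z.re ^ 2 * rcn k' z.im ^ 2 +
    rsn k' z.im ^ 2) * (rcn k' z.im ^ 2 + k ^ 2 * rsn k z.re ^ 2 * rsn k' z.im ^ 2) := by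
    simp [jacobiNumS, jacobiDen]
  rw [← hE] at hσ
  apply eq_inv_of_mul_eq_one_left
  field_simp
  linear_combination hσ

theorem ccn_add (z : ℂ) (hz : jacobiDen k k' z ≠ 0) :
    ccn k k' (z + ellipticK k' * I) = -I * cdn k k' z / (k * csn k k' z) := by
  have hk := modulus_sq_lt_one h0' h
  have hk' := comodulus_sq_lt_one h0 h
  have hd : (rdn k' z.im : ℂ) ≠ 0 := by exact_mod_cast (rdn_pos hk' _).ne'
  have hk0 : (k : ℂ) ≠ 0 := by exact_mod_cast h0.ne'
  have h' := (add_comm _ _).trans h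
  have hD' : (jacobiDen k k' z : ℂ) ≠ 0 := by exact_mod_cast hz
  rw [div_eq_mul_inv, ← csn_add_eq_inv h0 h0' h, csn_add h0 h, ccn, jacobiDen_add h0 h, cdn]
  obtain ⟨e0, e1, e2, e3, e4⟩ := rsn_rcn_rdn_relations hk hk' h z.re z.im
  have hσ := cdn_mul_csn_num_conj e1 e2 e3 e4 Complex.I_sq
  have hE : (jacobiDen k k' z : ℂ) =
      (rcn k' z.im ^ 2 + k ^ 2 * rsn k z.re ^ 2 * rsn k' z.im ^ 2) := by
    simp [jacobiDen]
  rw [← hE] at hσ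
  simp only [Complex.add_re, Complex.add_im, Complex.mul_I_re, Complex.mul_I_im,
    Complex.ofReal_im, Complex.ofReal_re, neg_zero, add_zero, rsn_add_ellipticK hk',
    rcn_add_ellipticK h0 h', rdn_add_ellipticK h0 h', Complex.ofReal_mul,
    Complex.ofReal_pow, Complex.ofReal_neg, Complex.ofReal_div]
  by_cases hN : (jacobiNumS k k' z : ℂ) = 0
  · simp [hN]
  field_simp
  linear_combination -hσ

theorem cdn_add (z : ℂ) (hz : jacobiDen k k' z ≠ 0) :
    cdn k k' (z + ellipticK k' * I) = -I * ccn k k' z / csn k k' z := by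
  have hk := modulus_sq_lt_one h0' h
  have hk' := comodulus_sq_lt_one h0 h
  have hd : (rdn k' z.im : ℂ) ≠ 0 := by exact_mod_cast (rdn_pos hk' _).ne'
  have hk0 : (k : ℂ) ≠ 0 := by exact_mod_cast h0.ne'
  have h' := (add_comm _ _).trans h
  have hD' : (jacobiDen k k' z : ℂ) ≠ 0 := by exact_mod_cast hz
  have hc : (csn k k' z)⁻¹ = k * csn k k' (z + ellipticK k' * I) := by
    rw [csn_add_eq_inv h0 h0' h, mul_inv, mul_inv_cancel_left₀ hk0]
  rw [div_eq_mul_inv, hc, csn_add h0 h, cdn, jacobiDen_add h0 h, ccn]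
  obtain ⟨e0, e1, e2, e3, e4⟩ := rsn_rcn_rdn_relations hk hk' h z.re z.im
  have hσ := ccn_mul_csn_num_conj e1 e2 e3 e4 Complex.I_sq
  have hE : (jacobiDen k k' z : ℂ) =
      (rcn k' z.im ^ 2 + k ^ 2 * rsn k z.re ^ 2 * rsn k' z.im ^ 2) := by
    simp [jacobiDen]
  rw [← hE] at hσ
  simp only [Complex.add_re, Complex.add_im, Complex.mul_I_re, Complex.mul_I_im,
    Complex.ofReal_im, Complex.ofReal_re, neg_zero, add_zero, rsn_add_ellipticK hk',
    rcn_add_ellipticK h0 h', rdn_add_ellipticK h0 h', Complex.ofReal_mul,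
    Complex.ofReal_pow, Complex.ofReal_neg, Complex.ofReal_div]
  by_cases hN : (jacobiNumS k k' z : ℂ) = 0
  · simp [hN]
  field_simp
  linear_combination -hσ

omit h0' in
/-- A pole of the Jacobi functions is `i K'` away from a zero of `sn`. -/
theorem exists_add_of_jacobiDen_eq_zero {z : ℂ} (hz : jacobiDen k k' z = 0) :
    ∃ w, z = w + ellipticK k' * I ∧ rsn k w.re = 0 ∧ rsn k' w.im = 0 := by
  refine ⟨z - ellipticK k' * I, by ring, ?_⟩
  have h1 := jacobiDen_add h0 h (z - ellipticK k' * I)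
  rw [sub_add_cancel, hz, eq_comm, div_eq_zero_iff] at h1
  have h2 := (rdn_pos (comodulus_sq_lt_one h0 h) (z - ellipticK k' * I).im).ne'
  have h3 : jacobiNumS k k' (z - ellipticK k' * I) = 0 := by
    simpa [h0.ne'] using h1.resolve_right (pow_ne_zero 2 h2)
  exact jacobiNumS_eq_zero h3

omit h0 h0' h in
theorem rcn_ne_zero_of_rsn_eq_zero {x : ℝ} (hs : rsn k x = 0) : rcn k x ≠ 0 := by
  intro hc
  have := rcn_sq k x
  rw [hs, hc] at this
  norm_num at this

omit h0 h0' h in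
theorem jacobiDen_ne_zero {z : ℂ} (h2 : rsn k' z.im = 0) : jacobiDen k k' z ≠ 0 := by
  have := rcn_ne_zero_of_rsn_eq_zero h2
  rw [jacobiDen, h2]
  simpa using this

theorem cdn_ne_zero_of_zero {z : ℂ} (h1 : rsn k z.re = 0) (h2 : rsn k' z.im = 0) :
    cdn k k' z ≠ 0 := by
  have hD : (jacobiDen k k' z : ℂ) ≠ 0 := by exact_mod_cast jacobiDen_ne_zero h2
  have h3 : (rcn k' z.im : ℂ) ≠ 0 := by exact_mod_cast rcn_ne_zero_of_rsn_eq_zero h2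
  have hd' : (rdn k' z.im : ℂ) ≠ 0 := by exact_mod_cast (rdn_pos (comodulus_sq_lt_one h0 h) _).ne'
  have hd : (rdn k z.re : ℂ) ≠ 0 := by exact_mod_cast (rdn_pos (modulus_sq_lt_one h0' h) _).ne'
  simp [cdn, h1, h2, hD, h3, hd, hd']

omit h0 h0' h in
theorem ccn_ne_zero_of_zero {z : ℂ} (h1 : rsn k z.re = 0) (h2 : rsn k' z.im = 0) :
    ccn k k' z ≠ 0 := by
  have hD : (jacobiDen k k' z : ℂ) ≠ 0 := by exact_mod_cast jacobiDen_ne_zero h2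
  have h3 : (rcn k' z.im : ℂ) ≠ 0 := by exact_mod_cast rcn_ne_zero_of_rsn_eq_zero h2
  have h4 : (rcn k z.re : ℂ) ≠ 0 := by exact_mod_cast rcn_ne_zero_of_rsn_eq_zero h1
  simp [ccn, h1, h2, hD, h3, h4]

omit h0 h0' h in
theorem csn_eq_zero_of_zero {z : ℂ} (h1 : rsn k z.re = 0) (h2 : rsn k' z.im = 0) :
    csn k k' z = 0 := by
  simp [csn, h1, h2]

theorem analyticAt_csn_sub {w : ℂ} (h2 : rsn k' w.im = 0) :
    AnalyticAt ℂ (fun z => csn k k' (z - ellipticK k' * I)) (w + ellipticK k' * I) := by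
  refine AnalyticAt.fun_comp (g := csn k k') ?_ (by fun_prop)
  rw [add_sub_cancel_right]
  exact analyticAt_csn h0 h0' h (jacobiDen_ne_zero h2)

theorem meromorphicOrderAt_csn_sub {w : ℂ} (h1 : rsn k w.re = 0) (h2 : rsn k' w.im = 0) :
    meromorphicOrderAt (fun z => csn k k' (z - ellipticK k' * I)) (w + ellipticK k' * I) = 1 := by
  have ha := analyticAt_csn h0 h0' h (jacobiDen_ne_zero (k := k) h2)
  have hc := meromorphicOrderAt_comp_sub_const_eq_meromorphicOrderAt (f := csn k k')
    (c := ellipticK k' * I) (x := w + ellipticK k' * I)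
  rw [Function.comp_def] at hc
  rw [hc, add_sub_cancel_right, ha.meromorphicOrderAt_eq,
    ha.analyticOrderAt_eq_one_of_zero_deriv_ne_zero (csn_eq_zero_of_zero h1 h2)]
  · rfl
  · rw [(hasDerivAt_csn (modulus_sq_lt_one h0' h) (comodulus_sq_lt_one h0 h) h
      (jacobiDen_ne_zero h2)).deriv]
    exact mul_ne_zero (ccn_ne_zero_of_zero h1 h2) (cdn_ne_zero_of_zero h0 h0' h h1 h2)

/-- Behaviour at a pole of a quotient by a translate of `sn`. -/
theorem pole_of_eventuallyEq_div {f g : ℂ → ℂ} {w : ℂ} (h1 : rsn k w.re = 0)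
    (h2 : rsn k' w.im = 0) (hg : AnalyticAt ℂ g w) (hg0 : g w ≠ 0)
    (hf : ∀ z, jacobiDen k k' z ≠ 0 → f (z + ellipticK k' * I) = g z / csn k k' z) :
    HasPoleAt f (w + ellipticK k' * I) ∧ MeromorphicNFAt f (w + ellipticK k' * I) := by
  set p := w + ellipticK k' * I with hp
  have hS := analyticAt_csn_sub h0 h0' h h2
  have hG : AnalyticAt ℂ (fun z => g (z - ellipticK k' * I)) p := by
    refine AnalyticAt.fun_comp (g := g) ?_ (by fun_prop)
    rwa [hp, add_sub_cancel_right]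
  have hG0 : (fun z => g (z - ellipticK k' * I)) p ≠ 0 := by simpa [hp] using hg0
  -- Near `p` the translate `z - iK'` stays near `w`, away from the poles. There `f` is a
  -- nonvanishing analytic factor times the inverse of a function with a simple zero, and the
  -- equality includes the point `p` itself, as normal form requires.
  have hev : f =ᶠ[𝓝 p] (fun z => g (z - ellipticK k' * I)) *
      (fun z => csn k k' (z - ellipticK k' * I))⁻¹ := by
    have ho : IsOpen {z : ℂ | jacobiDen k k' (z - ellipticK k' * I) ≠ 0} :=
      isOpen_ne_fun ((continuous_jacobiDen (modulus_sq_lt_one h0' h)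
        (comodulus_sq_lt_one h0 h)).comp (by fun_prop)) continuous_const
    filter_upwards [ho.mem_nhds (show p ∈ _ by simpa [hp] using jacobiDen_ne_zero h2)] with z hz
    have := hf _ hz
    rw [sub_add_cancel] at this
    rw [this, div_eq_mul_inv]
    rfl
  have hNF := (meromorphicNFAt_congr hev).2
    ((meromorphicNFAt_mul_iff_right hG hG0).2 hS.meromorphicNFAt.inv)
  refine ⟨⟨hNF.meromorphicAt, ?_⟩, hNF⟩
  rw [meromorphicOrderAt_congr (hev.filter_mono nhdsWithin_le_nhds),
    meromorphicOrderAt_mul_of_ne_zero hG hG0, meromorphicOrderAt_inv,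
    meromorphicOrderAt_csn_sub h0 h0' h h1 h2]
  decide

theorem csn_pole {z : ℂ} (hz : jacobiDen k k' z = 0) :
    HasPoleAt (csn k k') z ∧ MeromorphicNFAt (csn k k') z := by
  obtain ⟨w, rfl, h1, h2⟩ := exists_add_of_jacobiDen_eq_zero h0 h hz
  refine pole_of_eventuallyEq_div h0 h0' h h1 h2 (g := fun _ => (k : ℂ)⁻¹) analyticAt_const
    (by simpa using h0.ne') fun z _ => ?_
  rw [csn_add_eq_inv h0 h0' h, mul_inv, div_eq_mul_inv]

theorem ccn_pole {z : ℂ} (hz : jacobiDen k k' z = 0) :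
    HasPoleAt (ccn k k') z ∧ MeromorphicNFAt (ccn k k') z := by
  obtain ⟨w, rfl, h1, h2⟩ := exists_add_of_jacobiDen_eq_zero h0 h hz
  have hk0 : (k : ℂ) ≠ 0 := by exact_mod_cast h0.ne'
  refine pole_of_eventuallyEq_div h0 h0' h h1 h2 (g := fun z => -I / k * cdn k k' z)
    (analyticAt_const.mul (analyticAt_cdn h0 h0' h (jacobiDen_ne_zero h2)))
    (by simp [cdn_ne_zero_of_zero h0 h0' h h1 h2, h0.ne']) fun z hz => ?_
  rw [ccn_add h0 h0' h z hz]
  field_simp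

theorem cdn_pole {z : ℂ} (hz : jacobiDen k k' z = 0) :
    HasPoleAt (cdn k k') z ∧ MeromorphicNFAt (cdn k k') z := by
  obtain ⟨w, rfl, h1, h2⟩ := exists_add_of_jacobiDen_eq_zero h0 h hz
  refine pole_of_eventuallyEq_div h0 h0' h h1 h2 (g := fun z => -I * ccn k k' z)
    (analyticAt_const.mul (analyticAt_ccn h0 h0' h (jacobiDen_ne_zero h2)))
    (by simp [ccn_ne_zero_of_zero h1 h2]) fun z hz => ?_
  rw [cdn_add h0 h0' h z hz]

theorem meromorphicNFOn_csn : MeromorphicNFOn (csn k k') Set.univ := fun z _ => by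
  by_cases hz : jacobiDen k k' z = 0
  · exact (csn_pole h0 h0' h hz).2
  · exact (analyticAt_csn h0 h0' h hz).meromorphicNFAt

theorem meromorphicNFOn_ccn : MeromorphicNFOn (ccn k k') Set.univ := fun z _ => by
  by_cases hz : jacobiDen k k' z = 0
  · exact (ccn_pole h0 h0' h hz).2
  · exact (analyticAt_ccn h0 h0' h hz).meromorphicNFAt

theorem meromorphicNFOn_cdn : MeromorphicNFOn (cdn k k') Set.univ := fun z _ => by
  by_cases hz : jacobiDen k k' z = 0
  · exact (cdn_pole h0 h0' h hz).2
  · exact (analyticAt_cdn h0 h0' h hz).meromorphicNFAt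

omit h0 h0' h in
theorem csn_ofReal (x : ℝ) (hk' : k' ^ 2 < 1) : csn k k' x = rsn k x := by
  simp [csn, jacobiDen, rsn_zero hk', rcn_zero hk', rdn_zero hk']

omit h0 h0' h in
theorem ccn_ofReal (x : ℝ) (hk' : k' ^ 2 < 1) : ccn k k' x = rcn k x := by
  simp [ccn, jacobiDen, rsn_zero hk', rcn_zero hk']

omit h0 h0' h in
theorem cdn_ofReal (x : ℝ) (hk' : k' ^ 2 < 1) : cdn k k' x = rdn k x := by
  simp [cdn, jacobiDen, rsn_zero hk', rcn_zero hk', rdn_zero hk']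

/-! ### Identification with the meromorphic functions of the statement -/

omit h0 in
/-- Uniqueness of the meromorphic inverse of the elliptic integral. -/
theorem InvertsEllipticF.unique {g : ℝ → ℝ} {f₁ f₂ : ℂ → ℂ} (hf₁ : InvertsEllipticF k g f₁)
    (hf₂ : InvertsEllipticF k g f₂) : f₁ = f₂ := by
  have hk := modulus_sq_lt_one h0' h
  have hm : MeromorphicOn (f₁ - f₂) Set.univ := hf₁.1.meromorphicOn.sub hf₂.1.meromorphicOn
  have hF : Continuous fun x => ellipticF x k := by
    have : (fun x => ellipticF x k) = fun x => legendreInt k (Real.arcsin x) := rfl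
    rw [this]
    exact (continuous_legendreInt hk).comp Real.continuous_arcsin
  have hF0 : ellipticF 0 k = 0 := by simp [ellipticF]
  -- The points `ellipticF x k` with `x` decreasing to `0` accumulate at `0` without reaching it,
  -- and the two functions agree at each of them.
  have htop : meromorphicOrderAt (f₁ - f₂) 0 = ⊤ := by
    by_contra hne
    have hev := (meromorphicOrderAt_ne_top_iff_eventually_ne_zero (hm 0 (Set.mem_univ _))).1 hne
    have ht : Filter.Tendsto (fun x : ℝ => (ellipticF x k : ℂ)) (𝓝[>] 0) (𝓝[≠] 0) := by
      refine tendsto_nhdsWithin_iff.2 ⟨?_, ?_⟩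
      · have : Filter.Tendsto (fun x : ℝ => (ellipticF x k : ℂ)) (𝓝 0) (𝓝 0) := by
          have := (Complex.continuous_ofReal.comp hF).tendsto 0
          simpa [hF0, Function.comp_def] using! this
        exact this.mono_left nhdsWithin_le_nhds
      · filter_upwards [Ioo_mem_nhdsGT (zero_lt_one' ℝ)] with x hx h0
        have h1 : ellipticF x k = 0 := by simpa using h0
        have h2 := rsn_ellipticF hk (x := x) (by linarith [hx.1]) hx.2.le
        rw [h1, rsn_zero hk] at h2
        exact hx.1.ne h2
    obtain ⟨x, hx, hx'⟩ := ((ht.eventually hev).and (Ioo_mem_nhdsGT (zero_lt_one' ℝ))).exists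
    apply hx
    have hx2 : x ∈ Set.Ioo (-1 : ℝ) 1 := ⟨by linarith [hx'.1], hx'.2⟩
    rw [Pi.sub_apply, hf₁.2 x hx2, hf₂.2 x hx2, sub_self]
  funext z
  have hz : meromorphicOrderAt (f₁ - f₂) z = ⊤ := by
    by_contra hne
    exact hm.meromorphicOrderAt_ne_top_of_isPreconnected (x := z) (y := 0)
      isPreconnected_univ (Set.mem_univ _) (Set.mem_univ _) hne htop
  have hev : f₁ =ᶠ[𝓝[≠] z] f₂ := by
    filter_upwards [meromorphicOrderAt_eq_top_iff.1 hz] with w hw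
    exact sub_eq_zero.1 hw
  -- Normal form upgrades agreement on a punctured neighbourhood to agreement at `z`, poles
  -- included.
  exact (((hf₁.1 (Set.mem_univ z)).eventuallyEq_nhdsNE_iff_eventuallyEq_nhds
    (hf₂.1 (Set.mem_univ z))).1 hev).self_of_nhds

omit h0 in
theorem InvertsEllipticF.jacobiExtension_eq {g : ℝ → ℝ} {f : ℂ → ℂ} (hf : InvertsEllipticF k g f) :
    jacobiExtension k g = f := by
  have hex : ∃ f, InvertsEllipticF k g f := ⟨f, hf⟩
  rw [jacobiExtension, dif_pos hex]
  exact InvertsEllipticF.unique h0' h hex.choose_spec hf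

theorem jacobiSn_eq : jacobiSn k = csn k k' :=
  InvertsEllipticF.jacobiExtension_eq h0' h ⟨meromorphicNFOn_csn h0 h0' h, fun x hx => by
    rw [csn_ofReal _ (comodulus_sq_lt_one h0 h),
      rsn_ellipticF (modulus_sq_lt_one h0' h) hx.1.le hx.2.le]⟩

theorem jacobiCn_eq : jacobiCn k = ccn k k' :=
  InvertsEllipticF.jacobiExtension_eq h0' h ⟨meromorphicNFOn_ccn h0 h0' h, fun x hx => by
    rw [ccn_ofReal _ (comodulus_sq_lt_one h0 h),
      rcn_ellipticF (modulus_sq_lt_one h0' h)]⟩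

theorem jacobiDn_eq : jacobiDn k = cdn k k' :=
  InvertsEllipticF.jacobiExtension_eq h0' h ⟨meromorphicNFOn_cdn h0 h0' h, fun x hx => by
    rw [cdn_ofReal _ (comodulus_sq_lt_one h0 h),
      rdn_ellipticF (modulus_sq_lt_one h0' h) hx.1.le hx.2.le]⟩

end

/-! ### Order estimates by integration, and Liouville's theorem for a lattice -/

open Asymptotics in
-- Integration gains one order, by the mean value inequality on the disc of radius `‖z‖`.
theorem isBigO_pow_succ_of_hasDerivAt {f f' : ℂ → ℂ} {n : ℕ}
    (hf : ∀ᶠ z in 𝓝 0, HasDerivAt f (f' z) z) (h0 : f 0 = 0)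
    (h : f' =O[𝓝 0] fun z => z ^ n) : f =O[𝓝 0] fun z => z ^ (n + 1) := by
  obtain ⟨c, hc0, hc⟩ := h.exists_nonneg
  obtain ⟨ε, hε, hb⟩ := Metric.eventually_nhds_iff_ball.1 (hf.and hc.bound)
  refine IsBigO.of_bound c ?_
  filter_upwards [Metric.ball_mem_nhds 0 hε] with z hz
  have hsub : ∀ w ∈ Metric.closedBall (0 : ℂ) ‖z‖, w ∈ Metric.ball (0 : ℂ) ε := fun w hw => by
    rw [mem_ball_zero_iff] at hz ⊢
    rw [mem_closedBall_zero_iff] at hw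
    exact hw.trans_lt hz
  have := (convex_closedBall (0 : ℂ) ‖z‖).norm_image_sub_le_of_norm_hasDerivWithin_le
    (C := c * ‖z‖ ^ n) (x := 0) (y := z)
    (fun w hw => (hb w (hsub w hw)).1.hasDerivWithinAt) (fun w hw => by
      refine (hb w (hsub w hw)).2.trans ?_
      rw [norm_pow]
      rw [mem_closedBall_zero_iff] at hw
      gcongr) (by simp) (by simp)
  rw [h0, sub_zero, sub_zero] at this
  rw [norm_pow, pow_succ, ← mul_assoc]
  exact this

/-- The limit removes the singularity at `0`, and periodicity removes it at every lattice point. The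
resulting entire function is bounded because its range is compact, so it is constant. -/
theorem PeriodPair.eq_zero_of_periodic (L : PeriodPair) {f : ℂ → ℂ}
    (hper : ∀ z, ∀ l ∈ L.lattice, f (z + l) = f z)
    (hd : ∀ z ∉ L.lattice, DifferentiableAt ℂ f z) (h0 : f 0 = 0)
    (hc : Filter.Tendsto f (𝓝[≠] 0) (𝓝 0)) : f = 0 := by
  have hd0 : DifferentiableAt ℂ f 0 := by
    refine (Complex.analyticAt_of_differentiable_on_punctured_nhds_of_continuousAt ?_
      ?_).differentiableAt
    · filter_upwards [self_mem_nhdsWithin, mem_nhdsWithin_of_mem_nhds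
        (L.compl_lattice_sdiff_singleton_mem_nhds 0)] with w hw hw'
      exact hd w fun h => hw' ⟨h, hw⟩
    · rw [continuousAt_iff_punctured_nhds, h0]
      exact hc
  have hD : Differentiable ℂ f := fun z => by
    by_cases hz : z ∈ L.lattice
    · have h1 : f = f ∘ fun w => w - z := by
        funext w
        have := hper (w - z) z hz
        rw [sub_add_cancel] at this
        exact this
      rw [h1]
      refine DifferentiableAt.comp z ?_ (by fun_prop)
      rwa [sub_self]
    · exact hd z hz
  funext z
  rw [hD.apply_eq_apply_of_bounded (IsZLattice.isCompact_range_of_periodic L.lattice _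
    hD.continuous hper).isBounded z 0, h0]
  rfl

/-- If `c` were omitted, `1/(℘ - c)`, extended by `0` at the lattice, would be entire and periodic,
hence zero. -/
theorem PeriodPair.exists_weierstrassP_eq (L : PeriodPair) (c : ℂ) :
    ∃ u, u ∉ L.lattice ∧ L.weierstrassP u = c := by
  classical
  by_contra! hne
  let f : ℂ → ℂ := fun z => if z ∈ L.lattice then 0 else (L.weierstrassP z - c)⁻¹
  have hf : f = 0 := by
    refine L.eq_zero_of_periodic (fun z l hl => ?_) (fun z hz => ?_) (by simp [f]) ?_
    · simp only [f, Submodule.add_mem_iff_left _ hl]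
      rw [L.weierstrassP_add_coe z ⟨l, hl⟩]
    · have h1 : DifferentiableAt ℂ (fun z => (L.weierstrassP z - c)⁻¹) z :=
        ((L.analyticOnNhd_weierstrassP z hz).differentiableAt.sub_const c).inv
          (sub_ne_zero.2 (hne z hz))
      refine h1.congr_of_eventuallyEq ?_
      filter_upwards [L.isClosed_lattice.isOpen_compl.mem_nhds hz] with w hw
      exact if_neg hw
    · have h1 : Filter.Tendsto L.weierstrassP (𝓝[≠] 0) (Bornology.cobounded ℂ) := by
        apply tendsto_cobounded_of_meromorphicOrderAt_neg
        rw [L.order_weierstrassP 0 (zero_mem _)]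
        decide
      have h2 : Filter.Tendsto (fun z => (L.weierstrassP z - c)⁻¹) (𝓝[≠] 0) (𝓝 0) := by
        refine Filter.tendsto_inv₀_cobounded.comp ?_
        have := tendsto_sub_const_cobounded c
        exact this.comp h1
      refine h2.congr' ?_
      filter_upwards [self_mem_nhdsWithin, mem_nhdsWithin_of_mem_nhds
        (L.compl_lattice_sdiff_singleton_mem_nhds 0)] with w hw hw'
      exact (if_neg fun h => hw' ⟨h, hw⟩).symm
  -- Any point off the lattice would do: a vanishing inverse means `℘ - c = 0`, since `0⁻¹ = 0`.
  have h1 := congrFun hf (L.ω₁ / 2)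
  simp only [f, if_neg L.ω₁_div_two_notMem_lattice, Pi.zero_apply, inv_eq_zero, sub_eq_zero] at h1
  exact hne _ L.ω₁_div_two_notMem_lattice h1

/-! ### Expansion of `sn` at the origin -/

section

variable {k k' : ℝ} (h0 : 0 < k) (h0' : 0 < k') (h : k ^ 2 + k' ^ 2 = 1)

include h0 h0' h

omit h0' in
theorem jacobiDen_zero_ne_zero : jacobiDen k k' 0 ≠ 0 :=
  jacobiDen_ne_zero (by simpa using rsn_zero (comodulus_sq_lt_one h0 h))

theorem eventually_jacobiDen_ne_zero : ∀ᶠ z in 𝓝 0, jacobiDen k k' z ≠ 0 :=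
  (isOpen_ne_fun (continuous_jacobiDen (modulus_sq_lt_one h0' h) (comodulus_sq_lt_one h0 h))
    continuous_const).mem_nhds (jacobiDen_zero_ne_zero h0 h)

open Asymptotics in
-- The expansion is bootstrapped from the differential system: crude bounds on `sn`, `cn - 1`, `dn -
-- 1` are fed back and integrated, each round sharpening the order, until the cubic coefficient `-(1
-- + k²)/6` appears.
theorem csn_taylor :
    (fun z => csn k k' z - z) =O[𝓝 0] (fun z => z ^ 3) ∧
    (fun z => csn k k' z - z + (1 + k ^ 2) / 6 * z ^ 3) =O[𝓝 0] (fun z => z ^ 5) := by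
  have hk := modulus_sq_lt_one h0' h
  have hk' := comodulus_sq_lt_one h0 h
  have hev := eventually_jacobiDen_ne_zero h0 h0' h
  have hD := jacobiDen_zero_ne_zero h0 h
  have hs : ∀ᶠ z in 𝓝 0, HasDerivAt (csn k k') (ccn k k' z * cdn k k' z) z :=
    hev.mono fun z hz => hasDerivAt_csn hk hk' h hz
  have hc : ∀ᶠ z in 𝓝 0, HasDerivAt (ccn k k') (-csn k k' z * cdn k k' z) z :=
    hev.mono fun z hz => hasDerivAt_ccn hk hk' h hz
  have hd : ∀ᶠ z in 𝓝 0, HasDerivAt (cdn k k') (-(k : ℂ) ^ 2 * (csn k k' z * ccn k k' z)) z :=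
    hev.mono fun z hz => hasDerivAt_cdn hk hk' h hz
  have s0 : csn k k' 0 = 0 := by simpa [rsn_zero hk] using csn_ofReal (k := k) (k' := k') 0 hk'
  have c0 : ccn k k' 0 = 1 := by simpa [rcn_zero hk] using ccn_ofReal (k := k) (k' := k') 0 hk'
  have d0 : cdn k k' 0 = 1 := by simpa [rdn_zero hk] using cdn_ofReal (k := k) (k' := k') 0 hk'
  have bc : ccn k k' =O[𝓝 0] (fun z : ℂ => z ^ 0) := by
    simpa using (analyticAt_ccn h0 h0' h hD).continuousAt.isBigO_one ℂ
  have bd : cdn k k' =O[𝓝 0] (fun z : ℂ => z ^ 0) := by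
    simpa using (analyticAt_cdn h0 h0' h hD).continuousAt.isBigO_one ℂ
  have bz : ∀ n : ℕ, (fun z : ℂ => z ^ n) =O[𝓝 0] (fun z : ℂ => z ^ n) := fun n => isBigO_refl _ _
  have bs : csn k k' =O[𝓝 0] (fun z : ℂ => z ^ 1) :=
    isBigO_pow_succ_of_hasDerivAt hs s0 (by simpa using bc.mul bd)
  have bc1 : (fun z => ccn k k' z - 1) =O[𝓝 0] (fun z : ℂ => z ^ 2) :=
    isBigO_pow_succ_of_hasDerivAt (hc.mono fun z hz => hz.sub_const 1) (by simp [c0])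
      (by simpa using bs.neg_left.mul bd)
  have bd1 : (fun z => cdn k k' z - 1) =O[𝓝 0] (fun z : ℂ => z ^ 2) :=
    isBigO_pow_succ_of_hasDerivAt (hd.mono fun z hz => hz.sub_const 1) (by simp [d0])
      (by simpa using (bs.mul bc).const_mul_left (-(k : ℂ) ^ 2))
  have bs3 : (fun z => csn k k' z - z) =O[𝓝 0] (fun z : ℂ => z ^ 3) := by
    refine isBigO_pow_succ_of_hasDerivAt (hs.mono fun z hz => hz.sub (hasDerivAt_id z))
      (by simp [s0]) ?_
    have := (bc1.mul bd).add (by simpa using bd1)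
    simp only [pow_zero, mul_one] at this
    exact this.congr_left fun z => by ring
  refine ⟨bs3, ?_⟩
  have bc2 : (fun z => ccn k k' z - 1 + z ^ 2 / 2) =O[𝓝 0] (fun z : ℂ => z ^ 4) := by
    refine isBigO_pow_succ_of_hasDerivAt (hc.mono fun z hz => (hz.sub_const 1).add
      ((hasDerivAt_pow 2 z).div_const 2)) (by simp [c0]) ?_
    have := (bs3.mul bd).add (by simpa [← pow_succ'] using (bz 1).mul bd1)
    simp only [pow_zero, mul_one] at this
    exact this.neg_left.congr_left fun z => by norm_num; ring
  have bd2 : (fun z => cdn k k' z - 1 + k ^ 2 * (z ^ 2 / 2)) =O[𝓝 0] (fun z : ℂ => z ^ 4) := by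
    refine isBigO_pow_succ_of_hasDerivAt (hd.mono fun z hz => (hz.sub_const 1).add
      (((hasDerivAt_pow 2 z).div_const 2).const_mul ((k : ℂ) ^ 2))) (by simp [d0]) ?_
    have := (bs3.mul bc).add (by simpa [← pow_succ'] using (bz 1).mul bc1)
    simp only [pow_zero, mul_one] at this
    exact (this.const_mul_left (-(k : ℂ) ^ 2)).congr_left fun z => by norm_num; ring
  refine isBigO_pow_succ_of_hasDerivAt (hs.mono fun z hz => (hz.sub (hasDerivAt_id z)).add
    ((hasDerivAt_pow 3 z).const_mul ((1 + (k : ℂ) ^ 2) / 6))) (by simp [s0]) ?_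
  have b4 : (fun z => z ^ 2 / 2 * (cdn k k' z - 1)) =O[𝓝 0] (fun z : ℂ => z ^ 4) := by
    have := ((bz 2).mul bd1).const_mul_left (1 / 2)
    simp only [← pow_add] at this
    exact this.congr_left fun z => by ring
  have := ((bc2.mul bd).add (by simpa using bd2)).sub (by simpa using b4)
  simp only [pow_zero, mul_one] at this
  exact this.congr_left fun z => by norm_num; ring

theorem tendsto_csn_inv_sq_sub :
    Filter.Tendsto (fun z => ((csn k k' z)⁻¹) ^ 2 - 1 / z ^ 2) (𝓝[≠] 0)
      (𝓝 ((1 + (k : ℂ) ^ 2) / 3)) := by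
  obtain ⟨h3, h5⟩ := csn_taylor h0 h0' h
  have t1 : Filter.Tendsto (fun z => (csn k k' z - z) / z) (𝓝[≠] 0) (𝓝 0) := by
    refine (Asymptotics.IsLittleO.tendsto_div_nhds_zero ?_).mono_left nhdsWithin_le_nhds
    refine h3.trans_isLittleO ?_
    simpa using Asymptotics.isLittleO_pow_pow (𝕜 := ℂ) (show 1 < 3 by norm_num)
  have t2 : Filter.Tendsto (fun z => (csn k k' z - z + (1 + k ^ 2) / 6 * z ^ 3) / z ^ 3) (𝓝[≠] 0)
      (𝓝 0) := by
    refine (Asymptotics.IsLittleO.tendsto_div_nhds_zero ?_).mono_left nhdsWithin_le_nhds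
    exact h5.trans_isLittleO (Asymptotics.isLittleO_pow_pow (𝕜 := ℂ) (show 3 < 5 by norm_num))
  -- The factorization used is `1/s² - 1/z² = ((z - s)/z³) ((z + s)/z) / (s/z)²` with `s = csn k k'
  -- z`.
  have t3 := ((t2.const_sub ((1 + (k : ℂ) ^ 2) / 6)).mul (t1.const_add 2)).div
    ((t1.const_add 1).pow 2) (by norm_num)
  have e : ((1 + (k : ℂ) ^ 2) / 6 - 0) * (2 + 0) / (1 + 0) ^ 2 = (1 + (k : ℂ) ^ 2) / 3 := by ring
  rw [e] at t3
  refine t3.congr' ?_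
  have hne : ∀ᶠ z in 𝓝[≠] (0 : ℂ), (csn k k' z - z) / z ≠ -1 :=
    t1.eventually_ne (by norm_num)
  filter_upwards [hne, self_mem_nhdsWithin] with z hz hz0
  have hz0' : z ≠ 0 := hz0
  have hs : csn k k' z ≠ 0 := by
    intro hs
    rw [hs, zero_sub, neg_div, div_self hz0'] at hz
    exact hz rfl
  have e1 : 1 + (csn k k' z - z) / z = csn k k' z / z := by field_simp; ring
  simp only [Pi.div_apply]
  rw [e1]
  field_simp
  ring

end

theorem neg_one_zpow_sq {R : Type*} [DivisionRing R] (n : ℤ) : ((-1 : R) ^ n) ^ 2 = 1 := by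
  rcases Int.even_or_odd n with h | h
  · simp [h.neg_one_zpow]
  · simp [h.neg_one_zpow]

/-! ### The Weierstrass function in terms of `sn` -/

namespace O4Multiplet

variable (C : O4Multiplet)

theorem sqrt_ρ_pos : 0 < √C.ρ := Real.sqrt_pos.2 C.ρ_pos

theorem k_sq_lt_one : C.k ^ 2 < 1 := modulus_sq_lt_one C.k'_pos C.k_sq_add_sq

theorem k'_sq_lt_one : C.k' ^ 2 < 1 := comodulus_sq_lt_one C.k_pos C.k_sq_add_sq

theorem K_pos : 0 < ellipticK C.k := ellipticK_pos C.k_pos C.k_lt_one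

theorem K'_pos : 0 < ellipticK C.k' := ellipticK_pos C.k'_pos C.k'_lt_one

/-- The argument `√ρ u` of the Jacobi functions. -/
def arg (u : ℂ) : ℂ := ((√C.ρ : ℝ) : ℂ) * u

theorem arg_add (u v : ℂ) : C.arg (u + v) = C.arg u + C.arg v := mul_add _ _ _

theorem arg_two_ω (m : ℤ) : C.arg (m * (2 * (C.ω : ℂ))) = ((m * (2 * ellipticK C.k) : ℝ) : ℂ) := by
  have : ((√C.ρ : ℝ) : ℂ) ≠ 0 := by exact_mod_cast C.sqrt_ρ_pos.ne'
  simp only [arg, ω]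
  push_cast
  field_simp

theorem arg_two_ω' (m : ℤ) :
    C.arg (m * (2 * C.ω')) = ((m * (2 * ellipticK C.k') : ℝ) : ℂ) * I := by
  have : ((√C.ρ : ℝ) : ℂ) ≠ 0 := by exact_mod_cast C.sqrt_ρ_pos.ne'
  simp only [arg, ω']
  push_cast
  field_simp

theorem mem_Λ {u : ℂ} : u ∈ C.Λ ↔ ∃ m n : ℤ, m * (2 * (C.ω : ℂ)) + n * (2 * C.ω') = u :=
  PeriodPair.mem_lattice

theorem arg_eq_iff {u v : ℂ} : C.arg u = C.arg v ↔ u = v :=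
  mul_right_inj' (by exact_mod_cast C.sqrt_ρ_pos.ne')

theorem mem_Λ_iff {u : ℂ} : u ∈ C.Λ ↔ jacobiNumS C.k C.k' (C.arg u) = 0 := by
  rw [mem_Λ]
  constructor
  · rintro ⟨m, n, rfl⟩
    have h1 := rsn_add_int_mul C.k_sq_lt_one 0 m
    have h2 := rsn_add_int_mul C.k'_sq_lt_one 0 n
    rw [zero_add, rsn_zero C.k_sq_lt_one, mul_zero] at h1
    rw [zero_add, rsn_zero C.k'_sq_lt_one, mul_zero] at h2
    rw [arg_add, arg_two_ω, arg_two_ω', jacobiNumS]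
    simp only [Complex.add_re, Complex.add_im, Complex.mul_I_re, Complex.mul_I_im,
      Complex.ofReal_im, Complex.ofReal_re, neg_zero, add_zero, zero_add, h1, h2]
    ring
  · intro h
    obtain ⟨h1, h2⟩ := jacobiNumS_eq_zero h
    obtain ⟨m, hm⟩ := exists_eq_of_rsn_eq_zero C.k_sq_lt_one C.K_pos h1
    obtain ⟨n, hn⟩ := exists_eq_of_rsn_eq_zero C.k'_sq_lt_one C.K'_pos h2
    refine ⟨m, n, ?_⟩
    rw [← C.arg_eq_iff, arg_add, arg_two_ω, arg_two_ω', ← hm, ← hn, Complex.re_add_im]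

theorem csn_add_periods (z : ℂ) (m n : ℤ) :
    csn C.k C.k' (z + ((m * (2 * ellipticK C.k) : ℝ) : ℂ) +
      ((n * (2 * ellipticK C.k') : ℝ) : ℂ) * I) = (-1) ^ m * csn C.k C.k' z := by
  simp only [csn, jacobiDen, Complex.add_re, Complex.add_im, Complex.mul_I_re, Complex.mul_I_im,
      Complex.ofReal_im, Complex.ofReal_re, neg_zero, add_zero, rsn_add_int_mul C.k_sq_lt_one,
      rsn_add_int_mul C.k'_sq_lt_one, rcn_add_int_mul C.k_sq_lt_one,
      rcn_add_int_mul C.k'_sq_lt_one, rdn_add_int_mul C.k_sq_lt_one,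
      rdn_add_int_mul C.k'_sq_lt_one, mul_pow,
      neg_one_zpow_sq, one_mul]
  rw [← mul_div_assoc]
  congr 1
  push_cast
  linear_combination (-1) ^ m * I * rcn C.k z.re * rdn C.k z.re * rsn C.k' z.im * rcn C.k' z.im *
    neg_one_zpow_sq (R := ℂ) n

/-- Both sides are `Λ`-periodic, the sign of `sn` under `2ω` disappearing in the square. Both have
principal part `1/u²` at `0`, and `e₃ = -ρ(1 + k²)/3` is exactly what cancels the constant term of
`ρ ns²`. -/
theorem weierstrassP_eq {u : ℂ} (hu : u ∉ C.Λ) :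
    C.periods.weierstrassP u = C.e₃ + C.ρ * ((csn C.k C.k' (C.arg u))⁻¹) ^ 2 := by
  classical
  let f : ℂ → ℂ := fun u => if u ∈ C.Λ then 0 else
    C.e₃ + C.ρ * ((csn C.k C.k' (C.arg u))⁻¹) ^ 2 - C.periods.weierstrassP u
  have hρ : ((√C.ρ : ℝ) : ℂ) ^ 2 = C.ρ := by exact_mod_cast Real.sq_sqrt C.ρ_pos.le
  have hρ0 : ((√C.ρ : ℝ) : ℂ) ≠ 0 := by exact_mod_cast C.sqrt_ρ_pos.ne'
  have hk0 : (C.k : ℂ) ≠ 0 := by exact_mod_cast C.k_pos.ne'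
  have hf : f = 0 := by
    refine C.periods.eq_zero_of_periodic (fun z l hl => ?_) (fun z hz => ?_)
      (if_pos (zero_mem _)) ?_
    · have hl' : l ∈ C.Λ := hl
      simp only [f, Submodule.add_mem_iff_left _ hl']
      rw [C.periods.weierstrassP_add_coe z ⟨l, hl⟩]
      obtain ⟨m, n, rfl⟩ := C.mem_Λ.1 hl'
      rw [arg_add, arg_add, arg_two_ω, arg_two_ω', ← add_assoc, csn_add_periods, inv_pow, mul_pow,
        neg_one_zpow_sq, one_mul, inv_pow]
    · have hz' : z ∉ C.Λ := hz
      have hN : jacobiNumS C.k C.k' (C.arg z) ≠ 0 := fun h => hz' (C.mem_Λ_iff.2 h)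
      have hd := (rdn_pos C.k'_sq_lt_one (C.arg z).im).ne'
      -- Where `sn` has a pole, differentiability of `1/sn` is not visible from the quotient. It is
      -- replaced by `k sn(· + iK')`, whose denominator is a positive multiple of `jacobiNumS` and
      -- so vanishes only on the lattice.
      have hD : jacobiDen C.k C.k' (C.arg z + ellipticK C.k' * I) ≠ 0 := by
        rw [jacobiDen_add C.k_pos C.k_sq_add_sq]
        exact div_ne_zero (mul_ne_zero (pow_ne_zero 2 C.k_pos.ne') hN) (pow_ne_zero 2 hd)
      have h1 : DifferentiableAt ℂ (fun z => csn C.k C.k' (C.arg z + ellipticK C.k' * I)) z := by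
        refine (analyticAt_csn C.k_pos C.k'_pos C.k_sq_add_sq hD).differentiableAt.fun_comp' z ?_
        unfold arg
        fun_prop
      have h2 : DifferentiableAt ℂ (fun z => (C.e₃ : ℂ) + C.ρ *
          (C.k * csn C.k C.k' (C.arg z + ellipticK C.k' * I)) ^ 2 - C.periods.weierstrassP z) z :=
        (((h1.const_mul _).pow 2).const_mul _).const_add _ |>.sub
          (C.periods.analyticOnNhd_weierstrassP z hz).differentiableAt
      refine h2.congr_of_eventuallyEq ?_
      filter_upwards [C.periods.isClosed_lattice.isOpen_compl.mem_nhds hz] with w hw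
      have hw' : w ∉ C.Λ := hw
      simp only [f, if_neg hw', csn_add_eq_inv C.k_pos C.k'_pos C.k_sq_add_sq, mul_inv,
        mul_inv_cancel_left₀ hk0]
    · have ht : Filter.Tendsto C.arg (𝓝[≠] 0) (𝓝[≠] 0) := by
        refine tendsto_nhdsWithin_iff.2 ⟨?_, ?_⟩
        · have : Continuous C.arg := by unfold arg; fun_prop
          have := this.tendsto 0
          rw [arg, mul_zero] at this
          exact this.mono_left nhdsWithin_le_nhds
        · filter_upwards [self_mem_nhdsWithin] with z hz
          exact mul_ne_zero hρ0 hz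
      have h1 := (((tendsto_csn_inv_sq_sub C.k_pos C.k'_pos C.k_sq_add_sq).comp ht).const_mul
        (C.ρ : ℂ)).const_add (C.e₃ : ℂ)
      have h2 : Filter.Tendsto (C.periods.weierstrassPExcept 0) (𝓝[≠] 0) (𝓝 0) := by
        have := (C.periods.analyticAt_weierstrassPExcept 0).continuousAt.tendsto
        rw [C.periods.weierstrassPExcept_zero] at this
        exact this.mono_left nhdsWithin_le_nhds
      have h3 := h1.sub h2
      have e : (C.e₃ : ℂ) + C.ρ * ((1 + (C.k : ℂ) ^ 2) / 3) - 0 = 0 := by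
        simp only [e₃]; push_cast; ring
      rw [e] at h3
      refine h3.congr' ?_
      filter_upwards [self_mem_nhdsWithin, mem_nhdsWithin_of_mem_nhds
        (C.periods.compl_lattice_sdiff_singleton_mem_nhds 0)] with w hw hw'
      have hw0 : w ≠ 0 := hw
      have hw2 : w ∉ C.Λ := fun h => hw' ⟨h, hw⟩
      have h4 := C.periods.weierstrassPExcept_add 0 w
      simp only [ZeroMemClass.coe_zero, sub_zero] at h4
      simp only [f, if_neg hw2, ← h4, Function.comp_apply]
      rw [show C.arg w ^ 2 = C.ρ * w ^ 2 by rw [arg, mul_pow, hρ]]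
      have : (C.ρ : ℂ) ≠ 0 := by exact_mod_cast C.ρ_pos.ne'
      field_simp
      ring
  have := congrFun hf u
  simp only [f, if_neg hu, Pi.zero_apply, sub_eq_zero] at this
  exact this.symm

end O4Multiplet

/-! ### Cross-ratios on the sphere -/

/-- The antipode of `[p : q]` is `[-conj q : conj p]`. The factor `l` accounts for normalized
coordinates and cancels in every cross-ratio. -/
theorem exists_sphereCoord_antipode (z : OnePoint ℂ) :
    ∃ l : ℂ, l ≠ 0 ∧ (sphereCoord (antipode z)).1 = -(l * conj (sphereCoord z).2) ∧
      (sphereCoord (antipode z)).2 = l * conj (sphereCoord z).1 := by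
  induction z using OnePoint.rec with
  | infty => exact ⟨1, by simp⟩
  | coe z =>
    by_cases hz : z = 0
    · exact ⟨-1, by simp [hz, antipode_coe_zero]⟩
    · have : conj z ≠ 0 := by simpa using hz
      refine ⟨(conj z)⁻¹, by simpa using hz, ?_⟩
      simp [antipode_coe hz, this, neg_div]

theorem sphereInner_self (z : OnePoint ℂ) : sphereInner z z = (sphereNorm z : ℂ) ^ 2 := by
  have : sphereNorm z ^ 2 = ‖(sphereCoord z).1‖ ^ 2 + ‖(sphereCoord z).2‖ ^ 2 :=
    Real.sq_sqrt (by positivity)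
  rw [← Complex.ofReal_pow, this, sphereInner, Complex.conj_mul', Complex.conj_mul']
  push_cast
  rfl

theorem sphereInner_self_ne_zero (z : OnePoint ℂ) : sphereInner z z ≠ 0 := by
  rw [sphereInner_self]
  exact pow_ne_zero 2 (by exact_mod_cast (sphereNorm_pos z).ne')

theorem conj_sphereInner (z w : OnePoint ℂ) : conj (sphereInner z w) = sphereInner w z := by
  simp only [sphereInner, map_add, map_mul, Complex.conj_conj]
  ring

theorem sphereDet_swap (z w : OnePoint ℂ) : sphereDet w z = -sphereDet z w := by
  simp only [sphereDet]; ring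

theorem sphereDet_self (z : OnePoint ℂ) : sphereDet z z = 0 := by simp [sphereDet]

theorem sphereDet_ne_zero {z w : OnePoint ℂ} (h : z ≠ w) : sphereDet z w ≠ 0 :=
  fun h' => h (eq_of_sphereDet_eq_zero h')

theorem antipode_eq_iff {z w : OnePoint ℂ} :
    antipode z = w ↔ sphereInner z w = 0 := by
  refine ⟨fun h => ?_, fun h => (eq_antipode_of_sphereInner_eq_zero h).symm⟩
  subst h
  obtain ⟨l, -, h1, h2⟩ := exists_sphereCoord_antipode z
  rw [sphereInner, h1, h2]
  ring

theorem crossRatio_antipode (z a b : OnePoint ℂ) :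
    crossRatio z (antipode a) a b =
      sphereDet z a * sphereInner a b / (sphereDet z b * sphereInner a a) := by
  obtain ⟨l, h0, h1, h2⟩ := exists_sphereCoord_antipode a
  have e : ∀ w, sphereDet (antipode a) w = -l * sphereInner a w := fun w => by
    rw [sphereDet, h1, h2, sphereInner]; ring
  rw [crossRatio, e, e, mul_left_comm, mul_left_comm (sphereDet z b),
    mul_div_mul_left _ _ (neg_ne_zero.2 h0)]

theorem crossRatio_antipode_antipode (z a b : OnePoint ℂ) :
    crossRatio (antipode z) (antipode a) a b =
      sphereInner z a * sphereInner a b / (sphereInner z b * sphereInner a a) := by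
  obtain ⟨l, h0, h1, h2⟩ := exists_sphereCoord_antipode z
  have e : ∀ w, sphereDet (antipode z) w = -l * sphereInner z w := fun w => by
    rw [sphereDet, h1, h2, sphereInner]; ring
  rw [crossRatio_antipode, e, e, mul_assoc, mul_assoc (-l),
    mul_div_mul_left _ _ (neg_ne_zero.2 h0)]

/-- Three vectors of `ℂ²` satisfy `det(z,a) b + det(a,b) z + det(b,z) a = 0`; this is the Hermitian
product of that relation with `a`. -/
theorem sphere_plucker (z a b : OnePoint ℂ) :
    sphereDet z a * sphereInner a b - sphereDet z b * sphereInner a a =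
      sphereInner a z * sphereDet b a := by
  simp only [sphereDet, sphereInner]; ring

theorem crossRatio_antipode_sub_one {z a b : OnePoint ℂ} (hzb : z ≠ b) :
    crossRatio z (antipode a) a b - 1 =
      sphereInner a z * sphereDet b a / (sphereDet z b * sphereInner a a) := by
  have h1 := sphereDet_ne_zero hzb
  have h2 := sphereInner_self_ne_zero a
  rw [crossRatio_antipode, ← sphere_plucker]
  field_simp

theorem chordK_sq_eq (z w : OnePoint ℂ) :
    (chordK z w : ℂ) ^ 2 =
      sphereInner z w * sphereInner w z / (sphereInner z z * sphereInner w w) := by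
  rw [chordK, sphereInner_self, sphereInner_self, ← conj_sphereInner z w, Complex.mul_conj']
  push_cast
  rw [div_pow, mul_pow]

theorem crossRatio_antipode_sub_sq {z a b : OnePoint ℂ} (hzb : z ≠ b) :
    crossRatio z (antipode a) a b - (chordK a b : ℂ) ^ 2 =
      sphereInner a b * (sphereInner b z * sphereDet b a) /
        (sphereDet z b * (sphereInner a a * sphereInner b b)) := by
  have h1 := sphereDet_ne_zero hzb
  have h2 := sphereInner_self_ne_zero a
  have h3 := sphereInner_self_ne_zero b
  have h4 := sphere_plucker z b a
  rw [sphereDet_swap b a] at h4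
  rw [crossRatio_antipode, chordK_sq_eq]
  field_simp
  linear_combination -sphereInner a b * h4

theorem norm_sphereInner (z w : OnePoint ℂ) :
    ‖sphereInner z w‖ = chordK z w * (sphereNorm z * sphereNorm w) := by
  have := sphereNorm_pos z
  have := sphereNorm_pos w
  rw [chordK]
  field_simp

theorem norm_sphereDet (z w : OnePoint ℂ) :
    ‖sphereDet z w‖ = chordK' z w * (sphereNorm z * sphereNorm w) := by
  have := sphereNorm_pos z
  have := sphereNorm_pos w
  rw [chordK']
  field_simp

theorem chordK'_comm (z w : OnePoint ℂ) : chordK' z w = chordK' w z := by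
  rw [chordK', chordK', sphereDet_swap, norm_neg, mul_comm (sphereNorm z)]

theorem chordK_self (z : OnePoint ℂ) : chordK z z = 1 := by
  have := sphereNorm_pos z
  rw [chordK, sphereInner_self]
  simp [abs_of_pos this]
  field_simp

theorem chordK'_self (z : OnePoint ℂ) : chordK' z z = 0 := by
  simp [chordK', sphereDet_self]

theorem chordK_nonneg (z w : OnePoint ℂ) : 0 ≤ chordK z w :=
  div_nonneg (norm_nonneg _) (mul_pos (sphereNorm_pos _) (sphereNorm_pos _)).le

theorem chordK'_nonneg (z w : OnePoint ℂ) : 0 ≤ chordK' z w :=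
  div_nonneg (norm_nonneg _) (mul_pos (sphereNorm_pos _) (sphereNorm_pos _)).le

theorem chordK'_pos {z w : OnePoint ℂ} (h : z ≠ w) : 0 < chordK' z w :=
  div_pos (norm_pos_iff.2 (sphereDet_ne_zero h)) (mul_pos (sphereNorm_pos _) (sphereNorm_pos _))

theorem norm_crossRatio_antipode (z a b : OnePoint ℂ) :
    ‖crossRatio z (antipode a) a b‖ = chordK a b * chordK' a z / chordK' b z := by
  rw [crossRatio_antipode, norm_div, norm_mul, norm_mul, norm_sphereDet, norm_sphereDet,
    norm_sphereInner, norm_sphereInner, chordK_self, chordK'_comm z, chordK'_comm z]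
  have := sphereNorm_pos z
  have := sphereNorm_pos a
  have := sphereNorm_pos b
  field_simp

theorem norm_crossRatio_antipode_sub_one {z a b : OnePoint ℂ} (hzb : z ≠ b) :
    ‖crossRatio z (antipode a) a b - 1‖ = chordK' a b * chordK a z / chordK' b z := by
  rw [crossRatio_antipode_sub_one hzb, norm_div, norm_mul, norm_mul, norm_sphereDet,
    norm_sphereDet, norm_sphereInner, norm_sphereInner, chordK_self, chordK'_comm z,
    chordK'_comm b a]
  have := sphereNorm_pos z
  have := sphereNorm_pos a
  have := sphereNorm_pos b
  field_simp

theorem norm_crossRatio_antipode_sub_sq {z a b : OnePoint ℂ} (hzb : z ≠ b) :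
    ‖crossRatio z (antipode a) a b - (chordK a b : ℂ) ^ 2‖ =
      chordK a b * chordK' a b * chordK b z / chordK' b z := by
  rw [crossRatio_antipode_sub_sq hzb]
  simp only [norm_div, norm_mul, norm_sphereDet, norm_sphereInner, chordK_self]
  rw [chordK'_comm z, chordK'_comm b a]
  have := sphereNorm_pos z
  have := sphereNorm_pos a
  have := sphereNorm_pos b
  field_simp

/-- The Möbius map on the right sends `ns² v` to `k² cd² v = ns²(v + K + iK')`, so the identity is
the real structure read on the cross-ratio. -/
theorem conj_crossRatio_antipode {z a b : OnePoint ℂ} (hzb : z ≠ b) (hab : a ≠ b)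
    (h : sphereInner a b ≠ 0) :
    conj (crossRatio (antipode z) (antipode a) a b) =
      (chordK a b : ℂ) ^ 2 * ((crossRatio z (antipode a) a b - 1) /
        (crossRatio z (antipode a) a b - (chordK a b : ℂ) ^ 2)) := by
  have h1 := sphereDet_ne_zero hzb
  have h2 := sphereDet_ne_zero hab.symm
  have h3 := sphereInner_self_ne_zero a
  have h4 := sphereInner_self_ne_zero b
  rw [crossRatio_antipode_sub_sq hzb, crossRatio_antipode_sub_one hzb, chordK_sq_eq,
    crossRatio_antipode_antipode]
  simp only [map_div₀, map_mul, conj_sphereInner]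
  -- If `antipode z = b`, both sides are quotients by zero, hence `0`.
  by_cases h5 : sphereInner b z = 0
  · simp [h5]
  field_simp

theorem crossRatio_antipode_self (a b : OnePoint ℂ) :
    crossRatio (antipode b) (antipode a) a b = (chordK a b : ℂ) ^ 2 := by
  rw [crossRatio_antipode_antipode, chordK_sq_eq]
  ring

/-! ### Moduli of the squares of the Jacobi functions -/

/-- `jacobiNumC k k' z / jacobiDen k k' z` is `|cn z|²`. -/
def jacobiNumC (k k' : ℝ) (z : ℂ) : ℝ :=
  rcn k z.re ^ 2 + k' ^ 2 * rsn k z.re ^ 2 * rsn k' z.im ^ 2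

/-- `jacobiNumD k k' z / jacobiDen k k' z` is `|dn z|²`. -/
def jacobiNumD (k k' : ℝ) (z : ℂ) : ℝ :=
  rdn k z.re ^ 2 * rcn k' z.im ^ 2 + k ^ 2 * rcn k z.re ^ 2 * rsn k' z.im ^ 2

/-- With `ns` written over `jacobiNumS`, the functions `cs² = ns² - 1` and, in the next lemma, `ds²
= ns² - κ²` have perfect squares as numerators. Their moduli are then sums of two real squares. -/
theorem ns_sq_sub_one {s c d s' c' d' κ i : ℂ} (e1 : c ^ 2 = 1 - s ^ 2)
    (e2 : d ^ 2 = 1 - κ ^ 2 * s ^ 2) (e3 : c' ^ 2 = 1 - s' ^ 2)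
    (e4 : d' ^ 2 = 1 - (1 - κ ^ 2) * s' ^ 2) (eI : i ^ 2 = -1) :
    (s * d' - i * (c * d * s' * c')) ^ 2 - (s ^ 2 * c' ^ 2 + s' ^ 2) ^ 2 =
      (s * c * c' * d' - d * s' * i) ^ 2 := by
  grind

theorem ns_sq_sub_sq {s c d s' c' d' κ i : ℂ} (e1 : c ^ 2 = 1 - s ^ 2)
    (e2 : d ^ 2 = 1 - κ ^ 2 * s ^ 2) (e3 : c' ^ 2 = 1 - s' ^ 2)
    (e4 : d' ^ 2 = 1 - (1 - κ ^ 2) * s' ^ 2) (eI : i ^ 2 = -1) :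
    (s * d' - i * (c * d * s' * c')) ^ 2 - κ ^ 2 * (s ^ 2 * c' ^ 2 + s' ^ 2) ^ 2 =
      (s * d * c' - c * s' * d' * i) ^ 2 := by
  grind

/-- A cross-multiplied form of `cd = cs/ds` at `conj v`, linking the numerator of `cd` to those of
`cs` and `ds`. -/
theorem cs_mul_ds {s c d s' c' d' κ i : ℂ} (e1 : c ^ 2 = 1 - s ^ 2)
    (e2 : d ^ 2 = 1 - κ ^ 2 * s ^ 2) (e3 : c' ^ 2 = 1 - s' ^ 2)
    (e4 : d' ^ 2 = 1 - (1 - κ ^ 2) * s' ^ 2) (eI : i ^ 2 = -1) :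
    (c * d * d' + (1 - κ ^ 2) * s * s' * c' * i) * (s * d * c' + c * s' * d' * i) =
      (d ^ 2 * c' ^ 2 + κ ^ 2 * c ^ 2 * s' ^ 2) * (s * c * c' * d' + d * s' * i) := by
  grind

theorem norm_sq_sub_mul_I (x y : ℝ) : ‖((x : ℂ) - y * I) ^ 2‖ = x ^ 2 + y ^ 2 := by
  rw [norm_pow, ← Complex.normSq_eq_norm_sq, Complex.normSq_apply]
  simp
  ring

section

variable {k k' : ℝ} (h0 : 0 < k) (h0' : 0 < k') (h : k ^ 2 + k' ^ 2 = 1)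

theorem jacobiNumS_nonneg (z : ℂ) : 0 ≤ jacobiNumS k k' z := by unfold jacobiNumS; positivity

include h0 h0' h

theorem csn_inv (z : ℂ) : (csn k k' z)⁻¹ =
    (rsn k z.re * rdn k' z.im - I * (rcn k z.re * rdn k z.re * rsn k' z.im * rcn k' z.im)) /
        jacobiNumS k k' z := by
  have hk0 : (k : ℂ) ≠ 0 := by exact_mod_cast h0.ne'
  have h1 := csn_add_eq_inv h0 h0' h z
  rw [csn_add h0 h] at h1
  rw [← mul_right_inj' (inv_ne_zero hk0), ← mul_inv, ← h1]
  field_simp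

theorem norm_csn_inv_sq {z : ℂ} (hz : jacobiNumS k k' z ≠ 0) :
    ‖((csn k k' z)⁻¹) ^ 2‖ * jacobiNumS k k' z = jacobiDen k k' z := by
  have hk := modulus_sq_lt_one h0' h
  have hk' := comodulus_sq_lt_one h0 h
  have e1 := rcn_sq k z.re
  have e2 := rdn_sq hk z.re
  have e3 := rcn_sq k' z.im
  have e4 := rdn_sq hk' z.im
  have e0 : k' ^ 2 = 1 - k ^ 2 := by linarith
  rw [e0] at e4
  have := norm_sq_sub_mul_I (rsn k z.re * rdn k' z.im)
    (rcn k z.re * rdn k z.re * rsn k' z.im * rcn k' z.im)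
  rw [csn_inv h0 h0' h, div_pow, norm_div, mul_comm I]
  push_cast at this
  rw [this, norm_pow, Complex.norm_real, Real.norm_of_nonneg (jacobiNumS_nonneg z)]
  field_simp
  unfold jacobiNumS jacobiDen
  generalize rsn k z.re = s at *
  generalize rcn k z.re = c at *
  generalize rdn k z.re = d at *
  generalize rsn k' z.im = s' at *
  generalize rcn k' z.im = c' at *
  generalize rdn k' z.im = d' at *
  clear this hz h0 h0' h hk hk'
  grind

theorem csn_inv_sq_sub_one {z : ℂ} (hz : jacobiNumS k k' z ≠ 0) :
    ((csn k k' z)⁻¹) ^ 2 - 1 = (rsn k z.re * rcn k z.re * rcn k' z.im * rdn k' z.im -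
      rdn k z.re * rsn k' z.im * I) ^ 2 / jacobiNumS k k' z ^ 2 := by
  obtain ⟨e0, e1, e2, e3, e4⟩ := rsn_rcn_rdn_relations (modulus_sq_lt_one h0' h)
    (comodulus_sq_lt_one h0 h) h z.re z.im
  have hN : (jacobiNumS k k' z : ℂ) ≠ 0 := by exact_mod_cast hz
  have hN' : (jacobiNumS k k' z : ℂ) = rsn k z.re ^ 2 * rcn k' z.im ^ 2 + rsn k' z.im ^ 2 := by
    simp [jacobiNumS]
  rw [csn_inv h0 h0' h, div_pow, ← ns_sq_sub_one e1 e2 e3 e4 Complex.I_sq, ← hN', sub_div,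
    div_self (pow_ne_zero 2 hN)]

theorem csn_inv_sq_sub_sq {z : ℂ} (hz : jacobiNumS k k' z ≠ 0) :
    ((csn k k' z)⁻¹) ^ 2 - k ^ 2 = (rsn k z.re * rdn k z.re * rcn k' z.im -
      rcn k z.re * rsn k' z.im * rdn k' z.im * I) ^ 2 / jacobiNumS k k' z ^ 2 := by
  obtain ⟨e0, e1, e2, e3, e4⟩ := rsn_rcn_rdn_relations (modulus_sq_lt_one h0' h)
    (comodulus_sq_lt_one h0 h) h z.re z.im
  have hN : (jacobiNumS k k' z : ℂ) ≠ 0 := by exact_mod_cast hz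
  have hN' : (jacobiNumS k k' z : ℂ) = rsn k z.re ^ 2 * rcn k' z.im ^ 2 + rsn k' z.im ^ 2 := by
    simp [jacobiNumS]
  rw [csn_inv h0 h0' h, div_pow, ← ns_sq_sub_sq e1 e2 e3 e4 Complex.I_sq, ← hN', sub_div,
    mul_div_cancel_right₀ _ (pow_ne_zero 2 hN)]

theorem norm_csn_inv_sq_sub_one {z : ℂ} (hz : jacobiNumS k k' z ≠ 0) :
    ‖((csn k k' z)⁻¹) ^ 2 - 1‖ * jacobiNumS k k' z = jacobiNumC k k' z := by
  have hk := modulus_sq_lt_one h0' h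
  have hk' := comodulus_sq_lt_one h0 h
  have e1 := rcn_sq k z.re
  have e2 := rdn_sq hk z.re
  have e3 := rcn_sq k' z.im
  have e4 := rdn_sq hk' z.im
  have e0 : k' ^ 2 = 1 - k ^ 2 := by linarith
  rw [e0] at e4
  have := norm_sq_sub_mul_I (rsn k z.re * rcn k z.re * rcn k' z.im * rdn k' z.im)
    (rdn k z.re * rsn k' z.im)
  rw [csn_inv_sq_sub_one h0 h0' h hz, norm_div]
  push_cast at this
  rw [this, norm_pow, Complex.norm_real, Real.norm_of_nonneg (jacobiNumS_nonneg z)]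
  field_simp
  unfold jacobiNumS jacobiNumC
  rw [e0]
  generalize rsn k z.re = s at *
  generalize rcn k z.re = c at *
  generalize rdn k z.re = d at *
  generalize rsn k' z.im = s' at *
  generalize rcn k' z.im = c' at *
  generalize rdn k' z.im = d' at *
  clear this hz h0 h0' h hk hk'
  grind

theorem norm_csn_inv_sq_sub_sq {z : ℂ} (hz : jacobiNumS k k' z ≠ 0) :
    ‖((csn k k' z)⁻¹) ^ 2 - k ^ 2‖ * jacobiNumS k k' z = jacobiNumD k k' z := by
  have hk := modulus_sq_lt_one h0' h
  have hk' := comodulus_sq_lt_one h0 h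
  have e1 := rcn_sq k z.re
  have e2 := rdn_sq hk z.re
  have e3 := rcn_sq k' z.im
  have e4 := rdn_sq hk' z.im
  have e0 : k' ^ 2 = 1 - k ^ 2 := by linarith
  rw [e0] at e4
  have := norm_sq_sub_mul_I (rsn k z.re * rdn k z.re * rcn k' z.im)
    (rcn k z.re * rsn k' z.im * rdn k' z.im)
  rw [csn_inv_sq_sub_sq h0 h0' h hz, norm_div]
  push_cast at this
  rw [this, norm_pow, Complex.norm_real, Real.norm_of_nonneg (jacobiNumS_nonneg z)]
  field_simp
  unfold jacobiNumS jacobiNumD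
  generalize rsn k z.re = s at *
  generalize rcn k z.re = c at *
  generalize rdn k z.re = d at *
  generalize rsn k' z.im = s' at *
  generalize rcn k' z.im = c' at *
  generalize rdn k' z.im = d' at *
  clear this hz h0 h0' h hk hk'
  grind

end

/-! ### Abel–Jacobi images and chordal distances -/

namespace O4Multiplet

variable (C : O4Multiplet)

/-- Since `e₁ - e₃ = ρ`, the affine constants on the two sides cancel. The first alternative is the
point at infinity, where `u` is a period. -/
theorem isAbelJacobi_iff {ζ : OnePoint ℂ} {u : ℂ} : C.IsAbelJacobi ζ u ↔
    (ζ = C.β ∧ jacobiNumS C.k C.k' (C.arg u) = 0) ∨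
    (ζ ≠ C.β ∧ jacobiNumS C.k C.k' (C.arg u) ≠ 0 ∧
      ((csn C.k C.k' (C.arg u))⁻¹) ^ 2 = crossRatio ζ (antipode C.α) C.α C.β) := by
  have hρ : (C.ρ : ℂ) ≠ 0 := by exact_mod_cast C.ρ_pos.ne'
  have he : (C.e₁ : ℂ) - C.e₃ = C.ρ := by
    simp only [e₁, e₃]; push_cast; ring
  have hz := C.mem_Λ_iff (u := u)
  rw [IsAbelJacobi, wp, X, Ne, Ne, ← hz]
  clear hz
  by_cases h1 : u ∈ C.Λ
  · by_cases h2 : ζ = C.β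
    · simp [h1, h2]
    · rw [if_pos h1, if_neg h2]
      simp [h1, h2, (OnePoint.coe_ne_infty _).symm]
  · by_cases h2 : ζ = C.β
    · rw [if_neg h1, if_pos h2]
      simp [h1, h2, OnePoint.coe_ne_infty]
    · rw [if_neg h1, if_neg h2, C.weierstrassP_eq h1, OnePoint.coe_eq_coe, he, add_right_inj,
        mul_right_inj' hρ]
      simp [h1, h2]

/-- The theta-type moduli at an Abel–Jacobi image are proportional to the chordal distances. -/
theorem exists_scale {ζ : OnePoint ℂ} {u : ℂ} (hu : C.IsAbelJacobi ζ u) :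
    ∃ t > 0, C.k * jacobiNumS C.k C.k' (C.arg u) = t * chordK' C.β ζ ∧
      jacobiDen C.k C.k' (C.arg u) = t * chordK' C.α ζ ∧
      C.k * jacobiNumC C.k C.k' (C.arg u) = t * C.k' * chordK C.α ζ ∧
      jacobiNumD C.k C.k' (C.arg u) = t * C.k' * chordK C.β ζ := by
  have hk := C.k_pos
  have hk' := C.k'_pos
  rcases C.isAbelJacobi_iff.1 hu with ⟨rfl, h⟩ | ⟨hne, hN, hCR⟩
  · obtain ⟨h1, h2⟩ := jacobiNumS_eq_zero h
    have h3 := rcn_sq C.k (C.arg u).re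
    have h4 := rdn_sq C.k_sq_lt_one (C.arg u).re
    have h5 := rcn_sq C.k' (C.arg u).im
    rw [h1] at h3 h4
    rw [h2] at h5
    have e1 : chordK C.α C.β = C.k := rfl
    have e2 : chordK' C.α C.β = C.k' := rfl
    -- For `u ∈ Λ` the value of `jacobiDen` is `1`, and the chord from `α` to `ζ = β` is `k'`; this
    -- forces `t`.
    refine ⟨1 / C.k', by positivity, ?_, ?_, ?_, ?_⟩
    · rw [h, chordK'_self]; ring
    · rw [jacobiDen, h1, h2, h5, e2]; field_simp; ring
    · rw [jacobiNumC, h1, h2, h3, e1]; field_simp; ring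
    · rw [jacobiNumD, h2, h4, h5, chordK_self]; field_simp; ring
  · have hb := chordK'_pos (Ne.symm hne)
    have hNp : 0 < jacobiNumS C.k C.k' (C.arg u) := lt_of_le_of_ne (jacobiNumS_nonneg _) hN.symm
    have n1 := norm_csn_inv_sq C.k_pos C.k'_pos C.k_sq_add_sq hN
    have n2 := norm_csn_inv_sq_sub_one C.k_pos C.k'_pos C.k_sq_add_sq hN
    have n3 := norm_csn_inv_sq_sub_sq C.k_pos C.k'_pos C.k_sq_add_sq hN
    rw [hCR] at n1 n2 n3
    rw [norm_crossRatio_antipode] at n1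
    rw [norm_crossRatio_antipode_sub_one hne] at n2
    rw [show (C.k : ℂ) = (chordK C.α C.β : ℂ) from rfl, norm_crossRatio_antipode_sub_sq hne] at n3
    rw [show chordK C.α C.β = C.k from rfl] at n1 n3
    rw [show chordK' C.α C.β = C.k' from rfl] at n2 n3
    refine ⟨C.k * jacobiNumS C.k C.k' (C.arg u) / chordK' C.β ζ, by positivity, ?_, ?_, ?_, ?_⟩
    · field_simp
    · rw [← n1]; field_simp
    · rw [← n2]; field_simp
    · rw [← n3]; field_simp

theorem arg_ω₂_sub (u : ℂ) : C.arg (C.ω₂ - conj u) =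
    ((-((C.arg u).re + ellipticK C.k) : ℝ) : ℂ) +
      ((-(-(C.arg u).im + ellipticK C.k') : ℝ) : ℂ) * I := by
  have h : ((√C.ρ : ℝ) : ℂ) ≠ 0 := by exact_mod_cast C.sqrt_ρ_pos.ne'
  have h1 : ((√C.ρ : ℝ) : ℂ) * C.ω = ellipticK C.k := by
    rw [ω]; push_cast; field_simp
  have h2 : ((√C.ρ : ℝ) : ℂ) * C.ω' = I * ellipticK C.k' := by
    rw [ω']; push_cast; field_simp
  have h3 : C.arg (conj u) = (C.arg u).re - (C.arg u).im * I := by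
    have : C.arg (conj u) = conj (C.arg u) := by simp [arg]
    rw [this]
    apply Complex.ext <;> simp
  rw [arg] at h3 ⊢
  rw [mul_sub, h3, ω₂, mul_neg, mul_add, h1, h2]
  push_cast
  ring

end O4Multiplet

/-! ### The antipodal map as a translation by a half-period -/

section

variable {k k' : ℝ} (h0 : 0 < k) (h0' : 0 < k') (h : k ^ 2 + k' ^ 2 = 1)

include h0 h0' h

theorem jacobiNumS_neg_add (x y : ℝ) :
    jacobiNumS k k' (((-(x + ellipticK k) : ℝ) : ℂ) + ((-(-y + ellipticK k') : ℝ) : ℂ) * I) =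
      jacobiNumD k k' (x + y * I) / (rdn k x * rdn k' y) ^ 2 := by
  have hk := modulus_sq_lt_one h0' h
  have hk' := comodulus_sq_lt_one h0 h
  have h' := (add_comm _ _).trans h
  have := (rdn_pos hk x).ne'
  have := (rdn_pos hk' y).ne'
  simp only [jacobiNumS, jacobiNumD, Complex.add_re, Complex.add_im, Complex.mul_I_re,
    Complex.mul_I_im, Complex.ofReal_im, Complex.ofReal_re, add_zero, zero_add, neg_zero,
    rsn_neg hk, rsn_neg hk', rcn_neg hk', rdn_neg hk',
    rsn_add_ellipticK hk, rsn_add_ellipticK hk', rcn_add_ellipticK h0 h']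
  field_simp
  ring

/-- The point is `-conj v - K - iK'` with `v = x + iy`, and the value is `-k conj (cd v)`. -/
theorem csn_inv_neg_add (x y : ℝ) :
    (csn k k' (((-(x + ellipticK k) : ℝ) : ℂ) + ((-(-y + ellipticK k') : ℝ) : ℂ) * I))⁻¹ =
      -(k * (rcn k x * rdn k x * rdn k' y + k' ^ 2 * rsn k x * rsn k' y * rcn k' y * I)) /
        jacobiNumD k k' (x + y * I) := by
  have hk := modulus_sq_lt_one h0' h
  have hk' := comodulus_sq_lt_one h0 h
  have h' := (add_comm _ _).trans h
  have h1 : (rdn k x : ℂ) ≠ 0 := by exact_mod_cast (rdn_pos hk x).ne'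
  have h2 : (rdn k' y : ℂ) ≠ 0 := by exact_mod_cast (rdn_pos hk' y).ne'
  rw [csn_inv h0 h0' h, jacobiNumS_neg_add h0 h0' h]
  simp only [Complex.add_re, Complex.add_im, Complex.mul_I_re,
    Complex.mul_I_im, Complex.ofReal_im, Complex.ofReal_re, add_zero, zero_add, neg_zero,
    rsn_neg hk, rsn_neg hk', rcn_neg hk, rcn_neg hk', rdn_neg hk, rdn_neg hk',
    rsn_add_ellipticK hk, rsn_add_ellipticK hk', rcn_add_ellipticK h0 h',
    rcn_add_ellipticK h0' h, rdn_add_ellipticK h0 h', rdn_add_ellipticK h0' h]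
  push_cast
  by_cases hD : (jacobiNumD k k' (x + y * I) : ℂ) = 0
  · simp [hD]
  field_simp
  ring

end

namespace O4Multiplet

variable (C : O4Multiplet)

/-- Translation by `K + iK'` acts on `ns²` as the Möbius map of `conj_crossRatio_antipode`;
reflection supplies the conjugation, and evenness of `ns²` makes the sign irrelevant. -/
theorem isAbelJacobi_antipode {ζ : OnePoint ℂ} {u : ℂ} (hu : C.IsAbelJacobi ζ u) :
    C.IsAbelJacobi (antipode ζ) (C.ω₂ - conj u) := by
  have hab : sphereInner C.α C.β ≠ 0 := fun h =>
    C.ne_antipode (eq_antipode_of_sphereInner_eq_zero h)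
  have hk0 : (C.k : ℂ) ≠ 0 := by exact_mod_cast C.k_pos.ne'
  set v := C.arg u with hv
  have hvr : (v.re : ℂ) + v.im * I = v := Complex.re_add_im v
  have hd := (rdn_pos C.k_sq_lt_one v.re).ne'
  have hd' := (rdn_pos C.k'_sq_lt_one v.im).ne'
  have hS := jacobiNumS_neg_add C.k_pos C.k'_pos C.k_sq_add_sq v.re v.im
  have hI := csn_inv_neg_add C.k_pos C.k'_pos C.k_sq_add_sq v.re v.im
  obtain ⟨e0, e1, e2, e3, e4⟩ := rsn_rcn_rdn_relations C.k_sq_lt_one C.k'_sq_lt_one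
    C.k_sq_add_sq v.re v.im
  rw [hvr] at hS hI
  obtain ⟨t, ht, -, -, -, hD⟩ := C.exists_scale hu
  rw [← hv] at hD
  rw [isAbelJacobi_iff, arg_ω₂_sub, ← hv, hS, hI]
  by_cases hβ : antipode ζ = C.β
  · left
    refine ⟨hβ, ?_⟩
    rw [hD, chordK, ← conj_sphereInner, antipode_eq_iff.1 hβ]
    simp
  right
  have hζβ : sphereInner C.β ζ ≠ 0 := fun h => hβ (antipode_eq_iff.2 (by
    rw [← conj_sphereInner, h, map_zero]))
  have hD0 : jacobiNumD C.k C.k' v ≠ 0 := by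
    rw [hD]
    refine (mul_pos (mul_pos ht C.k'_pos) ?_).ne'
    exact div_pos (norm_pos_iff.2 hζβ) (mul_pos (sphereNorm_pos _) (sphereNorm_pos _))
  have hD0' : (jacobiNumD C.k C.k' v : ℂ) ≠ 0 := by exact_mod_cast hD0
  refine ⟨hβ, div_ne_zero hD0 (pow_ne_zero 2 (mul_ne_zero hd hd')), ?_⟩
  -- For `ζ = β` the cross-ratio of `ζ` is infinite and the Möbius relation is unavailable; there
  -- `ns²` at the shifted point is directly `k²`.
  rcases C.isAbelJacobi_iff.1 hu with ⟨rfl, hN⟩ | ⟨hne, hN, hCR⟩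
  · obtain ⟨h1, h2⟩ := jacobiNumS_eq_zero hN
    rw [← hv] at h1 h2
    rw [crossRatio_antipode_self, show chordK C.α C.β = C.k from rfl]
    have hDe : (jacobiNumD C.k C.k' v : ℂ) = rdn C.k v.re ^ 2 * rcn C.k' v.im ^ 2 := by
      simp [jacobiNumD, h2]
    rw [h1, Complex.ofReal_zero] at e1 e2
    rw [h2, Complex.ofReal_zero] at e3 e4
    rw [h1, h2, hDe, div_pow, neg_sq, mul_pow]
    simp only [Complex.ofReal_zero, mul_zero, zero_mul, add_zero, mul_pow, e1, e2, e3, e4]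
    norm_num
  · rw [← hv] at hN hCR
    have hDS := csn_inv_sq_sub_sq C.k_pos C.k'_pos C.k_sq_add_sq hN
    have hCS := csn_inv_sq_sub_one C.k_pos C.k'_pos C.k_sq_add_sq hN
    have hN' : (jacobiNumS C.k C.k' v : ℂ) ≠ 0 := by exact_mod_cast hN
    have hconj := conj_crossRatio_antipode hne C.ne hab
    rw [← hCR, show chordK C.α C.β = C.k from rfl, hDS, hCS] at hconj
    have h3 : crossRatio ζ (antipode C.α) C.α C.β - (C.k : ℂ) ^ 2 ≠ 0 := by
      rw [show C.k = chordK C.α C.β from rfl, crossRatio_antipode_sub_sq hne]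
      refine div_ne_zero (mul_ne_zero hab (mul_ne_zero hζβ (sphereDet_ne_zero C.ne.symm)))
        (mul_ne_zero (sphereDet_ne_zero hne) (mul_ne_zero (sphereInner_self_ne_zero _)
          (sphereInner_self_ne_zero _)))
    rw [← hCR, hDS] at h3
    have h4 : conj ((rsn C.k v.re * rdn C.k v.re * rcn C.k' v.im -
      rcn C.k v.re * rsn C.k' v.im * rdn C.k' v.im * I : ℂ)) ≠ 0 := by
      rw [Ne, map_eq_zero]
      intro h
      rw [h] at h3
      simp at h3
    -- This rewrites `conj (cd v)` as the quotient of the conjugates of `cs v` and `ds v`, the shape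
    -- in which the antipodal cross-ratio is known.
    have h5 := cs_mul_ds e1 e2 e3 e4 Complex.I_sq
    have hDe : (jacobiNumD C.k C.k' v : ℂ) = rdn C.k v.re ^ 2 * rcn C.k' v.im ^ 2 +
        C.k ^ 2 * rcn C.k v.re ^ 2 * rsn C.k' v.im ^ 2 := by
      simp [jacobiNumD]
    rw [← hDe, ← e0] at h5
    have h6 := congrArg conj hconj
    rw [Complex.conj_conj] at h6
    rw [h6]
    simp only [map_mul, map_div₀, map_pow, map_sub, Complex.conj_ofReal, Complex.conj_I] at h4 ⊢
    have h7 : (rsn C.k v.re * rdn C.k v.re * rcn C.k' v.im +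
      rcn C.k v.re * rsn C.k' v.im * rdn C.k' v.im * I : ℂ) ≠ 0 := by
      intro h; apply h4; rw [← h]; ring
    have h8 : -(C.k * (rcn C.k v.re * rdn C.k v.re * rdn C.k' v.im +
        C.k' ^ 2 * rsn C.k v.re * rsn C.k' v.im * rcn C.k' v.im * I) : ℂ) /
          jacobiNumD C.k C.k' v = -(C.k * ((rsn C.k v.re * rcn C.k v.re * rcn C.k' v.im *
          rdn C.k' v.im + rdn C.k v.re * rsn C.k' v.im * I) /
          (rsn C.k v.re * rdn C.k v.re * rcn C.k' v.im +
      rcn C.k v.re * rsn C.k' v.im * rdn C.k' v.im * I))) := by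
      rw [neg_div, mul_div_assoc, neg_inj, mul_right_inj' hk0, div_eq_div_iff hD0' h7, h5]
      ring
    rw [h8]
    simp only [mul_neg, sub_neg_eq_add]
    rw [div_div_div_cancel_right₀ (pow_ne_zero 2 hN'), ← div_pow, neg_sq, mul_pow]

end O4Multiplet

/-! ### Duplication formulas -/

section

variable {k k' : ℝ} (h0 : 0 < k) (h0' : 0 < k') (h : k ^ 2 + k' ^ 2 = 1)

include h0 h0' h

omit h0 in
-- This is the addition theorem for `z + conj z = 2 re z`, in the form `cn(a + b) = (cn a cn b dn a
-- dn b - k'² sn a sn b) / (dn a dn b + k² sn a sn b cn a cn b)`. For `b = conj a` the products are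
-- squared moduli, hence quotients of the four polynomials.
theorem rcn_two_mul_re (z : ℂ) :
    rcn k (2 * z.re) * (jacobiDen k k' z * jacobiNumD k k' z +
        k ^ 2 * jacobiNumC k k' z * jacobiNumS k k' z) =
      jacobiNumC k k' z * jacobiNumD k k' z -
        k' ^ 2 * jacobiDen k k' z * jacobiNumS k k' z := by
  have hk := modulus_sq_lt_one h0' h
  have e1 := rcn_sq k z.re
  have e2 := rdn_sq hk z.re
  have e3 := rcn_sq k' z.im
  have e0 : k' ^ 2 = 1 - k ^ 2 := by linarith
  have hne := (one_sub_sq_mul_rsn_pos hk z.re z.re).ne'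
  rw [two_mul, rcn_add hk, div_mul_eq_mul_div, div_eq_iff hne,
    show ∀ x y : ℝ, x * x - y * (y) = x ^ 2 - y ^ 2 by intros; ring, mul_pow]
  simp only [jacobiDen, jacobiNumC, jacobiNumD, jacobiNumS, e0, e1, e2, e3]
  ring

omit h0 in
theorem rdn_two_mul_re (z : ℂ) :
    rdn k (2 * z.re) * (jacobiDen k k' z * jacobiNumD k k' z +
        k ^ 2 * jacobiNumC k k' z * jacobiNumS k k' z) =
      k' ^ 2 * jacobiDen k k' z ^ 2 + k ^ 2 * jacobiNumC k k' z ^ 2 := by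
  have hk := modulus_sq_lt_one h0' h
  have e1 := rcn_sq k z.re
  have e2 := rdn_sq hk z.re
  have e3 := rcn_sq k' z.im
  have e0 : k' ^ 2 = 1 - k ^ 2 := by linarith
  have hne := (one_sub_sq_mul_rsn_pos hk z.re z.re).ne'
  rw [two_mul, rdn_add hk, div_mul_eq_mul_div, div_eq_iff hne,
    show ∀ x y w : ℝ, x * x - w * y * y = x ^ 2 - w * y ^ 2 by intros; ring, mul_pow]
  simp only [jacobiDen, jacobiNumC, jacobiNumD, jacobiNumS, e0, e1, e2, e3]
  ring

/-- The same addition theorem for `z - conj z = 2i im z`, converted to modulus `k'` by the imaginary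
transformation. -/
theorem rcn_two_mul_im (z : ℂ) :
    rcn k' (2 * z.im) * (jacobiNumC k k' z * jacobiNumD k k' z +
        k' ^ 2 * jacobiDen k k' z * jacobiNumS k k' z) =
      jacobiDen k k' z * jacobiNumD k k' z -
        k ^ 2 * jacobiNumC k k' z * jacobiNumS k k' z := by
  have hk := modulus_sq_lt_one h0' h
  have hk' := comodulus_sq_lt_one h0 h
  have e1 := rcn_sq k z.re
  have e2 := rdn_sq hk z.re
  have e3 := rcn_sq k' z.im
  have e4 := rdn_sq hk' z.im
  have e0 : k' ^ 2 = 1 - k ^ 2 := by linarith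
  have hne := (one_sub_sq_mul_rsn_pos hk' z.im z.im).ne'
  rw [two_mul, rcn_add hk', div_mul_eq_mul_div, div_eq_iff hne,
    show ∀ x y : ℝ, x * x - y * (y) = x ^ 2 - y ^ 2 by intros; ring, mul_pow]
  simp only [jacobiDen, jacobiNumC, jacobiNumD, jacobiNumS, e1, e2, e3, e4, e0]
  ring

theorem rdn_two_mul_im (z : ℂ) :
    rdn k' (2 * z.im) * (jacobiNumC k k' z * jacobiNumD k k' z +
        k' ^ 2 * jacobiDen k k' z * jacobiNumS k k' z) =
      k' ^ 2 * jacobiDen k k' z ^ 2 + k ^ 2 * jacobiNumC k k' z ^ 2 := by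
  have hk := modulus_sq_lt_one h0' h
  have hk' := comodulus_sq_lt_one h0 h
  have e1 := rcn_sq k z.re
  have e2 := rdn_sq hk z.re
  have e3 := rcn_sq k' z.im
  have e4 := rdn_sq hk' z.im
  have e0 : k' ^ 2 = 1 - k ^ 2 := by linarith
  have hne := (one_sub_sq_mul_rsn_pos hk' z.im z.im).ne'
  rw [two_mul, rdn_add hk', div_mul_eq_mul_div, div_eq_iff hne,
    show ∀ x y w : ℝ, x * x - w * y * y = x ^ 2 - w * y ^ 2 by intros; ring, mul_pow]
  simp only [jacobiDen, jacobiNumC, jacobiNumD, jacobiNumS, e1, e2, e3, e4, e0]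
  ring

end

/-! ### Half the Fubini–Study distance -/

theorem chordK_le_one (z w : OnePoint ℂ) : chordK z w ≤ 1 := by
  nlinarith [chordK_sq_add_sq z w, sq_nonneg (chordK' z w), chordK_nonneg z w]

theorem cos_fsDist_half (z w : OnePoint ℂ) : Real.cos (fsDist z w / 2) = chordK z w := by
  rw [fsDist, mul_div_cancel_left₀ _ two_ne_zero,
    Real.cos_arccos (by linarith [chordK_nonneg z w]) (chordK_le_one z w)]

theorem sin_fsDist_half (z w : OnePoint ℂ) : Real.sin (fsDist z w / 2) = chordK' z w := by
  rw [fsDist, mul_div_cancel_left₀ _ two_ne_zero, Real.sin_arccos,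
    ← chordK_sq_add_sq z w, add_sub_cancel_left, Real.sqrt_sq (chordK'_nonneg z w)]

theorem fsDist_half_nonneg (z w : OnePoint ℂ) : 0 ≤ fsDist z w / 2 := by
  rw [fsDist, mul_div_cancel_left₀ _ two_ne_zero]
  exact Real.arccos_nonneg _

theorem fsDist_half_le (z w : OnePoint ℂ) : fsDist z w / 2 ≤ Real.pi / 2 := by
  rw [fsDist, mul_div_cancel_left₀ _ two_ne_zero, Real.arccos_le_pi_div_two]
  exact chordK_nonneg z w

namespace O4Multiplet

variable (C : O4Multiplet) {ζ : OnePoint ℂ} {u : ℂ}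

/-- With the moduli replaced by chords, the denominator of the addition theorem becomes a multiple
of `sin (A + B)` and the numerator of `cn` one of `cos (A + B)`, where `A = δα/2` and `B = δβ/2`.
The numerator of `dn` becomes a constant multiple of `sin² A + cos² A`. -/
theorem duplication_re (hu : C.IsAbelJacobi ζ u) :
    rdn C.k (2 * (C.arg u).re) *
      Real.sin ((fsDist C.α ζ + fsDist C.β ζ) / 2) = C.k' ∧
    rcn C.k (2 * (C.arg u).re) *
      (C.k * Real.sin ((fsDist C.α ζ + fsDist C.β ζ) / 2)) =
        C.k' * Real.cos ((fsDist C.α ζ + fsDist C.β ζ) / 2) := by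
  obtain ⟨t, ht, hS, hΔ, hC, hD⟩ := C.exists_scale hu
  have h1 := rdn_two_mul_re C.k'_pos C.k_sq_add_sq (C.arg u)
  have h2 := rcn_two_mul_re C.k'_pos C.k_sq_add_sq (C.arg u)
  have ha := chordK_sq_add_sq C.α ζ
  have hk := C.k_pos
  have hk' := C.k'_pos
  rw [add_div, Real.sin_add, Real.cos_add, cos_fsDist_half, cos_fsDist_half, sin_fsDist_half,
    sin_fsDist_half]
  have hC' : jacobiNumC C.k C.k' (C.arg u) = t * C.k' * chordK C.α ζ / C.k := by
    rw [← hC]; field_simp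
  have hS' : jacobiNumS C.k C.k' (C.arg u) = t * chordK' C.β ζ / C.k := by
    rw [← hS]; field_simp
  rw [hΔ, hD, hC', hS'] at h1 h2
  constructor
  · field_simp at h1
    linear_combination h1 + C.k' * ha
  · field_simp at h2
    linear_combination h2

theorem duplication_im (hu : C.IsAbelJacobi ζ u) :
    rdn C.k' (2 * (C.arg u).im) *
      Real.cos ((fsDist C.α ζ - fsDist C.β ζ) / 2) = C.k ∧
    rcn C.k' (2 * (C.arg u).im) *
      (C.k' * Real.cos ((fsDist C.α ζ - fsDist C.β ζ) / 2)) =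
        C.k * Real.sin ((fsDist C.α ζ - fsDist C.β ζ) / 2) := by
  obtain ⟨t, ht, hS, hΔ, hC, hD⟩ := C.exists_scale hu
  have h1 := rdn_two_mul_im C.k_pos C.k'_pos C.k_sq_add_sq (C.arg u)
  have h2 := rcn_two_mul_im C.k_pos C.k'_pos C.k_sq_add_sq (C.arg u)
  have ha := chordK_sq_add_sq C.α ζ
  have hk := C.k_pos
  have hk' := C.k'_pos
  rw [sub_div, Real.sin_sub, Real.cos_sub, cos_fsDist_half, cos_fsDist_half, sin_fsDist_half,
    sin_fsDist_half]
  have hC' : jacobiNumC C.k C.k' (C.arg u) = t * C.k' * chordK C.α ζ / C.k := by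
    rw [← hC]; field_simp
  have hS' : jacobiNumS C.k C.k' (C.arg u) = t * chordK' C.β ζ / C.k := by
    rw [← hS]; field_simp
  rw [hΔ, hD, hC', hS'] at h1 h2
  constructor
  · field_simp at h1
    linear_combination h1 + C.k * ha
  · field_simp at h2
    linear_combination h2

end O4Multiplet

/-! ### `sn` on the line `re = -K`; `cn` and `dn` on the imaginary axis -/

section

variable {k k' : ℝ} (h0 : 0 < k) (h0' : 0 < k') (h : k ^ 2 + k' ^ 2 = 1)

include h0 h0' h

theorem jacobiDen_neg_ellipticK (y : ℝ) :
    jacobiDen k k' (((-ellipticK k : ℝ) : ℂ) + (y : ℂ) * I) = rdn k' y ^ 2 := by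
  have hk := modulus_sq_lt_one h0' h
  have e0 : k ^ 2 = 1 - k' ^ 2 := by linarith
  rw [rdn_sq (comodulus_sq_lt_one h0 h)]
  simp only [jacobiDen, Complex.add_re, Complex.add_im, Complex.mul_I_re, Complex.mul_I_im,
    Complex.ofReal_im, Complex.ofReal_re, neg_zero, add_zero, zero_add, rsn_neg hk,
    rsn_ellipticK hk, rcn_sq, e0]
  ring

theorem csn_neg_ellipticK (y : ℝ) :
    csn k k' (((-ellipticK k : ℝ) : ℂ) + (y : ℂ) * I) = -1 / rdn k' y := by
  have hk := modulus_sq_lt_one h0' h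
  have hd : (rdn k' y : ℂ) ≠ 0 := by exact_mod_cast (rdn_pos (comodulus_sq_lt_one h0 h) y).ne'
  rw [csn, jacobiDen_neg_ellipticK h0 h0' h]
  simp only [Complex.add_re, Complex.add_im, Complex.mul_I_re, Complex.mul_I_im,
    Complex.ofReal_im, Complex.ofReal_re, neg_zero, add_zero, zero_add, rsn_neg hk, rcn_neg hk,
    rsn_ellipticK hk, rcn_ellipticK hk]
  push_cast
  field_simp
  ring

omit h0 in
theorem jacobiDen_mul_I (y : ℝ) : jacobiDen k k' ((y : ℂ) * I) = rcn k' y ^ 2 := by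
  simp [jacobiDen, rsn_zero (modulus_sq_lt_one h0' h)]

omit h0 in
-- Jacobi's imaginary transformation. At the zeros of `rcn k'`, which are poles of `cn` here, both
-- sides take the default value `0`.
theorem ccn_mul_I (y : ℝ) : ccn k k' ((y : ℂ) * I) = 1 / rcn k' y := by
  have hk := modulus_sq_lt_one h0' h
  rw [ccn, jacobiDen_mul_I h0' h]
  by_cases hc : (rcn k' y : ℂ) = 0
  · simp [hc, rsn_zero hk]
  simp [rsn_zero hk, rcn_zero hk]
  field_simp

omit h0 in
theorem cdn_mul_I (y : ℝ) : cdn k k' ((y : ℂ) * I) = rdn k' y / rcn k' y := by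
  have hk := modulus_sq_lt_one h0' h
  rw [cdn, jacobiDen_mul_I h0' h]
  by_cases hc : (rcn k' y : ℂ) = 0
  · simp [hc, rsn_zero hk]
  simp [rsn_zero hk, rdn_zero hk]
  field_simp

end

theorem fsDist_add_eq_pi_iff (z w ζ : OnePoint ℂ) :
    fsDist z ζ + fsDist w ζ = Real.pi ↔ Real.cos ((fsDist z ζ + fsDist w ζ) / 2) = 0 := by
  have hz := fsDist_half_nonneg z ζ
  have hz' := fsDist_half_le z ζ
  have hw := fsDist_half_nonneg w ζ
  have hw' := fsDist_half_le w ζ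
  constructor
  · intro h
    rw [h, Real.cos_pi_div_two]
  · intro h
    rw [← Real.cos_pi_div_two] at h
    linarith [Real.injOn_cos ⟨by linarith, by linarith⟩
      ⟨by linarith [Real.pi_pos], by linarith [Real.pi_pos]⟩ h]

/-! ### Values at `u ± conj u` and at `u^±` -/

namespace O4Multiplet

variable (C : O4Multiplet) {ζ : OnePoint ℂ} {u : ℂ}

theorem jacobiDen_add_periods (z : ℂ) (m n : ℤ) :
    jacobiDen C.k C.k' (z + ((m * (2 * ellipticK C.k) : ℝ) : ℂ) +
      ((n * (2 * ellipticK C.k') : ℝ) : ℂ) * I) = jacobiDen C.k C.k' z := by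
  simp only [jacobiDen, Complex.add_re, Complex.add_im, Complex.mul_I_re, Complex.mul_I_im,
    Complex.ofReal_im, Complex.ofReal_re, neg_zero, add_zero, rsn_add_int_mul C.k_sq_lt_one,
    rsn_add_int_mul C.k'_sq_lt_one, rcn_add_int_mul C.k'_sq_lt_one, mul_pow, neg_one_zpow_sq,
    one_mul]

theorem arg_sub (u v : ℂ) : C.arg (u - v) = C.arg u - C.arg v := mul_sub _ _ _

theorem arg_ω : C.arg C.ω = ellipticK C.k := by
  have h : ((√C.ρ : ℝ) : ℂ) ≠ 0 := by exact_mod_cast C.sqrt_ρ_pos.ne'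
  rw [arg, ω]
  push_cast
  field_simp

theorem arg_ω' : C.arg C.ω' = ellipticK C.k' * I := by
  have h : ((√C.ρ : ℝ) : ℂ) ≠ 0 := by exact_mod_cast C.sqrt_ρ_pos.ne'
  rw [arg, ω']
  push_cast
  field_simp

theorem arg_ω₂ : C.arg C.ω₂ = -(ellipticK C.k + ellipticK C.k' * I) := by
  rw [← arg_ω, ← arg_ω', ← arg_add, ω₂, arg, arg, mul_neg]

theorem arg_add_conj (u : ℂ) : C.arg (u + conj u) = ((2 * (C.arg u).re : ℝ) : ℂ) := by
  rw [arg, arg, Complex.re_ofReal_mul, Complex.add_conj]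
  push_cast
  ring

theorem arg_sub_conj (u : ℂ) : C.arg (u - conj u) = ((2 * (C.arg u).im : ℝ) : ℂ) * I := by
  rw [arg, arg, Complex.im_ofReal_mul, Complex.sub_conj]
  push_cast
  ring

theorem hasValueAt_sn {z : ℂ} {m n : ℤ} {r : ℝ} (hz : jacobiDen C.k C.k' z ≠ 0)
    (hr : csn C.k C.k' z = r) :
    HasValueAt (jacobiSn C.k) (z + ((m * (2 * ellipticK C.k) : ℝ) : ℂ) +
      ((n * (2 * ellipticK C.k') : ℝ) : ℂ) * I) ((-1) ^ m * r) := by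
  rw [jacobiSn_eq C.k_pos C.k'_pos C.k_sq_add_sq]
  refine ⟨analyticAt_csn C.k_pos C.k'_pos C.k_sq_add_sq ?_, ?_⟩
  · rwa [jacobiDen_add_periods]
  · rw [csn_add_periods, hr]
    push_cast
    rfl

/-- The product of this sine with the positive `dn(2x)` is `k' > 0`, so no case analysis on the
angles is needed. -/
theorem sin_pos_of_isAbelJacobi (hu : C.IsAbelJacobi ζ u) :
    0 < Real.sin ((fsDist C.α ζ + fsDist C.β ζ) / 2) := by
  have h := (C.duplication_re hu).1
  exact pos_of_mul_pos_right (h ▸ C.k'_pos) (rdn_pos C.k_sq_lt_one _).le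

theorem cos_pos_of_isAbelJacobi (hu : C.IsAbelJacobi ζ u) :
    0 < Real.cos ((fsDist C.α ζ - fsDist C.β ζ) / 2) := by
  have h := (C.duplication_im hu).1
  exact pos_of_mul_pos_right (h ▸ C.k_pos) (rdn_pos C.k'_sq_lt_one _).le

/-- `sn(2x + K) = cd(2x)` is the quotient of the two formulas of `duplication_re`. This value
governs both `u^-` and the angle `D`. -/
theorem k_mul_rsn_add (hu : C.IsAbelJacobi ζ u) :
    C.k * rsn C.k (2 * (C.arg u).re + ellipticK C.k) =
      Real.cos ((fsDist C.α ζ + fsDist C.β ζ) / 2) := by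
  obtain ⟨h1, h2⟩ := C.duplication_re hu
  have hs := C.sin_pos_of_isAbelJacobi hu
  have hd := rdn_pos C.k_sq_lt_one (2 * (C.arg u).re)
  rw [rsn_add_ellipticK C.k_sq_lt_one, mul_div_assoc', div_eq_iff hd.ne']
  apply mul_right_cancel₀ hs.ne'
  linear_combination h2 - Real.cos ((fsDist C.α ζ + fsDist C.β ζ) / 2) * h1

/-- Up to periods the point lies on the line `re = -K`, where `sn(-K + iy) = -1/dn(y, k')`. -/
theorem hasValueAt_sn_add (hu : C.IsAbelJacobi ζ u) {x : ℂ} {m n : ℤ}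
    (hx : x = u - conj u + C.ω₂ + m * (2 * (C.ω : ℂ)) + n * (2 * C.ω')) :
    HasValueAt (jacobiSn C.k) (C.arg x)
      (-(-1) ^ m * (1 / Real.cos ((fsDist C.α ζ - fsDist C.β ζ) / 2))) ∧
    HasValueAt (jacobiSn C.k) (C.arg (x - C.ω'))
      (-(-1) ^ m * (Real.cos ((fsDist C.α ζ - fsDist C.β ζ) / 2) / C.k)) := by
  have hd := rdn_pos C.k'_sq_lt_one (2 * (C.arg u).im)
  have hd1 := rdn_pos C.k'_sq_lt_one (2 * (C.arg u).im - ellipticK C.k')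
  have h1 := (C.duplication_im hu).1
  have hc := C.cos_pos_of_isAbelJacobi hu
  -- A shift by `K'` exchanges `dn(2y, k')` with `k / dn(2y, k')`, which `duplication_im` identifies
  -- with the cosine.
  have h2 := rdn_add_ellipticK C.k_pos ((add_comm _ _).trans C.k_sq_add_sq)
    (2 * (C.arg u).im - ellipticK C.k')
  rw [sub_add_cancel, eq_div_iff hd1.ne', ← h1, mul_right_inj' hd.ne'] at h2
  constructor
  · have e : C.arg x = ((-ellipticK C.k : ℝ) : ℂ) +
        ((2 * (C.arg u).im - ellipticK C.k' : ℝ) : ℂ) * I + ((m * (2 * ellipticK C.k) : ℝ) : ℂ) +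
        ((n * (2 * ellipticK C.k') : ℝ) : ℂ) * I := by
      rw [hx, arg_add, arg_add, arg_add, arg_two_ω, arg_two_ω', arg_ω₂, arg_sub_conj]
      push_cast
      ring
    rw [e, neg_mul_comm]
    refine C.hasValueAt_sn ?_ ?_
    · rw [jacobiDen_neg_ellipticK C.k_pos C.k'_pos C.k_sq_add_sq]
      positivity
    · rw [csn_neg_ellipticK C.k_pos C.k'_pos C.k_sq_add_sq, h2]
      push_cast
      ring
  -- Here `ω₂` and `-ω'` each contribute `-iK'`; together they make a full period `-2iK'`, whence `n
  -- - 1`.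
  · have e : C.arg (x - C.ω') = ((-ellipticK C.k : ℝ) : ℂ) +
        ((2 * (C.arg u).im : ℝ) : ℂ) * I + ((m * (2 * ellipticK C.k) : ℝ) : ℂ) +
        (((n - 1 : ℤ) * (2 * ellipticK C.k') : ℝ) : ℂ) * I := by
      rw [arg_sub, hx, arg_add, arg_add, arg_add, arg_two_ω, arg_two_ω', arg_ω₂, arg_sub_conj,
        arg_ω']
      push_cast
      ring
    rw [e, neg_mul_comm]
    refine C.hasValueAt_sn ?_ ?_
    · rw [jacobiDen_neg_ellipticK C.k_pos C.k'_pos C.k_sq_add_sq]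
      positivity
    · rw [csn_neg_ellipticK C.k_pos C.k'_pos C.k_sq_add_sq, ← h1]
      have : (Real.cos ((fsDist C.α ζ - fsDist C.β ζ) / 2) : ℂ) ≠ 0 := by exact_mod_cast hc.ne'
      have : (rdn C.k' (2 * (C.arg u).im) : ℂ) ≠ 0 := by exact_mod_cast hd.ne'
      push_cast at *
      field_simp

/-- Up to periods the point is `2x + K + iK'`, where `sn` is the inverse of `k sn(2x + K)`. It has a
pole exactly when the cosine vanishes, and subtracting `ω'` brings the point back to the real axis.
-/
theorem hasValueAt_sn_sub (hu : C.IsAbelJacobi ζ u) {x : ℂ} {m n : ℤ}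
    (hx : x = u + conj u - C.ω₂ + m * (2 * (C.ω : ℂ)) + n * (2 * C.ω')) :
    (fsDist C.α ζ + fsDist C.β ζ ≠ Real.pi → HasValueAt (jacobiSn C.k) (C.arg x)
      ((-1) ^ m * (1 / Real.cos ((fsDist C.α ζ + fsDist C.β ζ) / 2)))) ∧
    (fsDist C.α ζ + fsDist C.β ζ = Real.pi → HasPoleAt (jacobiSn C.k) (C.arg x)) ∧
    HasValueAt (jacobiSn C.k) (C.arg (x - C.ω'))
      ((-1) ^ m * (Real.cos ((fsDist C.α ζ + fsDist C.β ζ) / 2) / C.k)) := by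
  have hr := C.k_mul_rsn_add hu
  have hk := C.k_pos
  have e : C.arg x = (((2 * (C.arg u).re + ellipticK C.k : ℝ) : ℂ) + ellipticK C.k' * I) +
      ((m * (2 * ellipticK C.k) : ℝ) : ℂ) + ((n * (2 * ellipticK C.k') : ℝ) : ℂ) * I := by
    rw [hx, arg_add, arg_add, arg_sub, arg_two_ω, arg_two_ω', arg_ω₂, arg_add_conj]
    push_cast
    ring
  have hN : jacobiDen C.k C.k' (((2 * (C.arg u).re + ellipticK C.k : ℝ) : ℂ) +
      ellipticK C.k' * I) = Real.cos ((fsDist C.α ζ + fsDist C.β ζ) / 2) ^ 2 := by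
    rw [jacobiDen_add C.k_pos C.k_sq_add_sq, ← hr]
    simp [jacobiNumS, rsn_zero C.k'_sq_lt_one, rcn_zero C.k'_sq_lt_one, rdn_zero C.k'_sq_lt_one,
      mul_pow]
  refine ⟨fun hne => ?_, fun heq => ?_, ?_⟩
  · rw [Ne, fsDist_add_eq_pi_iff] at hne
    rw [e]
    refine C.hasValueAt_sn (by rw [hN]; positivity) ?_
    rw [csn_add_eq_inv C.k_pos C.k'_pos C.k_sq_add_sq, csn_ofReal _ C.k'_sq_lt_one, ← hr]
    push_cast
    rw [one_div]
  · rw [fsDist_add_eq_pi_iff] at heq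
    rw [jacobiSn_eq C.k_pos C.k'_pos C.k_sq_add_sq, e]
    refine (csn_pole C.k_pos C.k'_pos C.k_sq_add_sq ?_).1
    rw [jacobiDen_add_periods, hN, heq]
    norm_num
  · have e' : C.arg (x - C.ω') = ((2 * (C.arg u).re + ellipticK C.k : ℝ) : ℂ) +
        ((m * (2 * ellipticK C.k) : ℝ) : ℂ) + ((n * (2 * ellipticK C.k') : ℝ) : ℂ) * I := by
      rw [arg_sub, e, arg_ω']
      ring
    rw [e']
    refine C.hasValueAt_sn (jacobiDen_ne_zero (by simpa using rsn_zero C.k'_sq_lt_one)) ?_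
    rw [csn_ofReal _ C.k'_sq_lt_one, ← hr, mul_div_cancel_left₀ _ hk.ne']

end O4Multiplet

theorem fsDist_eq_iff (z w ζ : OnePoint ℂ) :
    fsDist z ζ = fsDist w ζ ↔ Real.sin ((fsDist z ζ - fsDist w ζ) / 2) = 0 := by
  have hz := fsDist_half_nonneg z ζ
  have hz' := fsDist_half_le z ζ
  have hw := fsDist_half_nonneg w ζ
  have hw' := fsDist_half_le w ζ
  rw [Real.sin_eq_zero_iff_of_lt_of_lt (by linarith [Real.pi_pos]) (by linarith [Real.pi_pos])]
  constructor <;> intro h <;> linarith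

namespace O4Multiplet

variable (C : O4Multiplet) {ζ : OnePoint ℂ} {u : ℂ}

theorem sin_fsDist_α_β : Real.sin (fsDist C.α C.β / 2) = C.k' := sin_fsDist_half _ _

theorem cos_fsDist_α_β : Real.cos (fsDist C.α C.β / 2) = C.k := cos_fsDist_half _ _

/-- Valid also when `cos x = 0`: the default value `tan x = 0` makes the left side `0`, which is the
value intended for an infinite tangent. -/
theorem tan_fsDist_div_tan (x : ℝ) : Real.tan (fsDist C.α C.β / 2) / Real.tan x =
    C.k' * Real.cos x / (C.k * Real.sin x) := by
  rw [Real.tan_eq_sin_div_cos, Real.tan_eq_sin_div_cos, sin_fsDist_α_β, cos_fsDist_α_β,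
    div_div_div_eq]

theorem hasValueAt_cn_add (hu : C.IsAbelJacobi ζ u) :
    HasValueAt (jacobiCn C.k) (C.arg (u + conj u))
      (C.k' * Real.cos ((fsDist C.α ζ + fsDist C.β ζ) / 2) /
        (C.k * Real.sin ((fsDist C.α ζ + fsDist C.β ζ) / 2))) := by
  have hk := C.k_pos
  have hs := C.sin_pos_of_isAbelJacobi hu
  rw [jacobiCn_eq C.k_pos C.k'_pos C.k_sq_add_sq, arg_add_conj]
  refine ⟨analyticAt_ccn C.k_pos C.k'_pos C.k_sq_add_sq
    (jacobiDen_ne_zero (by simpa using rsn_zero C.k'_sq_lt_one)), ?_⟩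
  rw [ccn_ofReal _ C.k'_sq_lt_one, ← (C.duplication_re hu).2,
    mul_div_cancel_right₀ _ (by positivity)]

theorem hasValueAt_dn_add (hu : C.IsAbelJacobi ζ u) :
    HasValueAt (jacobiDn C.k) (C.arg (u + conj u))
      (C.k' / Real.sin ((fsDist C.α ζ + fsDist C.β ζ) / 2)) := by
  have hs := C.sin_pos_of_isAbelJacobi hu
  rw [jacobiDn_eq C.k_pos C.k'_pos C.k_sq_add_sq, arg_add_conj]
  refine ⟨analyticAt_cdn C.k_pos C.k'_pos C.k_sq_add_sq
    (jacobiDen_ne_zero (by simpa using rsn_zero C.k'_sq_lt_one)), ?_⟩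
  rw [cdn_ofReal _ C.k'_sq_lt_one, ← (C.duplication_re hu).1, mul_div_cancel_right₀ _ hs.ne']

theorem rcn_eq_zero_iff (hu : C.IsAbelJacobi ζ u) :
    rcn C.k' (2 * (C.arg u).im) = 0 ↔ fsDist C.α ζ = fsDist C.β ζ := by
  have hc := C.cos_pos_of_isAbelJacobi hu
  have h := (C.duplication_im hu).2
  have hk := C.k_pos
  have hk' := C.k'_pos
  rw [fsDist_eq_iff, ← mul_eq_zero_iff_right (mul_pos hk' hc).ne', h, mul_eq_zero,
    or_iff_right hk.ne']

theorem hasValueAt_cn_sub (hu : C.IsAbelJacobi ζ u) (hne : fsDist C.α ζ ≠ fsDist C.β ζ) :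
    HasValueAt (jacobiCn C.k) (C.arg (u - conj u))
      (C.k' * Real.cos ((fsDist C.α ζ - fsDist C.β ζ) / 2) /
        (C.k * Real.sin ((fsDist C.α ζ - fsDist C.β ζ) / 2))) := by
  have hr := (C.rcn_eq_zero_iff hu).not.2 hne
  have hc := C.cos_pos_of_isAbelJacobi hu
  have hk' := C.k'_pos
  rw [jacobiCn_eq C.k_pos C.k'_pos C.k_sq_add_sq, arg_sub_conj]
  refine ⟨analyticAt_ccn C.k_pos C.k'_pos C.k_sq_add_sq ?_, ?_⟩
  · rw [jacobiDen_mul_I C.k'_pos C.k_sq_add_sq]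
    exact pow_ne_zero 2 hr
  · rw [ccn_mul_I C.k'_pos C.k_sq_add_sq, ← (C.duplication_im hu).2,
      div_mul_cancel_right₀ (by positivity)]
    push_cast
    rw [one_div]

theorem hasValueAt_dn_sub (hu : C.IsAbelJacobi ζ u) (hne : fsDist C.α ζ ≠ fsDist C.β ζ) :
    HasValueAt (jacobiDn C.k) (C.arg (u - conj u))
      (C.k' / Real.sin ((fsDist C.α ζ - fsDist C.β ζ) / 2)) := by
  have hr := (C.rcn_eq_zero_iff hu).not.2 hne
  have hs := (fsDist_eq_iff _ _ _).not.1 hne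
  have hc := C.cos_pos_of_isAbelJacobi hu
  have hk := C.k_pos
  obtain ⟨h1, h2⟩ := C.duplication_im hu
  rw [jacobiDn_eq C.k_pos C.k'_pos C.k_sq_add_sq, arg_sub_conj]
  refine ⟨analyticAt_cdn C.k_pos C.k'_pos C.k_sq_add_sq ?_, ?_⟩
  · rw [jacobiDen_mul_I C.k'_pos C.k_sq_add_sq]
    exact pow_ne_zero 2 hr
  · rw [cdn_mul_I C.k'_pos C.k_sq_add_sq, ← Complex.ofReal_div, Complex.ofReal_inj,
      div_eq_div_iff hr hs]
    apply mul_left_cancel₀ (mul_pos hk hc).ne'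
    linear_combination C.k * Real.sin ((fsDist C.α ζ - fsDist C.β ζ) / 2) * h1 - C.k * h2

theorem hasPoleAt_sub (hu : C.IsAbelJacobi ζ u) (heq : fsDist C.α ζ = fsDist C.β ζ) :
    HasPoleAt (jacobiCn C.k) (C.arg (u - conj u)) ∧
      HasPoleAt (jacobiDn C.k) (C.arg (u - conj u)) := by
  have hD : jacobiDen C.k C.k' (C.arg (u - conj u)) = 0 := by
    rw [arg_sub_conj, jacobiDen_mul_I C.k'_pos C.k_sq_add_sq, (C.rcn_eq_zero_iff hu).2 heq]
    norm_num
  rw [jacobiCn_eq C.k_pos C.k'_pos C.k_sq_add_sq, jacobiDn_eq C.k_pos C.k'_pos C.k_sq_add_sq]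
  exact ⟨(ccn_pole C.k_pos C.k'_pos C.k_sq_add_sq hD).1,
    (cdn_pole C.k_pos C.k'_pos C.k_sq_add_sq hD).1⟩

theorem IsAbelJacobi.add_mul_two_ω (hu : C.IsAbelJacobi ζ u) (m : ℤ) :
    C.IsAbelJacobi ζ (u + m * (2 * (C.ω : ℂ))) := by
  have hl : (m * (2 * (C.ω : ℂ)) : ℂ) ∈ C.Λ := C.mem_Λ.2 ⟨m, 0, by simp⟩
  rw [IsAbelJacobi, wp, Submodule.add_mem_iff_left _ hl,
    C.periods.weierstrassP_add_coe u ⟨_, hl⟩]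
  exact hu

theorem IsAbelJacobi.neg (hu : C.IsAbelJacobi ζ u) : C.IsAbelJacobi ζ (-u) := by
  rw [IsAbelJacobi, wp, neg_mem_iff, C.periods.weierstrassP_neg]
  exact hu

theorem exists_isAbelJacobi (ζ : OnePoint ℂ) : ∃ u, C.IsAbelJacobi ζ u := by
  by_cases h : ζ = C.β
  · exact ⟨0, by rw [IsAbelJacobi, wp, X, if_pos (zero_mem _), if_pos h]⟩
  · obtain ⟨u, hu, hX⟩ := C.periods.exists_weierstrassP_eq
      ((C.e₃ : ℂ) + ((C.e₁ : ℂ) - C.e₃) * crossRatio ζ (antipode C.α) C.α C.β)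
    have hu' : u ∉ C.Λ := hu
    exact ⟨u, by rw [IsAbelJacobi, wp, X, if_neg hu', if_neg h, hX]⟩

theorem ω_pos : 0 < C.ω := div_pos C.K_pos C.sqrt_ρ_pos

/-- Reduction modulo `2ω` brings the real part into `[-ω, ω]`, and `u ↦ -u` then makes it
nonpositive. -/
theorem exists_isAbelJacobi_re (ζ : OnePoint ℂ) :
    ∃ u, C.IsAbelJacobi ζ u ∧ -C.ω ≤ u.re ∧ u.re ≤ 0 := by
  obtain ⟨u, hu⟩ := C.exists_isAbelJacobi ζ
  have hω := C.ω_pos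
  have h := abs_le.1 (abs_sub_round (u.re / (2 * C.ω)))
  have hv := hu.add_mul_two_ω C (-round (u.re / (2 * C.ω)))
  set n := round (u.re / (2 * C.ω))
  set v := u + (-n : ℤ) * (2 * (C.ω : ℂ)) with hvd
  have hre : v.re = (u.re / (2 * C.ω) - n) * (2 * C.ω) := by
    rw [sub_mul, div_mul_cancel₀ _ (by positivity), hvd]
    simp
    ring
  have h1 : -C.ω ≤ v.re := by rw [hre]; nlinarith [h.1]
  have h2 : v.re ≤ C.ω := by rw [hre]; nlinarith [h.2]
  rcases le_total v.re 0 with h3 | h3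
  · exact ⟨v, hv, h1, h3⟩
  · exact ⟨-v, hv.neg C, by simpa using h2, by simpa using h3⟩

/-- The strip condition says exactly `-K ≤ 2x + K ≤ K`, the range on which `ellipticF` inverts `sn`.
As `sin D = sn(2x + K)`, only `sin D` matters, not the choice of `D`. -/
theorem sub_eq_ellipticF (hu : C.IsAbelJacobi ζ u) {w : ℂ} (hw : conj u + w = C.ω₂)
    (h1 : -C.ω ≤ u.re) (h2 : u.re ≤ 0) {D : ℝ}
    (hD : Real.cos ((fsDist C.α ζ + fsDist C.β ζ) / 2) = C.k * Real.sin D) :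
    u - w = ((ellipticF (Real.sin D) C.k / √C.ρ : ℝ) : ℂ) + C.ω' := by
  have hρ := C.sqrt_ρ_pos
  have hK : ellipticK C.k = √C.ρ * C.ω := by rw [ω]; field_simp
  have hX : (C.arg u).re = √C.ρ * u.re := by rw [arg, Complex.re_ofReal_mul]
  rw [← C.k_mul_rsn_add hu, mul_right_inj' C.k_pos.ne'] at hD
  rw [← hD, ellipticF_rsn C.k_sq_lt_one (by rw [hX, hK]; nlinarith) (by rw [hX, hK]; nlinarith),
    eq_sub_of_add_eq' hw, hX, hK, ω₂]
  have h3 := Complex.add_conj u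
  rw [show 2 * (√C.ρ * u.re) + √C.ρ * C.ω = √C.ρ * (2 * u.re + C.ω) by ring,
    mul_div_cancel_left₀ _ hρ.ne']
  push_cast at h3 ⊢
  linear_combination h3

end O4Multiplet

/-! ### Assembly of the theorem -/

theorem mainTheorem3 (C : O4Multiplet) (ζ : OnePoint ℂ) :
    let δα := fsDist C.α ζ
    let δβ := fsDist C.β ζ
    let δ := fsDist C.α C.β
    let s : ℂ := ((√C.ρ : ℝ) : ℂ)
    let sn := jacobiSn C.k
    let cn := jacobiCn C.k
    let dn := jacobiDn C.k
    -- `cn` and `dn` of `√ρ (u_ζ ± conj u_ζ)`; for `δα + δβ = π` the tangent in the denominator is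
    -- infinite and the ratio of tangents is `0`
    (∀ u : ℂ, C.IsAbelJacobi ζ u →
      HasValueAt cn (s * (u + conj u)) (Real.tan (δ / 2) / Real.tan ((δα + δβ) / 2)) ∧
      HasValueAt dn (s * (u + conj u)) (Real.sin (δ / 2) / Real.sin ((δα + δβ) / 2)) ∧
      (δα ≠ δβ →
        HasValueAt cn (s * (u - conj u)) (Real.tan (δ / 2) / Real.tan ((δα - δβ) / 2)) ∧
        HasValueAt dn (s * (u - conj u)) (Real.sin (δ / 2) / Real.sin ((δα - δβ) / 2)) ∧
        HasValueAt cn (s * (u + conj u))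
          (C.k' / C.k * ((chordK C.α ζ * chordK' C.α ζ - chordK C.β ζ * chordK' C.β ζ) /
            (chordK' C.α ζ ^ 2 - chordK' C.β ζ ^ 2))) ∧
        HasValueAt cn (s * (u - conj u))
          (C.k' / C.k * ((chordK C.α ζ * chordK' C.α ζ + chordK C.β ζ * chordK' C.β ζ) /
            (chordK' C.α ζ ^ 2 - chordK' C.β ζ ^ 2))) ∧
        HasValueAt dn (s * (u + conj u))
          (C.k' * ((chordK C.β ζ * chordK' C.α ζ - chordK C.α ζ * chordK' C.β ζ) /
            (chordK C.β ζ ^ 2 - chordK C.α ζ ^ 2))) ∧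
        HasValueAt dn (s * (u - conj u))
          (C.k' * ((chordK C.β ζ * chordK' C.α ζ + chordK C.α ζ * chordK' C.β ζ) /
            (chordK C.β ζ ^ 2 - chordK C.α ζ ^ 2)))) ∧
      (δα = δβ → HasPoleAt cn (s * (u - conj u)) ∧ HasPoleAt dn (s * (u - conj u)))) ∧
    -- the real structure `conj u_ζ + u_{-1/conj ζ} = ω₂`
    (∀ u : ℂ, C.IsAbelJacobi ζ u → C.IsAbelJacobi (antipode ζ) (C.ω₂ - conj u)) ∧
    -- `sn` of `√ρ u_ζ^±` and `√ρ (u_ζ^± - ω')` for all representatives in `ℂ`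
    (∀ u w : ℂ, C.IsAbelJacobi ζ u → C.IsAbelJacobi (antipode ζ) w →
      ∀ m m' : ℤ, conj u + w = C.ω₂ + m * (2 * (C.ω : ℂ)) + m' * (2 * C.ω') →
        HasValueAt sn (s * (u + w)) (-(-1) ^ m * (1 / Real.cos ((δα - δβ) / 2))) ∧
        (δα + δβ ≠ Real.pi →
          HasValueAt sn (s * (u - w)) ((-1) ^ m * (1 / Real.cos ((δα + δβ) / 2)))) ∧
        (δα + δβ = Real.pi → HasPoleAt sn (s * (u - w))) ∧
        HasValueAt sn (s * (u + w - C.ω'))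
          (-(-1) ^ m * (Real.cos ((δα - δβ) / 2) / Real.cos (δ / 2))) ∧
        HasValueAt sn (s * (u - w - C.ω'))
          ((-1) ^ m * (Real.cos ((δα + δβ) / 2) / Real.cos (δ / 2)))) ∧
    -- the classes of `u_ζ^±` modulo `Λ` have representatives for which all signs are `+`
    (∀ u w : ℂ, C.IsAbelJacobi ζ u → C.IsAbelJacobi (antipode ζ) w →
      conj u + w - C.ω₂ ∈ C.Λ →
        ∃ up um : ℂ, up - (u + w) ∈ C.Λ ∧ um - (u - w) ∈ C.Λ ∧
          HasValueAt sn (s * up) (1 / Real.cos ((δα - δβ) / 2)) ∧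
          (δα + δβ ≠ Real.pi → HasValueAt sn (s * um) (1 / Real.cos ((δα + δβ) / 2))) ∧
          (δα + δβ = Real.pi → HasPoleAt sn (s * um)) ∧
          HasValueAt sn (s * (up - C.ω')) (Real.cos ((δα - δβ) / 2) / Real.cos (δ / 2)) ∧
          HasValueAt sn (s * (um - C.ω')) (Real.cos ((δα + δβ) / 2) / Real.cos (δ / 2))) ∧
    -- `u_ζ^- = F(sin D_ζ, k) / √ρ + ω'`, where `sin ((π - δα - δβ) / 2) / sin D_ζ = k`
    (∃ D : ℝ, Real.sin ((Real.pi - δα - δβ) / 2) = C.k * Real.sin D) ∧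
    (∀ D : ℝ, Real.sin ((Real.pi - δα - δβ) / 2) = C.k * Real.sin D →
      (∃ u w : ℂ, C.IsAbelJacobi ζ u ∧ C.IsAbelJacobi (antipode ζ) w ∧ conj u + w = C.ω₂ ∧
        -C.ω ≤ u.re ∧ u.re ≤ 0) ∧
      (∀ u w : ℂ, C.IsAbelJacobi ζ u → C.IsAbelJacobi (antipode ζ) w → conj u + w = C.ω₂ →
        -C.ω ≤ u.re → u.re ≤ 0 →
          u - w = ((ellipticF (Real.sin D) C.k / √C.ρ : ℝ) : ℂ) + C.ω')) := by
  intro δα δβ δ s sn cn dn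
  have hk := C.k_pos
  have hk' := C.k'_pos
  have hδ : Real.cos (δ / 2) = C.k := C.cos_fsDist_α_β
  have hsin : Real.sin ((Real.pi - δα - δβ) / 2) = Real.cos ((δα + δβ) / 2) := by
    rw [← Real.sin_pi_div_two_sub]
    congr 1
    ring
  have main : ∀ u w : ℂ, C.IsAbelJacobi ζ u →
      ∀ m m' : ℤ, conj u + w = C.ω₂ + m * (2 * (C.ω : ℂ)) + m' * (2 * C.ω') →
        HasValueAt sn (s * (u + w)) (-(-1) ^ m * (1 / Real.cos ((δα - δβ) / 2))) ∧
        (δα + δβ ≠ Real.pi →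
          HasValueAt sn (s * (u - w)) ((-1) ^ m * (1 / Real.cos ((δα + δβ) / 2)))) ∧
        (δα + δβ = Real.pi → HasPoleAt sn (s * (u - w))) ∧
        HasValueAt sn (s * (u + w - C.ω'))
          (-(-1) ^ m * (Real.cos ((δα - δβ) / 2) / Real.cos (δ / 2))) ∧
        HasValueAt sn (s * (u - w - C.ω'))
          ((-1) ^ m * (Real.cos ((δα + δβ) / 2) / Real.cos (δ / 2))) := by
    intro u w hu m m' h
    have h1 := C.hasValueAt_sn_add hu (x := u + w) (m := m) (n := m') (by linear_combination h)
    -- The difference `u - w` carries the opposite periods; the sign is unaffected because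
    -- `(-1)^(-m) = (-1)^m`.
    have h2 := C.hasValueAt_sn_sub hu (x := u - w) (m := -m) (n := -m') (by
      push_cast
      linear_combination -h)
    rw [zpow_neg, ← inv_zpow, inv_neg, inv_one] at h2
    rw [hδ]
    exact ⟨h1.1, h2.1, h2.2.1, h1.2, h2.2.2⟩
  refine ⟨fun u hu => ⟨?_, ?_, fun hne => ?_, fun heq => C.hasPoleAt_sub hu heq⟩,
    fun u hu => C.isAbelJacobi_antipode hu, fun u w hu _ => main u w hu, fun u w hu hw hΛ => ?_,
    ?_, fun D hD => ⟨?_, fun u w hu _ h h1 h2 => C.sub_eq_ellipticF hu h h1 h2 (hsin ▸ hD)⟩⟩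
  · rw [C.tan_fsDist_div_tan]
    exact C.hasValueAt_cn_add hu
  · rw [C.sin_fsDist_α_β]
    exact C.hasValueAt_dn_add hu
  · have ha := chordK_sq_add_sq C.α ζ
    have hb := chordK_sq_add_sq C.β ζ
    have hS := (C.sin_pos_of_isAbelJacobi hu).ne'
    have hD := (fsDist_eq_iff _ _ _).not.1 hne
    have c1 := C.hasValueAt_cn_add hu
    have c2 := C.hasValueAt_cn_sub hu hne
    have d1 := C.hasValueAt_dn_add hu
    have d2 := C.hasValueAt_dn_sub hu hne
    rw [C.tan_fsDist_div_tan, C.sin_fsDist_α_β]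
    refine ⟨c2, d2, ?_⟩
    rw [add_div, Real.sin_add] at hS
    rw [sub_div, Real.sin_sub] at hD
    rw [add_div, Real.sin_add] at c1 d1
    rw [sub_div, Real.sin_sub] at c2 d2
    rw [Real.cos_add] at c1
    rw [Real.cos_sub] at c2
    simp only [cos_fsDist_half, sin_fsDist_half] at hS hD c1 c2 d1 d2
    set a := chordK C.α ζ
    set a' := chordK' C.α ζ
    set b := chordK C.β ζ
    set b' := chordK' C.β ζ
    -- This is `sin² A - sin² B = sin (A + B) sin (A - B)` for the half-distances `A`, `B`; it puts
    -- the chordal and trigonometric fractions over comparable denominators.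
    have e1 : a' ^ 2 - b' ^ 2 = (a' * b + a * b') * (a' * b - a * b') := by
      linear_combination b' ^ 2 * ha - a' ^ 2 * hb
    have e2 : b ^ 2 - a ^ 2 = (a' * b + a * b') * (a' * b - a * b') := by
      linear_combination (b' ^ 2 - 1) * ha - (a' ^ 2 - 1) * hb
    rw [e1, e2]
    refine ⟨?_, ?_, ?_, ?_⟩
    · refine Eq.mp (congrArg (HasValueAt _ _) ?_) c1
      rw [div_mul_div_comm, div_eq_div_iff (mul_ne_zero hk.ne' hS)
        (mul_ne_zero hk.ne' (mul_ne_zero hS hD))]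
      linear_combination C.k' * C.k * (a' * b + a * b') * (a * a' * hb - b * b' * ha)
    · refine Eq.mp (congrArg (HasValueAt _ _) ?_) c2
      rw [div_mul_div_comm, div_eq_div_iff (mul_ne_zero hk.ne' hD)
        (mul_ne_zero hk.ne' (mul_ne_zero hS hD))]
      linear_combination C.k' * C.k * (a' * b - a * b') * (a * a' * hb + b * b' * ha)
    · refine Eq.mp (congrArg (HasValueAt _ _) ?_) d1
      field_simp
    · refine Eq.mp (congrArg (HasValueAt _ _) ?_) d2
      field_simp
  · obtain ⟨m, m', h⟩ := C.mem_Λ.1 hΛ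
    -- The shifts by `2ω` leave one such period in `u^+`, cancelling its minus sign, and none in
    -- `u^-`.
    have h1 := C.hasValueAt_sn_add hu (x := u + w + (1 - m) * (2 * (C.ω : ℂ))) (m := 1) (n := m')
      (by push_cast; linear_combination -h)
    have h2 := C.hasValueAt_sn_sub hu (x := u - w + m * (2 * (C.ω : ℂ))) (m := 0) (n := -m')
      (by push_cast; linear_combination h)
    simp only [zpow_one, zpow_zero, neg_neg, one_mul] at h1 h2
    rw [hδ]
    exact ⟨_, _, C.mem_Λ.2 ⟨1 - m, 0, by push_cast; ring⟩, C.mem_Λ.2 ⟨m, 0, by push_cast; ring⟩,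
      h1.1, h2.1, h2.2.1, h1.2, h2.2.2⟩
  · obtain ⟨u, hu⟩ := C.exists_isAbelJacobi ζ
    -- The angle is `D = am(2x + K)`, since `rsn` is by definition the sine of the amplitude.
    exact ⟨_, hsin.trans (C.k_mul_rsn_add hu).symm⟩
  · obtain ⟨u, hu, h1, h2⟩ := C.exists_isAbelJacobi_re ζ
    exact ⟨u, _, hu, C.isAbelJacobi_antipode hu, by ring, h1, h2⟩

end
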